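/- **Notation.** Points of frequency space $\mathbb{R}^3$ are written $(\xi,\mu,\tau)$, points of physical space $(x,y,t)$. For $\xi\neq 0$ let $\omega(\xi,\mu)=\xi^3+\mu^2/\xi$. For $k\in\mathbb{Z}$ let $k_+=\max(k,0)$ and $I_k=\{\xi\in\mathbb{R}:|\xi|\in[2^{k-1},2^{k+1}]\}$. Fix an even smooth function $\mu_0:\mathbb{R}\to[0,1]$ supported in $[-8/5,8/5]$ and equal to $1$ on $[-5/4,5/4]$; let $\chi_k(\xi)=\mu_0(\xi/2^k)-\mu_0(\xi/2^{k-1})$ for $k\in\mathbb{Z}$, and $\mu_j=\chi_j$ for integers $j\ge 1$. Let $$\mathcal{F}^{-1}(g)(x,y,t)=(2\pi)^{-3}\int_{\mathbb{R}^3}e^{i(x\xi+y\mu+t\tau)}g(\xi,\mu,\tau)\,d\xi\,d\mu\,d\tau ,$$ extended to $L^2(\mathbb{R}^3)$ as usual, and let $$R_{KP\text{-}I}=\{(\xi,\mu,\tau):|\xi|\ge1,\ |\mu|\in[2^{-20}|\xi|^2,2^{20}|\xi|^2],\ |\tau-\omega(\xi,\mu)|\le|\xi|\}.$$ All functions below are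 complex-valued functions in $L^2(\mathbb{R}^3)$ supported in $I_k\times\mathbb{R}\times\mathbb{R}$, and each space consists of those for which the indicated norm is finite. - $X_k$: $\displaystyle \|f\|_{X_k}=\sum_{j=0}^{2k_+-1}2^{j/2}\|\mu_j(\tau-\omega)f\|_{L^2}+\Big[\sum_{j\ge 2k_+}2^{2j-2k_+}\|\mu_j(\tau-\omega)f\|_{L^2}^2\Big]^{1/2}$. - $Y_k$, for $k\ge100$: $f$ is in addition supported in $R_{KP\text{-}I}$, and $\|f\|_{Y_k}=2^{-k/2}\|\mathcal{F}^{-1}[(\tau-\omega+i)f]\|_{L^1_yL^2_{x,t}}$. For $k\le99$, $Y_k=\{0\}$. - $X_k+Y_k$: $\|f\|_{X_k+Y_k}=\inf\{\|f_1\|_{X_k}+\|f_2\|_{Y_k}: f=f_1+f_2\}$. - $V_k$: $\|f\|_{V_k}=\|(1+2^k+i\mu/2^k)f\|_{X_k+Y_k}$. - $W_k$: $\|f\|_{W_k}=\|(\partial_\mu+I)f\|_{X_k+Y_k}$, where $\partial_\mu$ is the weak derivative and $I$ the identity. - $V_k\cap W_k$: $\|f\|_{V_k\cap W_k}=\max(\|f\|_{V_k},\|f\|_{W_k})$.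 **Proposition.** There is a constant $C$, depending only on the choice of $\mu_0$, such that the following holds. Let $k_1,k_2\in\mathbb{Z}$ with $|k_1-k_2|\le100$, and let $f_{k_1}\in V_{k_1}\cap W_{k_1}$ and $f_{k_2}\in V_{k_2}\cap W_{k_2}$. Then for every $k\in\mathbb{Z}$ the function $2^k\chi_k(\xi)(\tau-\omega(\xi,\mu)+i)^{-1}(f_{k_1}*f_{k_2})$ belongs to $V_k\cap W_k$, and $$\Big[\sum_{k\in\mathbb{Z}}\big\|2^k\chi_k(\xi)(\tau-\omega(\xi,\mu)+i)^{-1}(f_{k_1}*f_{k_2})\big\|_{V_k\cap W_k}^2\Big]^{1/2}\le C\,\|f_{k_1}\|_{V_{k_1}\cap W_{k_1}}\|f_{k_2}\|_{V_{k_2}\cap W_{k_2}} .$$ -/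

import Mathlib

open scoped ENNReal NNReal FourierTransform Convolution ContDiff

noncomputable section

namespace KPI

/-- Euclidean space `ℝ³`. On the frequency side a point is `p = (ξ, μ, τ)`, on the physical side
`p = (x, y, t)`; the coordinates are `p 0`, `p 1`, `p 2` in this order. -/
abbrev R3 : Type := EuclideanSpace ℝ (Fin 3)

/-- The hypotheses on the basic cutoff `μ₀ : ℝ → [0,1]`: smooth, even, supported in
`[-8/5, 8/5]` and equal to `1` on `[-5/4, 5/4]`. -/
structure IsBasicCutoff (μ₀ : ℝ → ℝ) : Prop where
  smooth : ContDiff ℝ ∞ μ₀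
  even : ∀ s, μ₀ (-s) = μ₀ s
  mem_Icc : ∀ s, μ₀ s ∈ Set.Icc (0 : ℝ) 1
  support_subset : Function.support μ₀ ⊆ Set.Icc (-8 / 5) (8 / 5)
  eq_one : ∀ s ∈ Set.Icc (-5 / 4 : ℝ) (5 / 4), μ₀ s = 1

/-- `χ_k(ξ) = μ₀(ξ/2^k) - μ₀(ξ/2^{k-1})`, `k ∈ ℤ`. -/
def chi (μ₀ : ℝ → ℝ) (k : ℤ) (ξ : ℝ) : ℝ :=
  μ₀ (ξ / (2 : ℝ) ^ k) - μ₀ (ξ / (2 : ℝ) ^ (k - 1))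

/-- The modulation cutoffs `μ_j`, `j ≥ 0`: `μ_0` is the basic cutoff, `μ_j = χ_j` for `j ≥ 1`. -/
def muCut (μ₀ : ℝ → ℝ) (j : ℕ) (s : ℝ) : ℝ :=
  if j = 0 then μ₀ s else chi μ₀ (j : ℤ) s

/-- `I_k = {ξ : |ξ| ∈ [2^{k-1}, 2^{k+1}]}`. -/
def I (k : ℤ) : Set ℝ := {ξ | |ξ| ∈ Set.Icc ((2 : ℝ) ^ (k - 1)) ((2 : ℝ) ^ (k + 1))}

/-- The dispersion function `ω(ξ, μ) = ξ³ + μ²/ξ` (it is only relevant for `ξ ≠ 0`). -/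
def omega (ξ μ : ℝ) : ℝ := ξ ^ 3 + μ ^ 2 / ξ

/-- The modulation `τ - ω(ξ, μ)` of the frequency point `p = (ξ, μ, τ)`. -/
def modulation (p : R3) : ℝ := p 2 - omega (p 0) (p 1)

/-- The multiplier `τ - ω(ξ, μ) + i`. -/
def symb (p : R3) : ℂ := (modulation p : ℂ) + Complex.I

/-- The KP-I region. -/
def RKPI : Set R3 :=
  {p | 1 ≤ |p 0| ∧ |p 1| ∈ Set.Icc (|p 0| ^ 2 / 2 ^ 20) (2 ^ 20 * |p 0| ^ 2) ∧
    |modulation p| ≤ |p 0|}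

/-- `f` is supported in the set `S` (up to a null set; elements of `L²` are functions modulo
null sets). -/
def SupportedIn (f : R3 → ℂ) (S : Set R3) : Prop :=
  ∀ᵐ p ∂(MeasureTheory.volume : MeasureTheory.Measure R3), p ∉ S → f p = 0

/-- The slab `I_k × ℝ × ℝ`. -/
def slab (k : ℤ) : Set R3 := {p | p 0 ∈ I k}

/-- `f ∈ L²(ℝ³)` and `f` is supported in `I_k × ℝ × ℝ`. -/
def IsL2Slab (k : ℤ) (f : R3 → ℂ) : Prop :=
  MeasureTheory.MemLp f 2 MeasureTheory.volume ∧ SupportedIn f (slab k)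

/-- The `L²` norm on `ℝ³`, with values in `[0, ∞]`. -/
def L2norm (f : R3 → ℂ) : ℝ≥0∞ := MeasureTheory.eLpNorm f 2 MeasureTheory.volume

/-- The mixed norm `‖G‖_{L¹_y L²_{x,t}}`, with values in `[0, ∞]`. -/
def L1yL2xt (G : R3 → ℂ) : ℝ≥0∞ :=
  ∫⁻ y : ℝ, (∫⁻ x : ℝ, ∫⁻ t : ℝ, ‖G !₂[x, y, t]‖ₑ ^ (2 : ℝ)) ^ (1 / 2 : ℝ)

/-- The inverse Fourier transform of `g ∈ L²(ℝ³)`, normalized as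
`𝓕⁻¹(g)(x,y,t) = (2π)⁻³ ∫ e^{i(xξ + yμ + tτ)} g(ξ,μ,τ) dξ dμ dτ`. Mathlib's `𝓕⁻` has the kernel
`e^{2πi⟨x,ξ⟩}`, so it has to be rescaled. -/
def invFourier (g : R3 → ℂ) (hg : MeasureTheory.MemLp g 2 (MeasureTheory.volume : MeasureTheory.Measure R3)) (p : R3) : ℂ :=
  (((2 * Real.pi) ^ 3)⁻¹ : ℝ) •
    (𝓕⁻ (hg.toLp g) : MeasureTheory.Lp (α := R3) ℂ 2 MeasureTheory.volume) ((2 * Real.pi)⁻¹ • p)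

/-! The norms below are extended norms: they are defined on all functions and equal `∞` exactly
on those which do not belong to the space. -/

open Classical in
/-- The norm of `X_k`:
`∑_{0 ≤ j < 2k₊} 2^{j/2} ‖μ_j(τ-ω) f‖_{L²} + [∑_{j ≥ 2k₊} 2^{2j-2k₊} ‖μ_j(τ-ω) f‖²_{L²}]^{1/2}`,
where `k₊ = max(k, 0)`. -/
def Xnorm (μ₀ : ℝ → ℝ) (k : ℤ) (f : R3 → ℂ) : ℝ≥0∞ :=
  if IsL2Slab k f then
    (∑ j ∈ Finset.range (2 * k.toNat),
        (2 : ℝ≥0∞) ^ ((j : ℝ) / 2) *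
          L2norm (fun p => (muCut μ₀ j (modulation p) : ℂ) * f p)) +
      (∑' j : Set.Ici (2 * k.toNat),
        (2 : ℝ≥0∞) ^ (2 * (j : ℝ) - 2 * (k.toNat : ℝ)) *
          L2norm (fun p => (muCut μ₀ j (modulation p) : ℂ) * f p) ^ (2 : ℝ)) ^ (1 / 2 : ℝ)
  else ⊤

open Classical in
/-- The norm of `Y_k`. For `k ≥ 100` the space consists of the `f ∈ L²` supported in
`R_{KP-I} ∩ (I_k × ℝ × ℝ)` with
`‖f‖_{Y_k} = 2^{-k/2} ‖𝓕⁻¹[(τ - ω + i) f]‖_{L¹_y L²_{x,t}}` finite; for such `f` the function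
`(τ - ω + i) f` is in `L²` because `|τ - ω| ≤ |ξ| ≤ 2^{k+1}` on the support. For `k ≤ 99` the space
is `{0}`. -/
def Ynorm (k : ℤ) (f : R3 → ℂ) : ℝ≥0∞ :=
  if 100 ≤ k then
    if h : MeasureTheory.MemLp f 2 MeasureTheory.volume ∧ SupportedIn f (RKPI ∩ slab k) ∧
        MeasureTheory.MemLp (fun p => symb p * f p) 2 MeasureTheory.volume then
      (2 : ℝ≥0∞) ^ (-(k : ℝ) / 2) * L1yL2xt (invFourier (fun p => symb p * f p) h.2.2)
    else ⊤
  else if SupportedIn f ∅ then 0 else ⊤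

/-- The norm of `X_k + Y_k`: the infimum of `‖f₁‖_{X_k} + ‖f₂‖_{Y_k}` over all decompositions
`f = f₁ + f₂`. -/
def XYnorm (μ₀ : ℝ → ℝ) (k : ℤ) (f : R3 → ℂ) : ℝ≥0∞ :=
  ⨅ (f₁ : R3 → ℂ) (f₂ : R3 → ℂ) (_ : f =ᵐ[MeasureTheory.volume] f₁ + f₂),
    Xnorm μ₀ k f₁ + Ynorm k f₂

open Classical in
/-- The norm of `V_k`: `‖f‖_{V_k} = ‖(1 + 2^k + iμ/2^k) f‖_{X_k + Y_k}`. -/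
def Vnorm (μ₀ : ℝ → ℝ) (k : ℤ) (f : R3 → ℂ) : ℝ≥0∞ :=
  if IsL2Slab k f then
    XYnorm μ₀ k (fun p => f p * (1 + (2 : ℂ) ^ k + Complex.I * (p 1 : ℂ) / (2 : ℂ) ^ k))
  else ⊤

/-- The unit vector of the `μ`-direction. -/
def eMu : R3 := EuclideanSpace.single 1 1

/-- `g` is the weak (distributional) derivative `∂_μ f` on `ℝ³`. -/
def IsWeakDerivMu (f g : R3 → ℂ) : Prop :=
  MeasureTheory.LocallyIntegrable f MeasureTheory.volume ∧
  MeasureTheory.LocallyIntegrable g MeasureTheory.volume ∧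
  ∀ φ : R3 → ℂ, ContDiff ℝ ∞ φ → HasCompactSupport φ →
    ∫ p, f p * fderiv ℝ φ p eMu = - ∫ p, g p * φ p

open Classical in
/-- The norm of `W_k`: `‖f‖_{W_k} = ‖(∂_μ + I) f‖_{X_k + Y_k}`, where `I` is the identity. The weak
derivative is unique up to a null set, so the infimum is over a single class of functions, and it
is `∞` when there is no weak derivative. -/
def Wnorm (μ₀ : ℝ → ℝ) (k : ℤ) (f : R3 → ℂ) : ℝ≥0∞ :=
  if IsL2Slab k f then
    ⨅ (g : R3 → ℂ) (_ : IsWeakDerivMu f g), XYnorm μ₀ k (g + f)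
  else ⊤

/-- The norm of `V_k ∩ W_k`, the maximum of the two norms. -/
def VWnorm (μ₀ : ℝ → ℝ) (k : ℤ) (f : R3 → ℂ) : ℝ≥0∞ := max (Vnorm μ₀ k f) (Wnorm μ₀ k f)

/-- The space `V_k`. -/
def V (μ₀ : ℝ → ℝ) (k : ℤ) : Set (R3 → ℂ) := {f | Vnorm μ₀ k f < ⊤}

/-- The space `W_k`. -/
def W (μ₀ : ℝ → ℝ) (k : ℤ) : Set (R3 → ℂ) := {f | Wnorm μ₀ k f < ⊤}

/-- The convolution `(f ∗ g)(p) = ∫ f(q) g(p - q) dq` on `ℝ³`. -/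
def conv (f g : R3 → ℂ) : R3 → ℂ :=
  f ⋆[ContinuousLinearMap.mul ℂ ℂ, MeasureTheory.volume] g

/-- The function `2^k χ_k(ξ) (τ - ω(ξ,μ) + i)⁻¹ h(ξ,μ,τ)`. -/
def outputPiece (μ₀ : ℝ → ℝ) (k : ℤ) (h : R3 → ℂ) (p : R3) : ℂ :=
  (2 : ℂ) ^ k * (chi μ₀ k (p 0) : ℂ) * (symb p)⁻¹ * h p

end KPI

end

/-! The whole estimate rests on one linear inequality, `exists_eLpNorm_ift_four_le_XYnorm`: the `L⁴`
norm of the inverse Fourier transform is bounded by the norm of `X_k + Y_k`, uniformly in `k`. Since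
`f * g` is the Fourier transform of a product, Hölder then puts convolutions in `L²`
(`memLp_conv_of_ift_four`). The outputs carry the factor `(τ - ω + i)⁻¹`, and this factor times an
`L²` function is always in `X_k` (`exists_Xnorm_le`), so `Y_k` matters only for the inputs.

For `X_k` the inequality is a Strichartz estimate. For frequencies with a fixed sign of `ξ` and
modulation at most `M`, Cauchy-Schwarz bounds `‖f * f‖₂` by the square root of the measure of pairs
of frequencies with a prescribed sum. Completing squares turns the resonance relation into an
elliptic annulus whose area does not depend on the frequencies (`volume_resonantSet_le`), and
`eLpNorm_ift_four_le_of_layer` follows. Dyadic pieces are summed with weights `2^{j/2}`.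

For `Y_k` write `f = (τ - ω + i)⁻¹ g`. By duality, `L¹_y L²` control of `𝓕⁻ g` reduces the claim to
an `L⁴` bound for symbols `F(ξ,τ)/(τ - ω + i)` with `F` in `L²`, with gain `2^{-k/2}`. Partial
fractions in `μ` give terms `b/(N - μ)` with `N` off the real axis. The physical side of such a term
lives in a half space `±y > 0`, and replacing `N` by its conjugate moves it to the opposite one. So
the term is pointwise dominated by the difference of the two (`eLpNorm_ift_resolvent_le`), a Poisson
kernel symbol that decays quadratically in `μ`. This decay pays for a weight `|τ - ω + i|^{5/8}` in
`L²`, and since the exponent exceeds `1/2` the Strichartz estimate for dyadic modulations applies.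

The `V_k` weight is inverted by averaging translations, which acts on `L⁴` (`eLpNorm_ift_div_le`).
Hence `f`, `μ f` and `∂_μ f` have `L⁴` bounds of size `(1 + 2^k)⁻¹`, `2^k` and `1`. A `μ` derivative
of the multiplier costs `2μ/(ξ(τ - ω + i))`, where `2^k/ξ` is bounded, so `f₁ * f₂`, `μ (f₁ * f₂)`
and `(∂_μ f₁) * f₂` dominate every output. Nonzero outputs have `2^k` at most a constant times
`2^{k₁}`, and the finite overlap of the `I_k` sums the squares. -/

noncomputable section

namespace KPI

open MeasureTheory SchwartzMap

/-! ### The inverse Fourier transform on `L²`, and products versus convolutions. -/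

section FourierL2

variable {E : Type*} [NormedAddCommGroup E] [InnerProductSpace ℝ E] [FiniteDimensional ℝ E]
  [MeasurableSpace E] [BorelSpace E]

open Classical in
/-- The inverse Fourier transform of a square integrable function, with the kernel `e^{2πi⟨x,ξ⟩}`,
and `0` for other functions. -/
def ift (f : E → ℂ) : E → ℂ :=
  if h : MemLp f 2 (volume : Measure E) then
    ((𝓕⁻ (h.toLp f) : Lp (α := E) ℂ 2 volume) : E → ℂ) else 0

theorem ift_eq {f : E → ℂ} (h : MemLp f 2 (volume : Measure E)) :
    ift f = ((𝓕⁻ (h.toLp f) : Lp (α := E) ℂ 2 volume) : E → ℂ) := dif_pos h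

theorem memLp_ift {f : E → ℂ} (h : MemLp f 2 (volume : Measure E)) :
    MemLp (ift f) 2 (volume : Measure E) := by
  rw [ift_eq h]; exact Lp.memLp _

theorem aestronglyMeasurable_ift (f : E → ℂ) :
    AEStronglyMeasurable (ift f) (volume : Measure E) := by
  unfold ift
  split_ifs
  · exact Lp.aestronglyMeasurable _
  · exact aestronglyMeasurable_zero

theorem eLpNorm_ift {f : E → ℂ} (h : MemLp f 2 (volume : Measure E)) :
    eLpNorm (ift f) 2 volume = eLpNorm f 2 (volume : Measure E) := by
  have : ‖(𝓕⁻ (h.toLp f) : Lp (α := E) ℂ 2 volume)‖ = ‖h.toLp f‖ :=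
    (Lp.fourierTransformₗᵢ E ℂ).symm.norm_map _
  rw [Lp.norm_def, Lp.norm_def, ENNReal.toReal_eq_toReal_iff' (Lp.eLpNorm_ne_top _)
    (Lp.eLpNorm_ne_top _)] at this
  rw [ift_eq h, this, eLpNorm_congr_ae h.coeFn_toLp]

theorem ift_congr {f g : E → ℂ} (h : f =ᵐ[volume] g) : ift f = ift g := by
  by_cases hf : MemLp f 2 (volume : Measure E)
  · have hg : MemLp g 2 (volume : Measure E) := hf.ae_eq h
    rw [ift_eq hf, ift_eq hg, MemLp.toLp_congr hf hg h]
  · have hg : ¬ MemLp g 2 (volume : Measure E) := fun hg => hf (hg.ae_eq h.symm)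
    simp [ift, hf, hg]

theorem ift_add {f g : E → ℂ} (hf : MemLp f 2 (volume : Measure E))
    (hg : MemLp g 2 (volume : Measure E)) : ift (f + g) =ᵐ[volume] ift f + ift g := by
  rw [ift_eq hf, ift_eq hg, ift_eq (hf.add hg), MemLp.toLp_add, FourierInvAdd.fourierInv_add]
  exact Lp.coeFn_add _ _

theorem ift_sub {f g : E → ℂ} (hf : MemLp f 2 (volume : Measure E))
    (hg : MemLp g 2 (volume : Measure E)) : ift (f - g) =ᵐ[volume] ift f - ift g := by
  have h := ift_add (hf.sub hg) hg
  rw [sub_add_cancel] at h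
  filter_upwards [h] with x hx
  simp [hx]

theorem ift_smul {f : E → ℂ} (c : ℂ) (hf : MemLp f 2 (volume : Measure E)) :
    ift (c • f) =ᵐ[volume] c • ift f := by
  have : (𝓕⁻ (c • hf.toLp f) : Lp (α := E) ℂ 2 volume) = c • 𝓕⁻ (hf.toLp f) :=
    (Lp.fourierTransformₗᵢ E ℂ).symm.map_smul c _
  rw [ift_eq hf, ift_eq (hf.const_smul c), MemLp.toLp_const_smul c hf, this]
  exact Lp.coeFn_smul _ _

theorem ift_zero : ift (0 : E → ℂ) =ᵐ[volume] 0 := by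
  have h := ift_smul (E := E) (f := 0) 0 MemLp.zero
  simpa using h

/-- Functions that agree against all Schwartz functions agree almost everywhere. -/
theorem ae_eq_of_integral_schwartz {f g : E → ℂ} (hf : LocallyIntegrable f (volume : Measure E))
    (hg : LocallyIntegrable g (volume : Measure E))
    (h : ∀ ψ : 𝓢(E, ℂ), ∫ x, f x * ψ x = ∫ x, g x * ψ x) : f =ᵐ[volume] g := by
  refine ae_eq_of_integral_contDiff_smul_eq hf hg fun φ hφ hc => ?_
  have h1 : HasCompactSupport (fun x => (φ x : ℂ)) := hc.comp_left (g := fun r : ℝ => (r : ℂ)) (by simp)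
  have h2 : ContDiff ℝ ∞ (fun x => (φ x : ℂ)) := Complex.ofRealCLM.contDiff.comp hφ
  simpa [mul_comm] using h (h1.toSchwartzMap h2)

/-- The `L²` inverse transform agrees with the one on tempered distributions, which is defined by
moving it to the test function. -/
theorem integral_ift_mul_schwartz {f : E → ℂ} (hf : MemLp f 2 (volume : Measure E)) (ψ : 𝓢(E, ℂ)) :
    ∫ x, ift f x * ψ x = ∫ x, f x * (𝓕⁻ ψ) x := by
  have h := DFunLike.congr_fun (Lp.fourierInv_toTemperedDistribution_eq (hf.toLp f)) ψ
  rw [TemperedDistribution.fourierInv_apply, Lp.toTemperedDistribution_apply,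
    Lp.toTemperedDistribution_apply] at h
  rw [ift_eq hf]
  simp only [smul_eq_mul] at h
  simp_rw [mul_comm _ (ψ _)]
  rw [← h]
  refine integral_congr_ae ?_
  filter_upwards [hf.coeFn_toLp] with x hx
  rw [hx, mul_comm]

theorem integrable_mul_L2 {f g : E → ℂ} (hf : MemLp f 2 (volume : Measure E))
    (hg : MemLp g 2 (volume : Measure E)) : Integrable (fun x => f x * g x) volume :=
  MemLp.integrable_mul hf hg

theorem continuous_integral_mul {f : E → ℂ} (hf : MemLp f 2 (volume : Measure E)) :
    Continuous (fun g : Lp (α := E) ℂ 2 volume => ∫ x, f x * g x) := by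
  have h : (fun g : Lp (α := E) ℂ 2 volume => ∫ x, f x * g x)
      = fun g => inner ℂ (hf.star.toLp (star f)) g := by
    ext g
    rw [L2.inner_def]
    refine integral_congr_ae ?_
    filter_upwards [hf.star.coeFn_toLp] with x hx
    simp [hx, mul_comm]
  rw [h]
  exact (innerSL ℂ (hf.star.toLp (star f))).continuous

/-- Both sides are continuous in `g` for the `L²` norm, so it is enough to know the identity on the
dense set of Schwartz functions. -/
theorem integral_ift_mul {f g : E → ℂ} (hf : MemLp f 2 (volume : Measure E))
    (hg : MemLp g 2 (volume : Measure E)) :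
    ∫ x, ift f x * g x = ∫ x, f x * ift g x := by
  suffices H : ∀ G : Lp (α := E) ℂ 2 volume,
      ∫ x, ift f x * G x = ∫ x, f x * (𝓕⁻ G : Lp (α := E) ℂ 2 volume) x by
    have := H (hg.toLp g)
    rw [ift_eq hg, ← this]
    refine integral_congr_ae ?_
    filter_upwards [hg.coeFn_toLp] with x hx
    rw [hx]
  intro G
  refine DenseRange.induction_on (p := fun G : Lp (α := E) ℂ 2 volume =>
      ∫ x, ift f x * G x = ∫ x, f x * (𝓕⁻ G : Lp (α := E) ℂ 2 volume) x)
    (SchwartzMap.denseRange_toLpCLM (p := 2) ENNReal.ofNat_ne_top) G ?_ ?_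
  · refine isClosed_eq (continuous_integral_mul (memLp_ift hf)) ?_
    exact (continuous_integral_mul hf).comp (Lp.fourierTransformₗᵢ E ℂ).symm.continuous
  · intro ψ
    have h1 : ∫ x, ift f x * (ψ.toLp 2 volume : Lp (α := E) ℂ 2 volume) x = ∫ x, ift f x * ψ x := by
      refine integral_congr_ae ?_
      filter_upwards [ψ.coeFn_toLp 2 volume] with x hx
      rw [hx]
    rw [toLpCLM_apply, h1, integral_ift_mul_schwartz hf, toLp_fourierInv_eq]
    refine integral_congr_ae ?_
    filter_upwards [(𝓕⁻ ψ).coeFn_toLp 2 volume] with x hx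
    rw [hx]

theorem integral_fourierInv_mul {f g : E → ℂ} (hf : Integrable f (volume : Measure E))
    (hg : Integrable g (volume : Measure E)) :
    ∫ x, 𝓕⁻ f x * g x = ∫ x, f x * 𝓕⁻ g x := by
  have := VectorFourier.integral_fourierIntegral_smul_eq_flip (L := -innerₗ E)
    (e := Real.fourierChar) (μ := volume) (ν := volume) Real.continuous_fourierChar
    (by simp only [LinearMap.neg_apply, innerₗ_apply_apply]; fun_prop) hf hg
  have h : (-innerₗ E).flip = -innerₗ E := by
    ext x y
    simp [real_inner_comm]
  simp only [smul_eq_mul, h] at this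
  exact this

theorem integral_fourier_mul {f g : E → ℂ} (hf : Integrable f (volume : Measure E))
    (hg : Integrable g (volume : Measure E)) :
    ∫ x, 𝓕 f x * g x = ∫ x, f x * 𝓕 g x := by
  have := VectorFourier.integral_fourierIntegral_smul_eq_flip (L := innerₗ E)
    (e := Real.fourierChar) (μ := volume) (ν := volume) Real.continuous_fourierChar
    (by simp only [innerₗ_apply_apply]; fun_prop) hf hg
  have h : (innerₗ E).flip = innerₗ E := by
    ext x y
    simp
  simp only [smul_eq_mul, h] at this
  exact this

theorem locallyIntegrable_of_memLp_two {f : E → ℂ} (hf : MemLp f 2 (volume : Measure E)) :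
    LocallyIntegrable f (volume : Measure E) := hf.locallyIntegrable (by norm_num)

theorem continuous_fourierInv_of_integrable {f : E → ℂ} (hf : Integrable f (volume : Measure E)) :
    Continuous (𝓕⁻ f) :=
  VectorFourier.fourierIntegral_continuous (L := -innerₗ E) Real.continuous_fourierChar
    (by simp only [LinearMap.neg_apply, innerₗ_apply_apply]; fun_prop) hf

/-- On `L¹ ∩ L²` the inverse Fourier transform is the absolutely convergent integral. -/
theorem ift_of_integrable {f : E → ℂ} (hf : MemLp f 2 (volume : Measure E))
    (hf1 : Integrable f (volume : Measure E)) : ift f =ᵐ[volume] 𝓕⁻ f := by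
  refine ae_eq_of_integral_schwartz (locallyIntegrable_of_memLp_two (memLp_ift hf))
    (continuous_fourierInv_of_integrable hf1).locallyIntegrable fun ψ => ?_
  rw [integral_ift_mul_schwartz hf, integral_fourierInv_mul hf1 ψ.integrable,
    fourierInv_coe]

theorem norm_fourierChar_mul (r : ℝ) (z : ℂ) :
    ‖((Real.fourierChar r : Circle) : ℂ) * z‖ = ‖z‖ := by
  rw [norm_mul, Circle.norm_coe, one_mul]

theorem memLp_fourierChar_mul {f : E → ℂ} {p : ℝ≥0∞} (hf : MemLp f p (volume : Measure E)) (s : E) :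
    MemLp (fun q => ((Real.fourierChar (-inner ℝ q s) : Circle) : ℂ) * f q) p volume := by
  refine hf.of_le ?_ (Filter.Eventually.of_forall fun q => (norm_fourierChar_mul _ _).le)
  refine Continuous.aestronglyMeasurable ?_ |>.mul hf.1
  exact continuous_subtype_val.comp (Real.continuous_fourierChar.comp (by fun_prop))

/-- Modulation on the frequency side is translation on the physical side. -/
theorem ift_fourierChar_mul {f : E → ℂ} (hf : MemLp f 2 (volume : Measure E)) (s : E) :
    ift (fun q => ((Real.fourierChar (-inner ℝ q s) : Circle) : ℂ) * f q)
      =ᵐ[volume] fun x => ift f (x - s) := by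
  have hs : MemLp (fun x => ift f (x - s)) 2 (volume : Measure E) :=
    (memLp_ift hf).comp_measurePreserving (measurePreserving_sub_right volume s)
  refine ae_eq_of_integral_schwartz
    (locallyIntegrable_of_memLp_two (memLp_ift (memLp_fourierChar_mul hf s)))
    (locallyIntegrable_of_memLp_two hs) fun ψ => ?_
  have hψ2 : MemLp (fun x => ψ (x + s)) 2 (volume : Measure E) :=
    (ψ.memLp 2 volume).comp_measurePreserving (measurePreserving_add_right volume s)
  have hψ1 : Integrable (fun x => ψ (x + s)) (volume : Measure E) := ψ.integrable.comp_add_right s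
  rw [integral_ift_mul_schwartz (memLp_fourierChar_mul hf s)]
  have h1 : ∫ x, ift f (x - s) * ψ x = ∫ x, ift f x * ψ (x + s) := by
    rw [← integral_add_right_eq_self _ s]
    simp
  rw [h1, integral_ift_mul hf hψ2]
  refine integral_congr_ae ?_
  filter_upwards [ift_of_integrable hψ2 hψ1] with q hq
  have h2 : 𝓕⁻ (fun x => ψ (x + s)) q
      = ((Real.fourierChar (-inner ℝ q s) : Circle) : ℂ) * 𝓕⁻ (ψ : E → ℂ) q := by
    have := congrFun (VectorFourier.fourierIntegral_comp_add_right Real.fourierChar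
      (volume : Measure E) (-innerₗ E) ψ s) q
    simp only [LinearMap.neg_apply, innerₗ_apply_apply, real_inner_comm q s] at this
    exact this
  rw [hq, h2, fourierInv_coe]
  ring

/-- Tested against a Schwartz function, both transforms move onto it, and Schwartz inversion leaves
the reflection. -/
theorem ift_ift {g : E → ℂ} (hg : MemLp g 2 (volume : Measure E)) :
    ift (ift g) =ᵐ[volume] fun x => g (-x) := by
  have hs : MemLp (fun x => g (-x)) 2 (volume : Measure E) :=
    hg.comp_measurePreserving (Measure.measurePreserving_neg volume)
  refine ae_eq_of_integral_schwartz (locallyIntegrable_of_memLp_two (memLp_ift (memLp_ift hg)))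
    (locallyIntegrable_of_memLp_two hs) fun ψ => ?_
  rw [integral_ift_mul_schwartz (memLp_ift hg), integral_ift_mul_schwartz hg,
    ← integral_neg_eq_self (fun x => g (-x) * ψ x)]
  refine integral_congr_ae (Filter.Eventually.of_forall fun x => ?_)
  simp only [neg_neg]
  congr 1
  have h := DFunLike.congr_fun (FourierTransform.fourier_fourierInv_eq (F := 𝓢(E, ℂ)) ψ) (-x)
  rw [← h, fourierInv_coe, fourier_coe, Real.fourierInv_eq_fourier_neg]

theorem memLp_comp_sub_left {g : E → ℂ} {p : ℝ≥0∞} (hg : MemLp g p (volume : Measure E)) (x : E) :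
    MemLp (fun q => g (x - q)) p volume :=
  hg.comp_measurePreserving (Measure.measurePreserving_sub_left volume x)

/-- The Fourier transform of the product of two inverse Fourier transforms is the convolution. -/
theorem fourier_ift_mul_ift {f g : E → ℂ} (hf : MemLp f 2 (volume : Measure E))
    (hg : MemLp g 2 (volume : Measure E)) (p : E) :
    𝓕 (fun x => ift f x * ift g x) p = ∫ q, f q * g (p - q) := by
  have h2 : ift (fun x => ((Real.fourierChar (-inner ℝ x p) : Circle) : ℂ) * ift g x)
      =ᵐ[volume] fun q => g (p - q) := by
    have h3 := ift_fourierChar_mul (memLp_ift hg) p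
    have h4 := (measurePreserving_sub_right (volume : Measure E) p).quasiMeasurePreserving.ae_eq_comp
      (ift_ift hg)
    filter_upwards [h3, h4] with q hq hq'
    rw [hq]
    simpa using hq'
  have h5 := integral_ift_mul hf (memLp_fourierChar_mul (memLp_ift hg) p)
  rw [Real.fourier_eq]
  calc _ = ∫ x, ift f x * (((Real.fourierChar (-inner ℝ x p) : Circle) : ℂ) * ift g x) := by
        congr 1; ext x; rw [Circle.smul_def, smul_eq_mul]; ring
    _ = _ := by
        rw [h5]
        refine integral_congr_ae ?_
        filter_upwards [h2] with q hq
        rw [hq]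

theorem eLpNorm_four_sq (u : E → ℂ) :
    eLpNorm (fun x => u x * u x) 2 volume = eLpNorm u 4 (volume : Measure E) ^ 2 := by
  rw [eLpNorm_eq_lintegral_rpow_enorm_toReal (by norm_num) (by norm_num),
    eLpNorm_eq_lintegral_rpow_enorm_toReal (by norm_num) (by norm_num), ← ENNReal.rpow_natCast,
    ← ENNReal.rpow_mul]
  simp only [enorm_mul]
  norm_num
  congr 2
  ext x
  ring

/-- The product is only known to be integrable, so the identity is tested against Schwartz
functions, where the Fourier transform of the product is the convolution. -/
theorem ift_mul_ift_of_memLp {f g : E → ℂ} (hf : MemLp f 2 (volume : Measure E))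
    (hg : MemLp g 2 (volume : Measure E))
    (hfg : MemLp (fun p => ∫ q, f q * g (p - q)) 2 (volume : Measure E)) :
    (fun x => ift f x * ift g x) =ᵐ[volume] ift (fun p => ∫ q, f q * g (p - q)) := by
  have hu := integrable_mul_L2 (memLp_ift hf) (memLp_ift hg)
  refine ae_eq_of_integral_schwartz hu.locallyIntegrable
    (locallyIntegrable_of_memLp_two (memLp_ift hfg)) fun ψ => ?_
  have h1 := integral_fourier_mul hu (𝓕⁻ ψ : 𝓢(E, ℂ)).integrable
  have h2 : 𝓕 (⇑(𝓕⁻ ψ : 𝓢(E, ℂ))) = ψ := by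
    rw [← fourier_coe, FourierTransform.fourier_fourierInv_eq]
  rw [h2] at h1
  rw [← h1, integral_ift_mul_schwartz hfg]
  simp_rw [fourier_ift_mul_ift hf hg]

/-- The `L⁴` norm of `𝓕⁻ f` is controlled by the `L²` norm of `f ∗ f`. -/
theorem eLpNorm_ift_four_sq_le {f : E → ℂ} (hf : MemLp f 2 (volume : Measure E))
    (hff : MemLp (fun p => ∫ q, f q * f (p - q)) 2 (volume : Measure E)) :
    eLpNorm (ift f) 4 (volume : Measure E) ^ 2
      = eLpNorm (fun p => ∫ q, f q * f (p - q)) 2 volume := by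
  rw [← eLpNorm_four_sq, eLpNorm_congr_ae (ift_mul_ift_of_memLp hf hf hff), eLpNorm_ift hff]

/-- The `L²` norm of `f ∗ g` is controlled by the `L⁴` norms of `𝓕⁻ f` and `𝓕⁻ g`. -/
theorem memLp_conv_of_ift_four {f g : E → ℂ} (hf : MemLp f 2 (volume : Measure E))
    (hg : MemLp g 2 (volume : Measure E)) (hf4 : eLpNorm (ift f) 4 (volume : Measure E) < ⊤)
    (hg4 : eLpNorm (ift g) 4 (volume : Measure E) < ⊤) :
    MemLp (fun p => ∫ q, f q * g (p - q)) 2 (volume : Measure E) ∧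
    eLpNorm (fun p => ∫ q, f q * g (p - q)) 2 (volume : Measure E)
      ≤ eLpNorm (ift f) 4 volume * eLpNorm (ift g) 4 volume := by
  have hu := integrable_mul_L2 (memLp_ift hf) (memLp_ift hg)
  have hle : eLpNorm (fun x => ift f x * ift g x) 2 (volume : Measure E)
      ≤ eLpNorm (ift f) 4 volume * eLpNorm (ift g) 4 volume := by
    have : ENNReal.HolderTriple 4 4 2 := ⟨by
      rw [← two_mul]
      have : (4 : ℝ≥0∞) = 2 * 2 := by norm_num
      rw [this, ENNReal.mul_inv (by simp) (by simp), ← mul_assoc,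
        ENNReal.mul_inv_cancel (by simp) (by simp), one_mul]⟩
    exact eLpNorm_smul_le_mul_eLpNorm (𝕜 := ℂ) (aestronglyMeasurable_ift g)
      (aestronglyMeasurable_ift f)
  have hu2 : MemLp (fun x => ift f x * ift g x) 2 (volume : Measure E) :=
    ⟨hu.1, hle.trans_lt (ENNReal.mul_lt_top hf4 hg4)⟩
  have h1 : (fun p => ∫ q, f q * g (p - q)) =ᵐ[volume]
      (ift (fun x => ift f x * ift g x)) ∘ fun p => -p := by
    have h2 := (Measure.measurePreserving_neg (volume : Measure E)).quasiMeasurePreserving.ae_eq_comp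
      (ift_of_integrable hu2 hu)
    filter_upwards [h2] with p hp
    rw [hp, ← fourier_ift_mul_ift hf hg, Function.comp_apply, Real.fourierInv_eq_fourier_neg, neg_neg]
  have h3 := (memLp_ift hu2).comp_measurePreserving (Measure.measurePreserving_neg volume)
  refine ⟨h3.ae_eq h1.symm, ?_⟩
  rw [eLpNorm_congr_ae h1, eLpNorm_comp_measurePreserving (memLp_ift hu2).1
    (Measure.measurePreserving_neg volume), eLpNorm_ift hu2]
  exact hle

end FourierL2
end KPI
end

/-! ### Duality between `L⁴` and `L^{4/3}`. -/

noncomputable section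

namespace KPI

open MeasureTheory SchwartzMap

/-- The `L^{4/3}` norm. -/
def N43 {α : Type*} [MeasurableSpace α] (ν : Measure α) (φ : α → ℂ) : ℝ≥0∞ :=
  (∫⁻ x, ‖φ x‖ₑ ^ (4 / 3 : ℝ) ∂ν) ^ (3 / 4 : ℝ)

theorem eLpNorm_four_eq {α : Type*} [MeasurableSpace α] {ν : Measure α} (u : α → ℂ) :
    eLpNorm u 4 ν = (∫⁻ x, ‖u x‖ₑ ^ (4 : ℝ) ∂ν) ^ (1 / 4 : ℝ) := by
  rw [eLpNorm_eq_lintegral_rpow_enorm_toReal (by norm_num) (by norm_num)]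
  norm_num

theorem enorm_integral_mul_le_four {α : Type*} [MeasurableSpace α] {ν : Measure α} {u φ : α → ℂ}
    (hu : AEStronglyMeasurable u ν) (hφ : AEStronglyMeasurable φ ν) :
    ‖∫ x, u x * φ x ∂ν‖ₑ ≤ eLpNorm u 4 ν * N43 ν φ := by
  refine (enorm_integral_le_lintegral_enorm _).trans ?_
  simp_rw [enorm_mul]
  have := ENNReal.lintegral_mul_le_Lp_mul_Lq ν (p := 4) (q := 4 / 3)
    (by rw [Real.holderConjugate_iff]; norm_num) hu.enorm hφ.enorm
  rw [eLpNorm_four_eq, N43]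
  norm_num at this ⊢
  exact this

/-- The truncation `z ↦ z̄ |z|² 1_{|z| ≤ n}`. -/
def cubeTrunc (n : ℕ) (z : ℂ) : ℂ :=
  Set.indicator {z : ℂ | ‖z‖ ≤ n} (fun z => star z * (‖z‖ : ℂ) ^ 2) z

theorem measurable_cubeTrunc (n : ℕ) : Measurable (cubeTrunc n) := by
  refine Measurable.indicator ?_ (measurableSet_le measurable_norm measurable_const)
  have : Continuous fun z : ℂ => star z * (‖z‖ : ℂ) ^ 2 := by fun_prop
  exact this.measurable

/-- The truncation `z ↦ |z|⁴ 1_{|z| ≤ n}`. -/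
def quartTrunc (n : ℕ) (z : ℂ) : ℝ := Set.indicator {z : ℂ | ‖z‖ ≤ n} (fun z => ‖z‖ ^ 4) z

theorem mul_cubeTrunc (n : ℕ) (z : ℂ) : z * cubeTrunc n z = (quartTrunc n z : ℂ) := by
  unfold cubeTrunc quartTrunc
  by_cases h : ‖z‖ ≤ n
  · have hz : z * star z = (‖z‖ : ℂ) ^ 2 := by
      rw [Complex.star_def, Complex.mul_conj, Complex.normSq_eq_norm_sq]; push_cast; rfl
    rw [Set.indicator_of_mem (by exact h), Set.indicator_of_mem (by exact h), ← mul_assoc, hz]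
    push_cast; ring
  · rw [Set.indicator_of_notMem (by exact h), Set.indicator_of_notMem (by exact h)]; simp

/-- This bound and the quadratic one put the truncated cube of a square integrable function into
both `L²` and `L¹`, which makes it an admissible test function. -/
theorem norm_cubeTrunc_le (n : ℕ) (z : ℂ) : ‖cubeTrunc n z‖ ≤ n ^ 2 * ‖z‖ := by
  unfold cubeTrunc
  by_cases h : ‖z‖ ≤ n
  · rw [Set.indicator_of_mem (by exact h)]
    simp only [norm_mul, norm_star, norm_pow, Complex.norm_real, norm_norm]
    have : ‖z‖ ^ 2 ≤ (n : ℝ) ^ 2 := by gcongr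
    nlinarith [norm_nonneg z]
  · rw [Set.indicator_of_notMem (by exact h)]; simp; positivity

theorem norm_cubeTrunc_le_sq (n : ℕ) (z : ℂ) : ‖cubeTrunc n z‖ ≤ n * ‖z‖ ^ 2 := by
  unfold cubeTrunc
  by_cases h : ‖z‖ ≤ n
  · rw [Set.indicator_of_mem (by exact h)]
    simp only [norm_mul, norm_star, norm_pow, Complex.norm_real, norm_norm]
    have : ‖z‖ ≤ (n : ℝ) := h
    nlinarith [norm_nonneg z, sq_nonneg ‖z‖]
  · rw [Set.indicator_of_notMem (by exact h)]; simp; positivity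

theorem enorm_cubeTrunc_rpow (n : ℕ) (z : ℂ) :
    ‖cubeTrunc n z‖ₑ ^ (4 / 3 : ℝ) = ENNReal.ofReal (quartTrunc n z) := by
  unfold cubeTrunc quartTrunc
  by_cases h : ‖z‖ ≤ n
  · rw [Set.indicator_of_mem (by exact h), Set.indicator_of_mem (by exact h)]
    simp only [enorm_mul, enorm_pow]
    have h0 : ‖star z‖ₑ = ‖z‖ₑ := by rw [← ofReal_norm, norm_star, ofReal_norm]
    have h1 : ‖((‖z‖ : ℝ) : ℂ)‖ₑ = ‖z‖ₑ := by
      rw [← ofReal_norm, ← ofReal_norm]; simp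
    rw [h0, h1, ← pow_succ', ← ENNReal.rpow_natCast, ← ENNReal.rpow_mul,
      ENNReal.ofReal_pow (norm_nonneg _), ofReal_norm, ← ENNReal.rpow_natCast]
    norm_num
  · rw [Set.indicator_of_notMem (by exact h), Set.indicator_of_notMem (by exact h)]; simp

theorem quartTrunc_nonneg (n : ℕ) (z : ℂ) : 0 ≤ quartTrunc n z :=
  Set.indicator_nonneg (fun _ _ => by positivity) _

theorem ofReal_quartTrunc_le (n : ℕ) (z : ℂ) :
    ENNReal.ofReal (quartTrunc n z) ≤ n ^ 2 * ‖z‖ₑ ^ (2 : ℝ) := by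
  have : quartTrunc n z ≤ n ^ 2 * ‖z‖ ^ 2 := by
    unfold quartTrunc
    by_cases h : ‖z‖ ≤ n
    · rw [Set.indicator_of_mem (by exact h)]
      have : ‖z‖ ^ 2 ≤ (n : ℝ) ^ 2 := by gcongr
      nlinarith [sq_nonneg ‖z‖]
    · rw [Set.indicator_of_notMem (by exact h)]; positivity
  refine (ENNReal.ofReal_le_ofReal this).trans (le_of_eq ?_)
  rw [ENNReal.ofReal_mul (by positivity), ENNReal.ofReal_pow (norm_nonneg _), ofReal_norm,
    ENNReal.ofReal_pow (by positivity)]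
  simp

theorem measurable_quartTrunc (n : ℕ) : Measurable (quartTrunc n) := by
  refine Measurable.indicator ?_ (measurableSet_le measurable_norm measurable_const)
  fun_prop

theorem iSup_quartTrunc (z : ℂ) :
    ⨆ n : ℕ, ENNReal.ofReal (quartTrunc n z) = ‖z‖ₑ ^ (4 : ℝ) := by
  have hz : ENNReal.ofReal (‖z‖ ^ 4) = ‖z‖ₑ ^ (4 : ℝ) := by
    rw [ENNReal.ofReal_pow (norm_nonneg _), ofReal_norm, ← ENNReal.rpow_natCast]; norm_num
  apply le_antisymm
  · refine iSup_le fun n => ?_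
    rw [← hz]
    exact ENNReal.ofReal_le_ofReal (Set.indicator_le_self' (fun _ _ => by positivity) _)
  · obtain ⟨n, hn⟩ := exists_nat_ge ‖z‖
    refine le_iSup_of_le n ?_
    rw [← hz, quartTrunc, Set.indicator_of_mem (by exact hn)]

theorem quartTrunc_mono {m n : ℕ} (h : m ≤ n) (z : ℂ) : quartTrunc m z ≤ quartTrunc n z := by
  refine Set.indicator_le_indicator_of_subset (fun w (hw : ‖w‖ ≤ m) => ?_)
    (fun _ => by positivity) _
  exact hw.trans (by exact_mod_cast h)

/-- Duality: the `L⁴` norm of a square integrable function can be tested on `L¹ ∩ L²`. -/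
theorem eLpNorm_four_le_of_dual {α : Type*} [MeasurableSpace α] {ν : Measure α} {u : α → ℂ}
    (hu : MemLp u 2 ν) {B : ℝ≥0∞}
    (h : ∀ φ : α → ℂ, Integrable φ ν → MemLp φ 2 ν → ‖∫ x, u x * φ x ∂ν‖ₑ ≤ B * N43 ν φ) :
    eLpNorm u 4 ν ≤ B := by
  have hum := hu.1.aemeasurable
  have hL2 : ∫⁻ x, ‖u x‖ₑ ^ (2 : ℝ) ∂ν < ⊤ := by
    have := hu.eLpNorm_lt_top
    rw [eLpNorm_eq_lintegral_rpow_enorm_toReal (by norm_num) (by norm_num)] at this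
    simpa using (ENNReal.rpow_lt_top_iff_of_pos (by norm_num)).1 this
  have hI : ∀ n : ℕ, (∫⁻ x, ENNReal.ofReal (quartTrunc n (u x)) ∂ν) ≤ B ^ (4 : ℝ) := by
    intro n
    set J := ∫⁻ x, ENNReal.ofReal (quartTrunc n (u x)) ∂ν with hJ
    have hJfin : J < ⊤ := by
      refine (lintegral_mono fun x => ofReal_quartTrunc_le n (u x)).trans_lt ?_
      rw [lintegral_const_mul' _ _ (by finiteness)]
      exact ENNReal.mul_lt_top (by finiteness) hL2
    have hφm : AEStronglyMeasurable (fun x => cubeTrunc n (u x)) ν :=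
      ((measurable_cubeTrunc n).comp_aemeasurable hum).aestronglyMeasurable
    have hφ2 : MemLp (fun x => cubeTrunc n (u x)) 2 ν :=
      hu.of_le_mul hφm (Filter.Eventually.of_forall fun x => norm_cubeTrunc_le n (u x))
    have hφ1 : Integrable (fun x => cubeTrunc n (u x)) ν := by
      have h2 : Integrable (fun x => (n : ℝ) * ‖u x‖ ^ 2) ν :=
        ((memLp_two_iff_integrable_sq_norm hu.1).1 hu).const_mul _
      exact h2.mono' hφm (Filter.Eventually.of_forall fun x => norm_cubeTrunc_le_sq n (u x))
    have h3 := h _ hφ1 hφ2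
    have h4 : ‖∫ x, u x * cubeTrunc n (u x) ∂ν‖ₑ = J := by
      simp_rw [mul_cubeTrunc]
      rw [integral_complex_ofReal, integral_eq_lintegral_of_nonneg_ae
        (Filter.Eventually.of_forall fun x => quartTrunc_nonneg _ _)
        ((measurable_quartTrunc n).comp_aemeasurable hum).aestronglyMeasurable]
      rw [← ofReal_norm, Complex.norm_real, Real.norm_of_nonneg ENNReal.toReal_nonneg,
        ENNReal.ofReal_toReal hJfin.ne]
    have h5 : N43 ν (fun x => cubeTrunc n (u x)) = J ^ (3 / 4 : ℝ) := by
      unfold N43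
      simp_rw [enorm_cubeTrunc_rpow]
      rfl
    rw [h4, h5] at h3
    rcases eq_or_ne J 0 with h0 | h0
    · rw [h0]; exact zero_le
    -- Testing against the truncated cube gave `J ≤ B J^{3/4}`. The truncation keeps `J` finite, so
    -- `J^{3/4}` may be cancelled.
    have h6 : J ^ (1 / 4 : ℝ) ≤ B := by
      have h7 : J = J ^ (1 / 4 : ℝ) * J ^ (3 / 4 : ℝ) := by
        rw [← ENNReal.rpow_add _ _ h0 hJfin.ne]; norm_num
      have hp : J ^ (3 / 4 : ℝ) ≠ 0 := by simp [h0, hJfin.ne]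
      have hq : J ^ (3 / 4 : ℝ) ≠ ⊤ := by simp [h0, hJfin.ne]
      nth_rewrite 1 [h7] at h3
      rw [ENNReal.mul_le_mul_iff_left hp hq] at h3
      exact h3
    calc J = (J ^ (1 / 4 : ℝ)) ^ (4 : ℝ) := by rw [← ENNReal.rpow_mul]; norm_num
      _ ≤ _ := by gcongr
  have hT : ∫⁻ x, ‖u x‖ₑ ^ (4 : ℝ) ∂ν ≤ B ^ (4 : ℝ) := by
    simp_rw [← iSup_quartTrunc]
    rw [lintegral_iSup' (fun n => ((measurable_quartTrunc n).ennreal_ofReal.comp_aemeasurable' hum))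
      (Filter.Eventually.of_forall fun x => fun m n hmn =>
        ENNReal.ofReal_le_ofReal (quartTrunc_mono hmn _))]
    exact iSup_le hI
  rw [eLpNorm_four_eq]
  calc _ ≤ (B ^ (4 : ℝ)) ^ (1 / 4 : ℝ) := by gcongr
    _ = B := by rw [← ENNReal.rpow_mul]; norm_num

/-! ### The `L⁴` norm of the inverse Fourier transform. -/

section FourierL4

variable {E : Type*} [NormedAddCommGroup E] [InnerProductSpace ℝ E] [FiniteDimensional ℝ E]
  [MeasurableSpace E] [BorelSpace E]

theorem enorm_integral_mul_ift_le {f φ : E → ℂ} (hf : MemLp f 2 (volume : Measure E))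
    (hφ : MemLp φ 2 (volume : Measure E)) :
    ‖∫ q, f q * ift φ q‖ₑ ≤ eLpNorm (ift f) 4 volume * N43 volume φ := by
  rw [← integral_ift_mul hf hφ]
  exact enorm_integral_mul_le_four (aestronglyMeasurable_ift f) hφ.1

theorem eLpNorm_ift_four_le_of_dual {f : E → ℂ} (hf : MemLp f 2 (volume : Measure E)) {B : ℝ≥0∞}
    (h : ∀ φ : E → ℂ, Integrable φ volume → MemLp φ 2 volume →
      ‖∫ q, f q * ift φ q‖ₑ ≤ B * N43 volume φ) :
    eLpNorm (ift f) 4 volume ≤ B :=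
  eLpNorm_four_le_of_dual (memLp_ift hf) fun φ h1 h2 => by
    rw [integral_ift_mul hf h2]; exact h φ h1 h2

/-- Lower semicontinuity of the `L⁴` norm of `𝓕⁻ f` under dominated convergence. -/
theorem eLpNorm_ift_four_le_of_tendsto {f : E → ℂ} {g : ℕ → E → ℂ}
    (hf : MemLp f 2 (volume : Measure E)) (hgm : ∀ n, AEStronglyMeasurable (g n) volume)
    (hg : ∀ n q, ‖g n q‖ ≤ ‖f q‖)
    (hlim : ∀ q, Filter.Tendsto (fun n => g n q) Filter.atTop (nhds (f q))) {B : ℝ≥0∞}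
    (hB : ∀ n, eLpNorm (ift (g n)) 4 volume ≤ B) : eLpNorm (ift f) 4 volume ≤ B := by
  refine eLpNorm_ift_four_le_of_dual hf fun φ h1 h2 => ?_
  have hT : Filter.Tendsto (fun n => ∫ q, g n q * ift φ q) Filter.atTop
      (nhds (∫ q, f q * ift φ q)) := by
    refine tendsto_integral_of_dominated_convergence (fun q => ‖f q * ift φ q‖) ?_ ?_ ?_ ?_
    · exact fun n => (hgm n).mul (aestronglyMeasurable_ift φ)
    · exact (integrable_mul_L2 hf (memLp_ift h2)).norm
    · intro n
      refine Filter.Eventually.of_forall fun q => ?_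
      rw [norm_mul, norm_mul]
      exact mul_le_mul_of_nonneg_right (hg n q) (norm_nonneg _)
    · exact Filter.Eventually.of_forall fun q => (hlim q).mul_const _
  refine le_of_tendsto hT.enorm (Filter.Eventually.of_forall fun n => ?_)
  have hgn : MemLp (g n) 2 volume := hf.of_le (hgm n) (Filter.Eventually.of_forall (hg n))
  refine (enorm_integral_mul_ift_le hgn h2).trans ?_
  gcongr
  exact hB n

theorem eLpNorm_ift_four_add_le {f g : E → ℂ} (hf : MemLp f 2 (volume : Measure E))
    (hg : MemLp g 2 (volume : Measure E)) :
    eLpNorm (ift (f + g)) 4 volume ≤ eLpNorm (ift f) 4 volume + eLpNorm (ift g) 4 volume := by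
  rw [eLpNorm_congr_ae (ift_add hf hg)]
  exact eLpNorm_add_le (aestronglyMeasurable_ift f) (aestronglyMeasurable_ift g) (by norm_num)

theorem eLpNorm_ift_four_smul {f : E → ℂ} (c : ℂ) (hf : MemLp f 2 (volume : Measure E)) :
    eLpNorm (ift (c • f)) 4 volume = ‖c‖ₑ * eLpNorm (ift f) 4 volume := by
  rw [eLpNorm_congr_ae (ift_smul c hf), eLpNorm_const_smul]

/-- Multiplication by a character is a translation on the physical side, so no `L^p` norm sees it.
-/
theorem eLpNorm_ift_fourierChar_mul {f : E → ℂ} (hf : MemLp f 2 (volume : Measure E)) (s : E)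
    (p : ℝ≥0∞) :
    eLpNorm (ift fun q => ((Real.fourierChar (-inner ℝ q s) : Circle) : ℂ) * f q) p volume
      = eLpNorm (ift f) p volume := by
  rw [eLpNorm_congr_ae (ift_fourierChar_mul hf s)]
  exact eLpNorm_comp_measurePreserving (aestronglyMeasurable_ift f)
    (measurePreserving_sub_right volume s)

/-- The Laplace transform of a character. It exhibits the multiplier `(A + 2πir)⁻¹` as an average of
characters of total mass `A⁻¹`. -/
theorem integral_exp_neg_mul_fourierChar {A : ℝ} (hA : 0 < A) (r : ℝ) :
    ∫ s in Set.Ioi (0 : ℝ), (Real.exp (-(s * A)) : ℂ) * ((Real.fourierChar (-(s * r)) : Circle) : ℂ)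
      = ((A : ℂ) + 2 * Real.pi * r * Complex.I)⁻¹ := by
  have h := integral_exp_mul_complex_Ioi (a := -((A : ℂ) + 2 * Real.pi * r * Complex.I))
    (by simp [hA]) 0
  simp only [Complex.ofReal_zero, mul_zero, Complex.exp_zero] at h
  rw [show ((A : ℂ) + 2 * Real.pi * r * Complex.I)⁻¹
    = -1 / -((A : ℂ) + 2 * Real.pi * r * Complex.I) by rw [neg_div_neg_eq, one_div], ← h]
  congr 1
  ext s
  rw [Real.fourierChar_apply, Complex.ofReal_exp, ← Complex.exp_add]
  congr 1
  push_cast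
  ring

/-- The multiplier `(A + 2πi⟨q,e⟩)⁻¹` is an average of modulations, so it acts on `L⁴` with norm
at most `A⁻¹`. -/
theorem eLpNorm_ift_div_le {A : ℝ} (hA : 0 < A) (e : E) {h : E → ℂ}
    (hh : MemLp h 2 (volume : Measure E)) :
    MemLp (fun q => ((A : ℂ) + 2 * Real.pi * (inner ℝ q e : ℝ) * Complex.I)⁻¹ * h q) 2 volume ∧
    eLpNorm (ift fun q => ((A : ℂ) + 2 * Real.pi * (inner ℝ q e : ℝ) * Complex.I)⁻¹ * h q) 4 volume
      ≤ ENNReal.ofReal A⁻¹ * eLpNorm (ift h) 4 volume := by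
  have hne : ∀ r : ℝ, ((A : ℂ) + 2 * Real.pi * r * Complex.I) ≠ 0 := fun r hr => by
    have := congrArg Complex.re hr
    simp at this
    exact hA.ne' this
  have hL2 : MemLp (fun q => ((A : ℂ) + 2 * Real.pi * (inner ℝ q e : ℝ) * Complex.I)⁻¹ * h q)
      2 volume := by
    refine hh.of_le_mul (c := A⁻¹) ?_ (Filter.Eventually.of_forall fun q => ?_)
    · refine Continuous.aestronglyMeasurable ?_ |>.mul hh.1
      exact Continuous.inv₀ (by fun_prop) fun q => hne _
    · rw [norm_mul, norm_inv]
      gcongr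
      have := Complex.abs_re_le_norm ((A : ℂ) + 2 * Real.pi * (inner ℝ q e : ℝ) * Complex.I)
      simp only [Complex.add_re, Complex.ofReal_re, Complex.mul_re, Complex.I_re, Complex.I_im] at this
      simp at this
      exact (le_abs_self A).trans this
  refine ⟨hL2, eLpNorm_ift_four_le_of_dual hL2 fun φ h1 h2 => ?_⟩
  set F : ℝ → E → ℂ := fun s q => (Real.exp (-(s * A)) : ℂ) *
    ((Real.fourierChar (-inner ℝ q (s • e)) : Circle) : ℂ) * (h q * ift φ q) with hF
  have hint : Integrable (fun q => h q * ift φ q) volume := integrable_mul_L2 hh (memLp_ift h2)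
  have hexp : IntegrableOn (fun s : ℝ => Real.exp (-(s * A))) (Set.Ioi 0) volume := by
    have := integrableOn_exp_mul_Ioi (a := -A) (by linarith) 0
    simpa [mul_comm] using this
  have hFint : Integrable (Function.uncurry F) ((volume.restrict (Set.Ioi (0 : ℝ))).prod volume) := by
    have hI := hexp.mul_prod hint.norm
    refine hI.mono' ?_ (Filter.Eventually.of_forall fun p => ?_)
    · refine AEStronglyMeasurable.mul ?_ ?_
      · refine Continuous.aestronglyMeasurable ?_
        refine Continuous.mul (by fun_prop) ?_
        exact continuous_subtype_val.comp (Real.continuous_fourierChar.comp (by fun_prop))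
      · exact hint.1.comp_snd
    · simp only [Function.uncurry, hF]
      rw [mul_assoc, norm_mul, norm_fourierChar_mul, Complex.norm_real, Real.norm_eq_abs,
        Real.abs_exp]
  have hswap : ∫ q, ((A : ℂ) + 2 * Real.pi * (inner ℝ q e : ℝ) * Complex.I)⁻¹ * h q * ift φ q
      = ∫ s in Set.Ioi (0 : ℝ), ∫ q, F s q := by
    rw [integral_integral_swap hFint]
    refine integral_congr_ae (Filter.Eventually.of_forall fun q => ?_)
    simp only [hF, inner_smul_right]
    rw [integral_mul_const, integral_exp_neg_mul_fourierChar hA, mul_assoc]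
  rw [hswap]
  refine (enorm_integral_le_lintegral_enorm _).trans ?_
  have hbd : ∀ s : ℝ, ‖∫ q, F s q‖ₑ
      ≤ ENNReal.ofReal (Real.exp (-(s * A))) * (eLpNorm (ift h) 4 volume * N43 volume φ) := by
    intro s
    have : ∫ q, F s q = (Real.exp (-(s * A)) : ℂ) *
        ∫ q, (((Real.fourierChar (-inner ℝ q (s • e)) : Circle) : ℂ) * h q) * ift φ q := by
      rw [← integral_const_mul]
      congr 1; ext q; simp only [hF]; ring
    rw [this, enorm_mul, ← eLpNorm_ift_fourierChar_mul hh (s • e) 4]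
    gcongr
    · rw [← ofReal_norm, Complex.norm_real, Real.norm_eq_abs, Real.abs_exp]
    · exact enorm_integral_mul_ift_le (memLp_fourierChar_mul hh _) h2
  refine (lintegral_mono hbd).trans ?_
  rw [lintegral_mul_const _ (by fun_prop), ← ofReal_integral_eq_lintegral_ofReal hexp
    (Filter.Eventually.of_forall fun s => (Real.exp_pos _).le), mul_assoc]
  refine le_of_eq ?_
  congr 2
  have := integral_exp_mul_Ioi (a := -A) (by linarith) 0
  simp only [neg_mul, mul_zero, Real.exp_zero] at this
  simp_rw [mul_comm _ A, this]
  rw [neg_div_neg_eq, one_div]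

end FourierL4
end KPI
end

/-! ### Coordinates on `ℝ³` and the geometry of resonances. -/

noncomputable section

namespace KPI

open MeasureTheory

/-- The coordinates of `ℝ³`. -/
def coords (p : R3) : ℝ × ℝ × ℝ := (p 0, p 1, p 2)

theorem measurePreserving_coords : MeasurePreserving coords volume volume := by
  have h1 := EuclideanSpace.volume_preserving_symm_measurableEquiv_toLp (Fin 3)
  have h2 := volume_preserving_piFinSuccAbove (fun _ : Fin 3 => ℝ) 0
  have h3 := (MeasurePreserving.id (volume : Measure ℝ)).prod (volume_preserving_finTwoArrow ℝ)
  exact h3.comp (h2.comp h1)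

theorem measurable_coords : Measurable coords := measurePreserving_coords.measurable

/-- The coordinates of `ℝ³` as a measurable equivalence. -/
def coordsEquiv : R3 ≃ᵐ ℝ × ℝ × ℝ where
  toFun := coords
  invFun := fun q => !₂[q.1, q.2.1, q.2.2]
  left_inv := fun p => by ext i; fin_cases i <;> simp [coords]
  right_inv := fun q => by simp [coords]
  measurable_toFun := measurable_coords
  measurable_invFun := by
    show Measurable fun q : ℝ × ℝ × ℝ => !₂[q.1, q.2.1, q.2.2]
    refine (PiLp.continuous_toLp 2 _).measurable.comp ?_
    refine measurable_pi_lambda _ fun i => ?_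
    fin_cases i <;> simp <;> fun_prop

theorem measurePreserving_coordsEquiv_symm :
    MeasurePreserving coordsEquiv.symm volume volume :=
  MeasurePreserving.symm coordsEquiv measurePreserving_coords

theorem lintegral_R3 {F : R3 → ℝ≥0∞} (hF : AEMeasurable F volume) :
    ∫⁻ p, F p = ∫⁻ a : ℝ, ∫⁻ b : ℝ, ∫⁻ c : ℝ, F !₂[a, b, c] := by
  rw [← measurePreserving_coordsEquiv_symm.lintegral_comp_emb coordsEquiv.symm.measurableEmbedding]
  have hm : AEMeasurable (fun q => F (coordsEquiv.symm q)) volume :=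
    hF.comp_quasiMeasurePreserving measurePreserving_coordsEquiv_symm.quasiMeasurePreserving
  rw [Measure.volume_eq_prod, lintegral_prod _ hm]
  refine lintegral_congr_ae ?_
  have hm' : ∀ᵐ a : ℝ, AEMeasurable (fun q : ℝ × ℝ => F (coordsEquiv.symm (a, q))) volume := by
    have := hm.aestronglyMeasurable
    rw [Measure.volume_eq_prod] at this
    filter_upwards [this.prodMk_left] with a ha using ha.aemeasurable
  filter_upwards [hm'] with a ha
  rw [Measure.volume_eq_prod, lintegral_prod _ ha]
  rfl

theorem measurable_modulation : Measurable modulation := by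
  unfold modulation omega; fun_prop

theorem measurable_symb : Measurable symb := by
  have := measurable_modulation
  unfold symb; fun_prop

theorem modulation_neg (p : R3) : modulation (-p) = -modulation p := by
  simp only [modulation, omega, PiLp.neg_apply, div_neg]
  ring

/-! ### The area of the resonant set -/

/-- The set lies between the circles of radius `√(K - N)` and `√(K + N)`. The areas subtract so that
`K` drops out, with the convention that the root of a negative number is `0`. -/
theorem volume_annulus_le (K : ℝ) {N : ℝ} (hN : 0 ≤ N) :
    volume {q : ℝ × ℝ | |K - q.1 ^ 2 - q.2 ^ 2| ≤ N} ≤ ENNReal.ofReal (2 * Real.pi * N) := by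
  set S := {q : ℝ × ℝ | |K - q.1 ^ 2 - q.2 ^ 2| ≤ N}
  have hS : MeasurableSet S := measurableSet_le (by fun_prop) measurable_const
  rw [← Complex.volume_preserving_equiv_real_prod.measure_preimage hS.nullMeasurableSet]
  have hsub : Complex.measurableEquivRealProd ⁻¹' S
      ⊆ Metric.closedBall 0 √(K + N) \ Metric.ball 0 √(K - N) := by
    intro z hz
    have h1 : |K - z.re ^ 2 - z.im ^ 2| ≤ N := hz
    have h2 : ‖z‖ ^ 2 = z.re ^ 2 + z.im ^ 2 := by rw [Complex.sq_norm, Complex.normSq_apply]; ring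
    rw [abs_le] at h1
    simp only [Set.mem_sdiff, Metric.mem_closedBall, dist_zero_right, Metric.mem_ball, not_lt]
    exact ⟨Real.le_sqrt_of_sq_le (by linarith), Real.sqrt_le_iff.2 ⟨norm_nonneg _, by linarith⟩⟩
  refine (measure_mono hsub).trans ?_
  rcases lt_or_ge (K + N) 0 with h | h
  · rw [Real.sqrt_eq_zero_of_nonpos h.le, Real.sqrt_eq_zero_of_nonpos (by linarith)]
    simp
  have hle : √(K - N) ≤ √(K + N) := Real.sqrt_le_sqrt (by linarith)
  rw [measure_sdiff (Metric.ball_subset_closedBall.trans (Metric.closedBall_subset_closedBall hle))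
    measurableSet_ball.nullMeasurableSet (by finiteness), Complex.volume_closedBall,
    Complex.volume_ball, ← ENNReal.ofReal_pow (Real.sqrt_nonneg _), Real.sq_sqrt h,
    ← ENNReal.ofReal_pow (Real.sqrt_nonneg _), tsub_le_iff_right]
  have hpi : (NNReal.pi : ℝ≥0∞) = ENNReal.ofReal Real.pi := by
    rw [ENNReal.ofReal, ← NNReal.coe_real_pi, Real.toNNReal_coe]
  rw [hpi, ← ENNReal.ofReal_mul (by linarith), ← ENNReal.ofReal_mul (by positivity),
    ← ENNReal.ofReal_add (by positivity) (by positivity)]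
  refine ENNReal.ofReal_le_ofReal ?_
  have : K - N ≤ √(K - N) ^ 2 := by
    rcases le_total 0 (K - N) with h' | h'
    · rw [Real.sq_sqrt h']
    · exact h'.trans (by positivity)
  nlinarith [Real.pi_pos]

/-- Completing the square in both variables. For `0 < a < ξ` both square coefficients are positive,
so at a fixed sum frequency the resonance function is elliptic. -/
theorem omega_add_omega {ξ μ a b : ℝ} (ha : 0 < a) (ha' : a < ξ) :
    omega a b + omega (ξ - a) (μ - b) = μ ^ 2 / ξ + ξ ^ 3 / 4 + 3 * ξ * (a - ξ / 2) ^ 2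
      + ξ / (a * (ξ - a)) * (b - μ * a / ξ) ^ 2 := by
  have h1 : ξ - a ≠ 0 := by linarith
  have h2 : ξ ≠ 0 := by linarith
  unfold omega
  field_simp
  ring

/-- Translating by `m` and dilating by `√c` reduces to `c = 1`, `m = 0`. The Jacobian is `c^{-1/2} ≤
d⁻¹`. -/
theorem volume_quadratic_slice_le (L m : ℝ) {c d N : ℝ} (hd : 0 < d) (hc : d ^ 2 ≤ c) :
    volume {b : ℝ | |L - c * (b - m) ^ 2| ≤ N}
      ≤ ENNReal.ofReal d⁻¹ * volume {b : ℝ | |L - b ^ 2| ≤ N} := by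
  have hc0 : 0 < c := lt_of_lt_of_le (by positivity) hc
  have h1 : {b : ℝ | |L - c * (b - m) ^ 2| ≤ N}
      = (fun b => b - m) ⁻¹' ((√c * ·) ⁻¹' {b : ℝ | |L - b ^ 2| ≤ N}) := by
    ext b
    simp [mul_pow, Real.sq_sqrt hc0.le]
  have h2 : MeasurableSet {b : ℝ | |L - b ^ 2| ≤ N} := measurableSet_le (by fun_prop) measurable_const
  rw [h1, (measurePreserving_sub_right volume m).measure_preimage
    ((measurable_const_mul _) h2).nullMeasurableSet, Real.volume_preimage_mul_left (Real.sqrt_pos.2 hc0).ne']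
  gcongr
  rw [abs_of_pos (by positivity)]
  have : d ≤ √c := Real.le_sqrt_of_sq_le hc
  gcongr

theorem lintegral_comp_affine (g : ℝ → ℝ≥0∞) (hg : Measurable g) {c : ℝ} (hc : 0 < c) (m : ℝ) :
    ∫⁻ a, g (c * (a - m)) = ENNReal.ofReal c⁻¹ * ∫⁻ s, g s := by
  rw [lintegral_sub_right_eq_self (fun a => g (c * a)) m]
  have h := Real.map_volume_mul_left hc.ne'
  have h2 : ∫⁻ a, g (c * a) = ∫⁻ s, g s ∂(Measure.map (c * ·) volume) :=
    (lintegral_map hg (measurable_const_mul c)).symm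
  rw [h2, h, lintegral_smul_measure, abs_of_pos (by positivity), smul_eq_mul]

/-- The pairs `(a, b)` with `0 < a < ξ` for which `ω(a, b) + ω(ξ - a, μ - b)` is within `N` of
`τ`. -/
def resonantSet (ξ μ τ N : ℝ) : Set (ℝ × ℝ) :=
  {q | (0 < q.1 ∧ q.1 < ξ) ∧ |τ - (omega q.1 q.2 + omega (ξ - q.1) (μ - q.2))| ≤ N}

theorem measurableSet_resonantSet (ξ μ τ N : ℝ) : MeasurableSet (resonantSet ξ μ τ N) := by
  unfold resonantSet omega
  measurability

/-- The set is compared slice by slice in `a` with a circular annulus. The centre and the scale of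
the slice in `b` depend on `a`, but only the lengths of slices matter, and the lower bound `4/ξ` for
the coefficient makes them uniform. -/
theorem volume_resonantSet_le (ξ μ τ : ℝ) {N : ℝ} (hN : 0 ≤ N) :
    volume (resonantSet ξ μ τ N) ≤ ENNReal.ofReal (2 * Real.pi * N) := by
  rcases le_or_gt ξ 0 with hξ | hξ
  · have : resonantSet ξ μ τ N = ∅ := by
      ext q; simp only [resonantSet, Set.mem_ofPred_eq, Set.mem_empty_iff_false, iff_false]
      rintro ⟨⟨h1, h2⟩, -⟩; linarith
    simp [this]
  set K := τ - (μ ^ 2 / ξ + ξ ^ 3 / 4)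
  set ℓ : ℝ → ℝ≥0∞ := fun s => volume {b : ℝ | |K - s ^ 2 - b ^ 2| ≤ N}
  have hS : MeasurableSet {q : ℝ × ℝ | |K - q.1 ^ 2 - q.2 ^ 2| ≤ N} :=
    measurableSet_le (by fun_prop) measurable_const
  have hℓ : Measurable ℓ := measurable_measure_prodMk_left hS
  have hℓ' : ∫⁻ s, ℓ s ≤ ENNReal.ofReal (2 * Real.pi * N) := by
    refine le_trans (le_of_eq ?_) (volume_annulus_le K hN)
    rw [Measure.volume_eq_prod, Measure.prod_apply hS]
    rfl
  set d := 2 / √ξ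
  have hd : 0 < d := by positivity
  set c := √(3 * ξ)
  have hc : 0 < c := by positivity
  rw [Measure.volume_eq_prod, Measure.prod_apply (measurableSet_resonantSet ξ μ τ N)]
  have hslice : ∀ a : ℝ, volume (Prod.mk a ⁻¹' resonantSet ξ μ τ N)
      ≤ ENNReal.ofReal d⁻¹ * ℓ (c * (a - ξ / 2)) := by
    intro a
    by_cases ha : 0 < a ∧ a < ξ
    -- This is `a (ξ - a) ≤ ξ²/4`.
    · have h1 : d ^ 2 ≤ ξ / (a * (ξ - a)) := by
        have h3 : 0 < ξ - a := by linarith [ha.2]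
        have h4 := ha.1
        rw [div_pow, Real.sq_sqrt hξ.le, div_le_div_iff₀ hξ (by positivity)]
        nlinarith [sq_nonneg (ξ - 2 * a)]
      refine le_trans (measure_mono fun b hb => ?_)
        (volume_quadratic_slice_le (K - (c * (a - ξ / 2)) ^ 2) (μ * a / ξ) hd h1)
      have hb2 : |τ - (omega a b + omega (ξ - a) (μ - b))| ≤ N := hb.2
      rw [omega_add_omega ha.1 ha.2] at hb2
      simp only [Set.mem_ofPred_eq, mul_pow, K, c]
      rw [Real.sq_sqrt (by positivity)]
      convert! hb2 using 2
      ring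
    · have : Prod.mk a ⁻¹' resonantSet ξ μ τ N = ∅ := by
        ext b; simp only [resonantSet, Set.mem_preimage, Set.mem_ofPred_eq, Set.mem_empty_iff_false,
          iff_false]
        exact fun h => ha h.1
      simp [this]
  refine (lintegral_mono hslice).trans ?_
  rw [lintegral_const_mul' _ _ (by finiteness), lintegral_comp_affine ℓ hℓ hc, ← mul_assoc,
    ← ENNReal.ofReal_mul (by positivity)]
  -- The two Jacobians multiply to `(√ξ / 2) (3ξ)^{-1/2} = 1/(2√3)`. The powers of `ξ` cancel, which
  -- makes the Strichartz constant uniform in frequency.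
  refine le_trans (mul_le_of_le_one_left zero_le ?_) hℓ'
  rw [← ENNReal.ofReal_one]
  refine ENNReal.ofReal_le_ofReal ?_
  have h5 : √ξ ≤ c := Real.sqrt_le_sqrt (by linarith)
  have h6 : 0 < √ξ := Real.sqrt_pos.2 hξ
  simp only [d, inv_div]
  rw [← div_eq_mul_inv, div_le_one hc]
  linarith

/-! ### The Strichartz estimate on a layer of bounded modulation. -/

/-- Frequencies with `0 < σ ξ` and modulation at most `M`. -/
def layer (σ M : ℝ) : Set R3 := {p | 0 < σ * p 0 ∧ |modulation p| ≤ M}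

theorem measurableSet_layer (σ M : ℝ) : MeasurableSet (layer σ M) := by
  have := measurable_modulation
  unfold layer
  measurability

theorem measurableSet_layer_inter (σ M : ℝ) (p : R3) :
    MeasurableSet {q : R3 | q ∈ layer σ M ∧ p - q ∈ layer σ M} :=
  (measurableSet_layer σ M).inter ((measurable_const_sub p) (measurableSet_layer σ M))

/-- The two modulation conditions confine `c` to an interval of length `2M` and, when added, put
`(a, b)` in the resonant set with tolerance `2M`. This gives `2M · 4πM ≤ 36 M²`. -/
theorem volume_layer_inter_one_le (p : R3) {M : ℝ} (hM : 0 ≤ M) :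
    volume {q : R3 | q ∈ layer 1 M ∧ p - q ∈ layer 1 M} ≤ ENNReal.ofReal (36 * M ^ 2) := by
  have hmeas := measurableSet_layer_inter 1 M p
  rw [← lintegral_indicator_one hmeas, lintegral_R3 (by
    exact (measurable_one.indicator hmeas).aemeasurable)]
  set R := resonantSet (p 0) (p 1) (p 2) (2 * M)
  have hin : ∀ a b : ℝ, ∫⁻ c : ℝ, Set.indicator {q : R3 | q ∈ layer 1 M ∧ p - q ∈ layer 1 M}
      (1 : R3 → ℝ≥0∞) !₂[a, b, c] ≤ Set.indicator R (fun _ => ENNReal.ofReal (2 * M)) (a, b) := by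
    intro a b
    have hpt : ∀ c : ℝ, Set.indicator {q : R3 | q ∈ layer 1 M ∧ p - q ∈ layer 1 M}
      (1 : R3 → ℝ≥0∞) !₂[a, b, c] ≤ Set.indicator R (fun _ =>
        Set.indicator (Set.Icc (omega a b - M) (omega a b + M)) 1 c) (a, b) := by
      intro c
      by_cases hc : !₂[a, b, c] ∈ {q : R3 | q ∈ layer 1 M ∧ p - q ∈ layer 1 M}
      · obtain ⟨⟨h1, h2⟩, h3, h4⟩ := hc
        simp [modulation] at h1 h2 h3 h4
        have hR : (a, b) ∈ R := by
          refine ⟨⟨h1, h3⟩, ?_⟩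
          rw [abs_le] at *
          constructor <;> simp only <;> linarith [h2.1, h2.2, h4.1, h4.2]
        have hI : c ∈ Set.Icc (omega a b - M) (omega a b + M) := by
          rw [abs_le] at h2
          exact ⟨by linarith, by linarith⟩
        rw [Set.indicator_of_mem hR, Set.indicator_of_mem hI]
        exact Set.indicator_le_self' (fun _ _ => zero_le) _
      · rw [Set.indicator_of_notMem hc]; exact zero_le
    refine (lintegral_mono hpt).trans ?_
    by_cases hR : (a, b) ∈ R
    · simp only [Set.indicator_of_mem hR]
      rw [lintegral_indicator_one measurableSet_Icc, Real.volume_Icc]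
      refine ENNReal.ofReal_le_ofReal (by linarith)
    · simp [Set.indicator_of_notMem hR]
  refine (lintegral_mono fun a => lintegral_mono fun b => hin a b).trans ?_
  have hRm := measurableSet_resonantSet (p 0) (p 1) (p 2) (2 * M)
  rw [← lintegral_prod (μ := (volume : Measure ℝ)) (ν := (volume : Measure ℝ))
    (fun q => Set.indicator R (fun _ => ENNReal.ofReal (2 * M)) q)
    (measurable_const.indicator hRm).aemeasurable, lintegral_indicator_const hRm,
    ← Measure.volume_eq_prod]
  refine (mul_le_mul_right (volume_resonantSet_le _ _ _ (by positivity)) _).trans ?_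
  rw [← ENNReal.ofReal_mul (by positivity)]
  refine ENNReal.ofReal_le_ofReal ?_
  nlinarith [Real.pi_lt_four, Real.pi_lt_d2, mul_nonneg hM hM]

/-- The modulation is odd under `p ↦ -p`, so the layer over negative `ξ` is the reflection of the
one over positive `ξ`. -/
theorem volume_layer_inter_le {σ : ℝ} (hσ : σ = 1 ∨ σ = -1) (p : R3) {M : ℝ} (hM : 0 ≤ M) :
    volume {q : R3 | q ∈ layer σ M ∧ p - q ∈ layer σ M} ≤ ENNReal.ofReal (36 * M ^ 2) := by
  rcases hσ with rfl | rfl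
  · exact volume_layer_inter_one_le p hM
  · have hneg : ∀ q : R3, q ∈ layer (-1) M ↔ -q ∈ layer 1 M := by
      intro q
      simp [layer, modulation_neg]
    have : {q : R3 | q ∈ layer (-1) M ∧ p - q ∈ layer (-1) M}
        = (fun q => -q) ⁻¹' {q : R3 | q ∈ layer 1 M ∧ -p - q ∈ layer 1 M} := by
      ext q
      simp only [Set.mem_ofPred_eq, Set.mem_preimage, hneg]
      rw [show -(p - q) = -p - -q by abel]
    rw [this, Measure.measure_preimage_neg]
    exact volume_layer_inter_one_le (-p) hM

theorem aestronglyMeasurable_conv_integrand {E : Type*} [NormedAddCommGroup E]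
    [InnerProductSpace ℝ E] [FiniteDimensional ℝ E] [MeasurableSpace E] [BorelSpace E]
    {f g : E → ℂ} (hf : AEStronglyMeasurable f (volume : Measure E))
    (hg : AEStronglyMeasurable g (volume : Measure E)) :
    AEStronglyMeasurable (fun z : E × E => f z.2 * g (z.1 - z.2))
      ((volume : Measure E).prod volume) :=
  hf.convolution_integrand (ContinuousLinearMap.mul ℂ ℂ) hg

theorem aestronglyMeasurable_conv {E : Type*} [NormedAddCommGroup E]
    [InnerProductSpace ℝ E] [FiniteDimensional ℝ E] [MeasurableSpace E] [BorelSpace E]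
    {f g : E → ℂ} (hf : AEStronglyMeasurable f (volume : Measure E))
    (hg : AEStronglyMeasurable g (volume : Measure E)) :
    AEStronglyMeasurable (fun p => ∫ q, f q * g (p - q)) (volume : Measure E) :=
  (aestronglyMeasurable_conv_integrand hf hg).integral_prod_right'

theorem eLpNorm_two_rpow {α : Type*} [MeasurableSpace α] {ν : Measure α} (f : α → ℂ) :
    ∫⁻ x, ‖f x‖ₑ ^ (2 : ℝ) ∂ν = eLpNorm f 2 ν ^ (2 : ℝ) := by
  rw [eLpNorm_eq_lintegral_rpow_enorm_toReal (by norm_num) (by norm_num), ← ENNReal.rpow_mul]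
  norm_num

/-- Cauchy-Schwarz, with the indicator of the set where both factors can be nonzero as the second
function. -/
theorem enorm_conv_sq_le {f : R3 → ℂ} (hf : MemLp f 2 volume) {S : Set R3}
    (hsupp : ∀ p, f p ≠ 0 → p ∈ S) (hS : MeasurableSet S) (p : R3) :
    ‖∫ q, f q * f (p - q)‖ₑ ^ (2 : ℝ)
      ≤ volume {q : R3 | q ∈ S ∧ p - q ∈ S} * ∫⁻ q, ‖f q * f (p - q)‖ₑ ^ (2 : ℝ) := by
  set T := {q : R3 | q ∈ S ∧ p - q ∈ S}
  have hT : MeasurableSet T := hS.inter ((measurable_const_sub p) hS)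
  have hm : AEStronglyMeasurable (fun q => f q * f (p - q)) volume :=
    hf.1.mul (memLp_comp_sub_left hf p).1
  have h1 : ∀ q, ‖f q * f (p - q)‖ₑ = T.indicator 1 q * ‖f q * f (p - q)‖ₑ := by
    intro q
    by_cases hq : q ∈ T
    · rw [Set.indicator_of_mem hq, Pi.one_apply, one_mul]
    · rw [Set.indicator_of_notMem hq, zero_mul, enorm_eq_zero]
      by_contra h
      rw [mul_eq_zero, not_or] at h
      exact hq ⟨hsupp _ h.1, hsupp _ h.2⟩
  have h2 : ‖∫ q, f q * f (p - q)‖ₑ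
      ≤ volume T ^ (1 / 2 : ℝ) * (∫⁻ q, ‖f q * f (p - q)‖ₑ ^ (2 : ℝ)) ^ (1 / 2 : ℝ) := by
    refine (enorm_integral_le_lintegral_enorm _).trans ?_
    rw [lintegral_congr h1]
    refine (ENNReal.lintegral_mul_le_Lp_mul_Lq volume Real.HolderConjugate.two_two
      (measurable_one.indicator hT).aemeasurable hm.enorm).trans ?_
    gcongr
    rw [← lintegral_indicator_one hT]
    refine lintegral_mono fun q => ?_
    by_cases hq : q ∈ T
    · simp [Set.indicator_of_mem hq]
    · simp [Set.indicator_of_notMem hq]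
  calc _ ≤ (volume T ^ (1 / 2 : ℝ) * (∫⁻ q, ‖f q * f (p - q)‖ₑ ^ (2 : ℝ)) ^ (1 / 2 : ℝ)) ^ (2 : ℝ) := by
        gcongr
    _ = _ := by
        rw [ENNReal.mul_rpow_of_nonneg _ _ (by norm_num), ← ENNReal.rpow_mul, ← ENNReal.rpow_mul]
        norm_num

/-- Tonelli and translation invariance. -/
theorem lintegral_lintegral_conv_sq {f : R3 → ℂ} (hf : MemLp f 2 volume) :
    ∫⁻ p, ∫⁻ q, ‖f q * f (p - q)‖ₑ ^ (2 : ℝ) = (eLpNorm f 2 volume ^ (2 : ℝ)) ^ 2 := by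
  rw [lintegral_lintegral_swap
    ((aestronglyMeasurable_conv_integrand hf.1 hf.1).enorm.pow_const _)]
  simp_rw [enorm_mul, ENNReal.mul_rpow_of_nonneg _ _ (show (0 : ℝ) ≤ 2 by norm_num)]
  have : ∀ q : R3, ∫⁻ p, ‖f q‖ₑ ^ (2 : ℝ) * ‖f (p - q)‖ₑ ^ (2 : ℝ)
      = ‖f q‖ₑ ^ (2 : ℝ) * eLpNorm f 2 volume ^ (2 : ℝ) := by
    intro q
    rw [lintegral_const_mul' _ _ (by finiteness),
      lintegral_sub_right_eq_self (fun p => ‖f p‖ₑ ^ (2 : ℝ)) q, eLpNorm_two_rpow]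
  simp_rw [this]
  rw [lintegral_mul_const' _ _ (by have := hf.eLpNorm_ne_top; finiteness), eLpNorm_two_rpow, sq]

/-- The `L⁴` Strichartz estimate for functions of modulation at most `M`. -/
theorem eLpNorm_ift_four_le_of_layer {f : R3 → ℂ} (hf : MemLp f 2 volume) {σ M : ℝ}
    (hσ : σ = 1 ∨ σ = -1) (hM : 0 ≤ M) (hsupp : ∀ p, f p ≠ 0 → p ∈ layer σ M) :
    eLpNorm (ift f) 4 volume ≤ ENNReal.ofReal √(6 * M) * eLpNorm f 2 volume := by
  have h1 : ∫⁻ p, ‖∫ q, f q * f (p - q)‖ₑ ^ (2 : ℝ)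
      ≤ ENNReal.ofReal (36 * M ^ 2) * (eLpNorm f 2 volume ^ (2 : ℝ)) ^ 2 := by
    rw [← lintegral_lintegral_conv_sq hf, ← lintegral_const_mul' _ _ (by finiteness)]
    refine lintegral_mono fun p => ?_
    refine (enorm_conv_sq_le hf hsupp (measurableSet_layer σ M) p).trans ?_
    gcongr
    exact volume_layer_inter_le hσ p hM
  have hfin := hf.eLpNorm_ne_top
  have hc : eLpNorm (fun p => ∫ q, f q * f (p - q)) 2 volume
      ≤ ENNReal.ofReal (6 * M) * eLpNorm f 2 volume ^ (2 : ℝ) := by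
    rw [eLpNorm_two_rpow] at h1
    rw [← ENNReal.rpow_le_rpow_iff (z := 2) (by norm_num),
      ENNReal.mul_rpow_of_nonneg _ _ (by norm_num)]
    refine h1.trans (le_of_eq ?_)
    rw [ENNReal.ofReal_rpow_of_nonneg (by positivity) (by norm_num),
      ENNReal.rpow_two (eLpNorm f 2 volume ^ (2 : ℝ))]
    congr 2
    · norm_num; ring
  have hmem : MemLp (fun p => ∫ q, f q * f (p - q)) 2 volume :=
    ⟨aestronglyMeasurable_conv hf.1 hf.1, hc.trans_lt (by finiteness)⟩
  have h2 := eLpNorm_ift_four_sq_le hf hmem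
  rw [← ENNReal.rpow_le_rpow_iff (z := 2) (by norm_num), ENNReal.mul_rpow_of_nonneg _ _ (by norm_num),
    ENNReal.ofReal_rpow_of_nonneg (by positivity) (by norm_num)]
  have h3 : √(6 * M) ^ (2 : ℝ) = 6 * M := by
    rw [Real.rpow_two, Real.sq_sqrt (by positivity)]
  rw [h3]
  refine le_trans (le_of_eq ?_) hc
  rw [← h2]; norm_num

end KPI
end

noncomputable section

namespace KPI

open MeasureTheory

/-! ### Dyadic modulation cutoffs and the `L⁴` bound for `X_k`. -/

section Cutoff

variable {μ₀ : ℝ → ℝ}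

theorem IsBasicCutoff.eq_zero (h : IsBasicCutoff μ₀) {s : ℝ} (hs : 8 / 5 < |s|) : μ₀ s = 0 := by
  by_contra h0
  have := h.support_subset h0
  have h2 : |s| ≤ 8 / 5 := abs_le.2 ⟨by linarith [this.1], this.2⟩
  linarith

theorem IsBasicCutoff.eq_one' (h : IsBasicCutoff μ₀) {s : ℝ} (hs : |s| ≤ 5 / 4) : μ₀ s = 1 :=
  h.eq_one s ⟨by linarith [(abs_le.1 hs).1], (abs_le.1 hs).2⟩

theorem IsBasicCutoff.measurable (h : IsBasicCutoff μ₀) : Measurable μ₀ :=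
  h.smooth.continuous.measurable

theorem abs_chi_le_one (h : IsBasicCutoff μ₀) (k : ℤ) (s : ℝ) : |chi μ₀ k s| ≤ 1 := by
  have h1 := h.mem_Icc (s / 2 ^ k)
  have h2 := h.mem_Icc (s / 2 ^ (k - 1))
  unfold chi
  rw [abs_le]
  constructor <;> linarith [h1.1, h1.2, h2.1, h2.2]

theorem abs_le_of_chi_ne_zero (h : IsBasicCutoff μ₀) {k : ℤ} {s : ℝ} (hs : chi μ₀ k s ≠ 0) :
    (2 : ℝ) ^ (k - 1) ≤ |s| ∧ |s| ≤ (2 : ℝ) ^ (k + 1) := by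
  have hk : (0 : ℝ) < 2 ^ (k - 1) := by positivity
  have hk1 : (2 : ℝ) ^ k = 2 * 2 ^ (k - 1) := by
    rw [← zpow_one_add₀ (by norm_num)]; congr 1; ring
  have hk2 : (2 : ℝ) ^ (k + 1) = 4 * 2 ^ (k - 1) := by
    rw [show k + 1 = 2 + (k - 1) by ring, zpow_add₀ (by norm_num)]; norm_num
  constructor
  · by_contra! hlt
    refine hs ?_
    unfold chi
    rw [h.eq_one', h.eq_one', sub_self]
    · rw [abs_div, abs_of_pos hk, div_le_iff₀ hk]; linarith
    · rw [abs_div, hk1, abs_of_pos (mul_pos two_pos hk), div_le_iff₀ (by positivity)]; linarith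
  · by_contra! hlt
    refine hs ?_
    unfold chi
    rw [h.eq_zero, h.eq_zero, sub_self]
    · rw [abs_div, abs_of_pos hk, lt_div_iff₀ hk]; linarith
    · rw [abs_div, hk1, abs_of_pos (mul_pos two_pos hk), lt_div_iff₀ (by positivity)]; linarith

theorem measurable_chi (h : IsBasicCutoff μ₀) (k : ℤ) : Measurable (chi μ₀ k) := by
  have := h.measurable
  unfold chi
  fun_prop

theorem measurable_muCut (h : IsBasicCutoff μ₀) (j : ℕ) : Measurable (muCut μ₀ j) := by
  unfold muCut
  by_cases hj : j = 0
  · simpa [hj] using h.measurable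
  · simpa [hj] using measurable_chi h _

theorem abs_muCut_le_one (h : IsBasicCutoff μ₀) (j : ℕ) (s : ℝ) : |muCut μ₀ j s| ≤ 1 := by
  unfold muCut
  split_ifs
  · have := h.mem_Icc s
    rw [abs_le]; constructor <;> linarith [this.1, this.2]
  · exact abs_chi_le_one h _ _

theorem abs_le_of_muCut_ne_zero (h : IsBasicCutoff μ₀) {j : ℕ} {s : ℝ} (hs : muCut μ₀ j s ≠ 0) :
    |s| ≤ 2 * 2 ^ j := by
  unfold muCut at hs
  split_ifs at hs with hj
  · by_contra! hlt
    refine hs (h.eq_zero ?_)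
    rw [hj] at hlt; norm_num at hlt; linarith
  · refine (abs_le_of_chi_ne_zero h hs).2.trans (le_of_eq ?_)
    rw [zpow_add₀ (by norm_num)]; simp [mul_comm]

theorem le_abs_of_muCut_ne_zero (h : IsBasicCutoff μ₀) {j : ℕ} (hj : j ≠ 0) {s : ℝ}
    (hs : muCut μ₀ j s ≠ 0) : 2 ^ j ≤ 2 * |s| := by
  unfold muCut at hs
  rw [if_neg hj] at hs
  have := (abs_le_of_chi_ne_zero h hs).1
  rw [zpow_sub₀ (by norm_num)] at this
  simp at this
  linarith

/-- The sum telescopes, so the partial sums of the dyadic decomposition are again dilated cutoffs.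
-/
theorem sum_muCut (μ₀ : ℝ → ℝ) (n : ℕ) (s : ℝ) :
    ∑ j ∈ Finset.range (n + 1), muCut μ₀ j s = μ₀ (s / 2 ^ n) := by
  induction n with
  | zero => simp [muCut]
  | succ n ih =>
    rw [Finset.sum_range_succ, ih, muCut, if_neg (by omega), chi]
    have : ((n + 1 : ℕ) : ℤ) - 1 = n := by push_cast; ring
    rw [this, zpow_natCast, zpow_natCast]
    ring

/-- The piece of `f` of modulation `2^j`. -/
def muPiece (μ₀ : ℝ → ℝ) (j : ℕ) (f : R3 → ℂ) (p : R3) : ℂ := (muCut μ₀ j (modulation p) : ℂ) * f p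

theorem aestronglyMeasurable_muPiece (h : IsBasicCutoff μ₀) (j : ℕ) {f : R3 → ℂ}
    (hf : AEStronglyMeasurable f volume) : AEStronglyMeasurable (muPiece μ₀ j f) volume := by
  have h1 : Measurable fun p => (muCut μ₀ j (modulation p) : ℂ) :=
    Complex.measurable_ofReal.comp ((measurable_muCut h j).comp measurable_modulation)
  exact h1.aestronglyMeasurable.mul hf

theorem norm_muPiece_le (h : IsBasicCutoff μ₀) (j : ℕ) (f : R3 → ℂ) (p : R3) :
    ‖muPiece μ₀ j f p‖ ≤ ‖f p‖ := by
  rw [muPiece, norm_mul, Complex.norm_real]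
  exact mul_le_of_le_one_left (norm_nonneg _) (abs_muCut_le_one h _ _)

theorem memLp_muPiece (h : IsBasicCutoff μ₀) (j : ℕ) {f : R3 → ℂ} (hf : MemLp f 2 volume) :
    MemLp (muPiece μ₀ j f) 2 volume :=
  hf.of_le (aestronglyMeasurable_muPiece h j hf.1) (Filter.Eventually.of_forall (norm_muPiece_le h j f))

/-- The restriction of `f` to `{0 < σ ξ}`. -/
def halfPart (σ : ℝ) (f : R3 → ℂ) : R3 → ℂ := Set.indicator {p | 0 < σ * p 0} f

theorem measurableSet_half (σ : ℝ) : MeasurableSet {p : R3 | 0 < σ * p 0} := by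
  measurability

theorem memLp_halfPart (σ : ℝ) {f : R3 → ℂ} (hf : MemLp f 2 volume) :
    MemLp (halfPart σ f) 2 volume := hf.indicator (measurableSet_half σ)

theorem ae_ne_zero_coord : ∀ᵐ p : R3, p 0 ≠ 0 := by
  have h1 : ∀ᵐ q : ℝ × ℝ × ℝ, q.1 ≠ 0 := by
    have : ∀ᵐ a : ℝ, a ≠ 0 := by simp [ae_iff]
    exact Measure.quasiMeasurePreserving_fst.ae this
  exact measurePreserving_coords.quasiMeasurePreserving.ae h1

theorem eq_halfPart_add (f : R3 → ℂ) : f =ᵐ[volume] halfPart 1 f + halfPart (-1) f := by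
  filter_upwards [ae_ne_zero_coord] with p hp
  rcases lt_or_gt_of_ne hp with h | h
  · simp [halfPart, Set.indicator, h, not_lt.2 h.le]
  · simp [halfPart, Set.indicator, h, not_lt.2 h.le]

theorem muPiece_sum (f : R3 → ℂ) (n : ℕ) :
    ∑ j ∈ Finset.range (n + 1), muPiece μ₀ j f
      = fun p => (μ₀ (modulation p / 2 ^ n) : ℂ) * f p := by
  ext p
  rw [Finset.sum_apply, ← sum_muCut μ₀]
  simp [muPiece, Finset.sum_mul]

theorem eLpNorm_ift_sum_le {ι : Type*} (s : Finset ι) (f : ι → R3 → ℂ)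
    (hf : ∀ i, MemLp (f i) 2 volume) :
    eLpNorm (ift (∑ i ∈ s, f i)) 4 volume ≤ ∑ i ∈ s, eLpNorm (ift (f i)) 4 volume := by
  classical
  induction s using Finset.induction_on with
  | empty =>
    simp only [Finset.sum_empty]
    rw [eLpNorm_congr_ae ift_zero]; simp
  | insert i s hi ih =>
    rw [Finset.sum_insert hi, Finset.sum_insert hi]
    refine (eLpNorm_ift_four_add_le (hf i) (memLp_finsetSum' s fun i _ => hf i)).trans ?_
    gcongr

theorem rpow_half_natCast (j : ℕ) : ENNReal.ofReal √(6 * (2 * 2 ^ j)) ≤ 4 * (2 : ℝ≥0∞) ^ ((j : ℝ) / 2) := by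
  have h1 : √(6 * (2 * 2 ^ j)) ≤ 4 * (2 : ℝ) ^ ((j : ℝ) / 2) := by
    rw [Real.sqrt_le_left (by positivity), mul_pow, ← Real.rpow_natCast (2 ^ ((j : ℝ) / 2)), ← Real.rpow_mul (by norm_num)]
    have : (2 : ℝ) ^ ((j : ℝ) / 2 * (2 : ℕ)) = 2 ^ j := by
      rw [← Real.rpow_natCast]; congr 1; push_cast; ring
    rw [this]
    have : (0 : ℝ) < 2 ^ j := by positivity
    linarith
  refine (ENNReal.ofReal_le_ofReal h1).trans (le_of_eq ?_)
  rw [ENNReal.ofReal_mul (by norm_num), ← ENNReal.ofReal_rpow_of_pos (by norm_num)]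
  norm_num

/-- Each dyadic piece lies in a layer with `M = 2 · 2^j`, so the Strichartz estimate costs a
multiple of `2^{j/2}`. Restricting the sign of `ξ` is essential, because the area bound concerns two
frequencies of the same sign. Partial sums are handled by the triangle inequality, and the limit by
lower semicontinuity. -/
theorem eLpNorm_ift_halfPart_le (h : IsBasicCutoff μ₀) {f : R3 → ℂ} (hf : MemLp f 2 volume)
    {σ : ℝ} (hσ : σ = 1 ∨ σ = -1) :
    eLpNorm (ift (halfPart σ f)) 4 volume
      ≤ 4 * ∑' j : ℕ, (2 : ℝ≥0∞) ^ ((j : ℝ) / 2) * eLpNorm (muPiece μ₀ j f) 2 volume := by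
  have hfσ := memLp_halfPart σ hf
  refine eLpNorm_ift_four_le_of_tendsto (g := fun n p => (μ₀ (modulation p / 2 ^ n) : ℂ) *
    halfPart σ f p) hfσ ?_ ?_ ?_ ?_
  · intro n
    have h1 : Measurable fun p => (μ₀ (modulation p / 2 ^ n) : ℂ) :=
      Complex.measurable_ofReal.comp (h.measurable.comp (measurable_modulation.div_const _))
    exact h1.aestronglyMeasurable.mul hfσ.1
  · intro n p
    have := h.mem_Icc (modulation p / 2 ^ n)
    rw [norm_mul, Complex.norm_real, Real.norm_of_nonneg this.1]
    exact mul_le_of_le_one_left (norm_nonneg _) this.2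
  · intro p
    -- At each point the cutoff equals `1` as soon as `2^n` exceeds the modulation, so the sequence
    -- is eventually constant.
    refine tendsto_const_nhds.congr' ?_
    have : Filter.Tendsto (fun n : ℕ => (2 : ℝ) ^ n) Filter.atTop Filter.atTop :=
      tendsto_pow_atTop_atTop_of_one_lt (by norm_num)
    filter_upwards [this.eventually_ge_atTop |modulation p|] with n hn
    rw [h.eq_one', Complex.ofReal_one, one_mul]
    rw [abs_div, abs_of_pos (by positivity : (0 : ℝ) < 2 ^ n)]
    exact ((div_le_one (by positivity)).2 hn).trans (by norm_num)
  · intro n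
    rw [← muPiece_sum]
    refine (eLpNorm_ift_sum_le _ _ fun j => memLp_muPiece h j hfσ).trans ?_
    rw [← ENNReal.tsum_mul_left]
    refine le_trans (Finset.sum_le_sum fun j _ => ?_) (ENNReal.sum_le_tsum (Finset.range (n + 1)))
    refine (eLpNorm_ift_four_le_of_layer (memLp_muPiece h j hfσ) hσ
      (by positivity : (0 : ℝ) ≤ 2 * 2 ^ j) ?_).trans ?_
    · intro p hp
      rw [muPiece, mul_ne_zero_iff] at hp
      refine ⟨?_, abs_le_of_muCut_ne_zero h (by exact_mod_cast hp.1)⟩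
      by_contra hc
      exact hp.2 (Set.indicator_of_notMem (s := {p : R3 | 0 < σ * p 0}) hc f)
    · rw [← mul_assoc (4 : ℝ≥0∞)]
      refine mul_le_mul' (rpow_half_natCast j) ?_
      · refine eLpNorm_mono fun p => ?_
        rw [muPiece, muPiece, norm_mul, norm_mul]
        gcongr
        exact norm_indicator_le_norm_self _ _

/-- The `L⁴` estimate for `ℓ¹` sums over dyadic modulations. -/
theorem eLpNorm_ift_four_le_tsum (h : IsBasicCutoff μ₀) {f : R3 → ℂ} (hf : MemLp f 2 volume) :
    eLpNorm (ift f) 4 volume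
      ≤ 8 * ∑' j : ℕ, (2 : ℝ≥0∞) ^ ((j : ℝ) / 2) * eLpNorm (muPiece μ₀ j f) 2 volume := by
  rw [ift_congr (eq_halfPart_add f)]
  refine (eLpNorm_ift_four_add_le (memLp_halfPart _ hf) (memLp_halfPart _ hf)).trans ?_
  refine (add_le_add (eLpNorm_ift_halfPart_le h hf (Or.inl rfl))
    (eLpNorm_ift_halfPart_le h hf (Or.inr rfl))).trans (le_of_eq ?_)
  rw [← add_mul]; norm_num

/-- `∑_i 2^{-ci}`. -/
def geomSum (c : ℝ) : ℝ≥0∞ := ∑' i : ℕ, (2 : ℝ≥0∞) ^ (-(c * i))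

theorem geomSum_lt_top {c : ℝ} (hc : 0 < c) : geomSum c < ⊤ := by
  have : geomSum c = ∑' i : ℕ, ((2 : ℝ≥0∞) ^ (-c)) ^ i := by
    unfold geomSum
    congr 1; ext i
    rw [← ENNReal.rpow_natCast, ← ENNReal.rpow_mul]; congr 1; ring
  rw [this, ENNReal.tsum_geometric, ENNReal.inv_lt_top, tsub_pos_iff_lt]
  exact ENNReal.rpow_lt_one_of_one_lt_of_neg (by norm_num) (by linarith)

theorem two_rpow_add (a b : ℝ) : (2 : ℝ≥0∞) ^ (a + b) = 2 ^ a * 2 ^ b :=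
  ENNReal.rpow_add _ _ (by norm_num) (by norm_num)

/-- In the tail put `j = i + 2m`. Then `2^{j/2} a_j = 2^{-i/2} · 2^{j-m} a_j`, and `2^{j-m} a_j` is
at most the square root of the tail sum. The tail starts at `2m`, and this makes the loss geometric
with no dependence on `m`. -/
theorem tsum_le_sum_add_sqrt_tsum (a : ℕ → ℝ≥0∞) (m : ℕ) :
    ∑' j : ℕ, (2 : ℝ≥0∞) ^ ((j : ℝ) / 2) * a j
      ≤ (1 + geomSum (1 / 2)) * (∑ j ∈ Finset.range (2 * m), (2 : ℝ≥0∞) ^ ((j : ℝ) / 2) * a j +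
        (∑' j : Set.Ici (2 * m), (2 : ℝ≥0∞) ^ (2 * (j : ℝ) - 2 * (m : ℝ)) * a j ^ (2 : ℝ))
          ^ (1 / 2 : ℝ)) := by
  generalize hA : ∑ j ∈ Finset.range (2 * m), (2 : ℝ≥0∞) ^ ((j : ℝ) / 2) * a j = A
  generalize hT : ∑' j : Set.Ici (2 * m), (2 : ℝ≥0∞) ^ (2 * (j : ℝ) - 2 * (m : ℝ)) *
    a j ^ (2 : ℝ) = T
  have hterm : ∀ i : ℕ, (2 : ℝ≥0∞) ^ (((i + 2 * m : ℕ) : ℝ) / 2) * a (i + 2 * m)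
      ≤ 2 ^ (-(1 / 2 * (i : ℝ))) * T ^ (1 / 2 : ℝ) := by
    intro i
    have h1 : (2 : ℝ≥0∞) ^ (2 * ((i + 2 * m : ℕ) : ℝ) - 2 * (m : ℝ)) * a (i + 2 * m) ^ (2 : ℝ)
        ≤ T := by
      rw [← hT]
      have hi : i + 2 * m ∈ Set.Ici (2 * m) := Set.mem_Ici.2 (Nat.le_add_left _ _)
      exact ENNReal.le_tsum (f := fun j : Set.Ici (2 * m) =>
        (2 : ℝ≥0∞) ^ (2 * ((j : ℕ) : ℝ) - 2 * (m : ℝ)) * a j ^ (2 : ℝ)) ⟨i + 2 * m, hi⟩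
    calc (2 : ℝ≥0∞) ^ (((i + 2 * m : ℕ) : ℝ) / 2) * a (i + 2 * m)
        = 2 ^ (-(1 / 2 * (i : ℝ))) * ((2 : ℝ≥0∞) ^ (2 * ((i + 2 * m : ℕ) : ℝ) - 2 * (m : ℝ))
          * a (i + 2 * m) ^ (2 : ℝ)) ^ (1 / 2 : ℝ) := by
          rw [ENNReal.mul_rpow_of_nonneg _ _ (by norm_num), ← ENNReal.rpow_mul, ← ENNReal.rpow_mul,
            ← mul_assoc, ← two_rpow_add, show (2 : ℝ) * (1 / 2) = 1 by norm_num, ENNReal.rpow_one]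
          congr 2
          push_cast
          ring
      _ ≤ _ := by gcongr
  have hsplit := Summable.sum_add_tsum_nat_add' (k := 2 * m)
    (f := fun j : ℕ => (2 : ℝ≥0∞) ^ ((j : ℝ) / 2) * a j) ENNReal.summable
  have htail : ∑' i : ℕ, (2 : ℝ≥0∞) ^ (((i + 2 * m : ℕ) : ℝ) / 2) * a (i + 2 * m)
      ≤ geomSum (1 / 2) * T ^ (1 / 2 : ℝ) := by
    refine (ENNReal.tsum_le_tsum hterm).trans ?_
    rw [ENNReal.tsum_mul_right, geomSum]
  rw [hA] at hsplit
  rw [← hsplit, mul_add]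
  refine add_le_add (le_mul_of_one_le_left zero_le le_self_add) (htail.trans ?_)
  exact mul_le_mul_left le_add_self _

theorem tsum_muPiece_le_Xnorm (μ₀ : ℝ → ℝ) {k : ℤ} {f : R3 → ℂ} :
    ∑' j : ℕ, (2 : ℝ≥0∞) ^ ((j : ℝ) / 2) * eLpNorm (muPiece μ₀ j f) 2 volume
      ≤ (1 + geomSum (1 / 2)) * Xnorm μ₀ k f := by
  by_cases hf : IsL2Slab k f
  swap
  · rw [Xnorm, if_neg hf, ENNReal.mul_top (by simp)]; exact le_top
  rw [Xnorm, if_pos hf]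
  exact tsum_le_sum_add_sqrt_tsum (fun j => eLpNorm (muPiece μ₀ j f) 2 volume) k.toNat

theorem isL2Slab_of_Xnorm_lt_top {k : ℤ} {f : R3 → ℂ} (h : Xnorm μ₀ k f < ⊤) : IsL2Slab k f := by
  by_contra hc
  rw [Xnorm, if_neg hc] at h
  exact lt_irrefl _ h

/-- The `L⁴` estimate for `X_k`. -/
theorem exists_eLpNorm_ift_four_le_Xnorm (h : IsBasicCutoff μ₀) :
    ∃ C : ℝ≥0, ∀ (k : ℤ) (f : R3 → ℂ), MemLp f 2 volume →
      eLpNorm (ift f) 4 volume ≤ C * Xnorm μ₀ k f := by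
  have hfin : (8 * (1 + geomSum (1 / 2))) ≠ ⊤ := by
    have := (geomSum_lt_top (c := 1 / 2) (by norm_num)).ne
    finiteness
  refine ⟨(8 * (1 + geomSum (1 / 2))).toNNReal, fun k f hf => ?_⟩
  rw [ENNReal.coe_toNNReal hfin, mul_assoc]
  exact (eLpNorm_ift_four_le_tsum h hf).trans (by gcongr; exact tsum_muPiece_le_Xnorm μ₀)

theorem norm_symb (p : R3) : ‖symb p‖ = √(modulation p ^ 2 + 1) := by
  rw [symb, Complex.norm_eq_sqrt_sq_add_sq]; simp

theorem one_le_norm_symb (p : R3) : 1 ≤ ‖symb p‖ := by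
  rw [norm_symb]; exact Real.one_le_sqrt.2 (by nlinarith [sq_nonneg (modulation p)])

theorem abs_modulation_le_norm_symb (p : R3) : |modulation p| ≤ ‖symb p‖ := by
  rw [norm_symb]; exact Real.abs_le_sqrt (by linarith)

theorem symb_ne_zero (p : R3) : symb p ≠ 0 := by
  have := one_le_norm_symb p
  intro h; rw [h, norm_zero] at this; linarith

theorem two_pow_le_norm_symb (h : IsBasicCutoff μ₀) {j : ℕ} {p : R3}
    (hp : muCut μ₀ j (modulation p) ≠ 0) : 2 ^ j ≤ 2 * ‖symb p‖ := by
  rcases eq_or_ne j 0 with rfl | hj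
  · have := one_le_norm_symb p; norm_num; linarith
  · have := le_abs_of_muCut_ne_zero h hj hp
    have := abs_modulation_le_norm_symb p
    linarith

/-- The `L⁴` estimate with the weight `⟨τ - ω⟩^{5/8}`. -/
theorem exists_eLpNorm_ift_four_le_weight (h : IsBasicCutoff μ₀) :
    ∃ C : ℝ≥0, ∀ (f : R3 → ℂ), MemLp f 2 volume →
      eLpNorm (ift f) 4 volume
        ≤ C * eLpNorm (fun p => ((‖symb p‖ ^ (5 / 8 : ℝ) : ℝ) : ℂ) * f p) 2 volume := by
  have hfin : (8 * (2 * geomSum (1 / 8))) ≠ ⊤ := by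
    have := (geomSum_lt_top (c := 1 / 8) (by norm_num)).ne
    finiteness
  refine ⟨(8 * (2 * geomSum (1 / 8))).toNNReal, fun f hf => ?_⟩
  rw [ENNReal.coe_toNNReal hfin, mul_assoc]
  refine (eLpNorm_ift_four_le_tsum h hf).trans ?_
  gcongr
  set W := eLpNorm (fun p => ((‖symb p‖ ^ (5 / 8 : ℝ) : ℝ) : ℂ) * f p) 2 volume
  have hpiece : ∀ j : ℕ, eLpNorm (muPiece μ₀ j f) 2 volume
      ≤ ENNReal.ofReal (2 * (2 : ℝ) ^ (-(5 / 8 * (j : ℝ)))) * W := by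
    intro j
    refine eLpNorm_le_mul_eLpNorm_of_ae_le_mul (Filter.Eventually.of_forall fun p => ?_) 2
    by_cases hp : muCut μ₀ j (modulation p) = 0
    · rw [muPiece, hp]; simp; positivity
    have h1 := two_pow_le_norm_symb h hp
    have h2 : 1 ≤ 2 * (2 : ℝ) ^ (-(5 / 8 * (j : ℝ))) * ‖symb p‖ ^ (5 / 8 : ℝ) := by
      have h3 : ((2 : ℝ) ^ j) ^ (5 / 8 : ℝ) ≤ (2 * ‖symb p‖) ^ (5 / 8 : ℝ) := by gcongr
      rw [← Real.rpow_natCast, ← Real.rpow_mul (by norm_num),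
        Real.mul_rpow (by norm_num) (norm_nonneg _)] at h3
      have h4 : (2 : ℝ) ^ (5 / 8 : ℝ) ≤ 2 := by
        calc (2 : ℝ) ^ (5 / 8 : ℝ) ≤ 2 ^ (1 : ℝ) := by gcongr <;> norm_num
          _ = 2 := by norm_num
      have h5 : (0 : ℝ) < 2 ^ ((j : ℝ) * (5 / 8)) := by positivity
      rw [Real.rpow_neg (by norm_num), mul_comm (5 / 8 : ℝ), mul_assoc, mul_left_comm,
        ← div_eq_inv_mul, le_div_iff₀ h5, one_mul]
      refine h3.trans ?_
      gcongr
    rw [norm_mul, Complex.norm_real, Real.norm_of_nonneg (by positivity), ← mul_assoc]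
    exact (norm_muPiece_le h j f p).trans (le_mul_of_one_le_left (norm_nonneg _) h2)
  -- The weight gives `2^{-5j/8}` against `2^{j/2}`, leaving the summable factor `2^{-j/8}`. This
  -- needs an exponent above `1/2`; the later Poisson kernel bound needs one below `3/4`.
  calc _ ≤ ∑' j : ℕ, 2 * W * (2 : ℝ≥0∞) ^ (-(1 / 8 * (j : ℝ))) := by
        refine ENNReal.tsum_le_tsum fun j => ?_
        refine (mul_le_mul_right (hpiece j) _).trans (le_of_eq ?_)
        rw [ENNReal.ofReal_mul (by norm_num), ← ENNReal.ofReal_rpow_of_pos (by norm_num),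
          show (-(1 / 8 * (j : ℝ))) = (j : ℝ) / 2 + (-(5 / 8 * (j : ℝ))) by ring, two_rpow_add]
        simp only [ENNReal.ofReal_ofNat]
        ring
    _ = _ := by rw [ENNReal.tsum_mul_left, geomSum]; ring

end Cutoff

end KPI
end

noncomputable section

namespace KPI

open MeasureTheory

/-! ### Splitting off the second coordinate -/

/-- The plane of the first and the third coordinate. -/
abbrev R2 : Type := EuclideanSpace ℝ (Fin 2)

/-- The first and the third coordinate. -/
def sp (p : R3) : R2 := !₂[p 0, p 2]

/-- The point with the given first and third coordinates and the given second coordinate. -/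
def join (v : R2) (s : ℝ) : R3 := !₂[v 0, s, v 1]

@[simp] theorem join_zero (v : R2) (s : ℝ) : join v s 0 = v 0 := rfl
@[simp] theorem join_one (v : R2) (s : ℝ) : join v s 1 = s := rfl
@[simp] theorem join_two (v : R2) (s : ℝ) : join v s 2 = v 1 := rfl
@[simp] theorem sp_zero (p : R3) : sp p 0 = p 0 := rfl
@[simp] theorem sp_one (p : R3) : sp p 1 = p 2 := rfl

@[simp] theorem sp_join (v : R2) (s : ℝ) : sp (join v s) = v := by
  ext i; fin_cases i <;> rfl

theorem join_sp (p : R3) : join (sp p) (p 1) = p := by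
  ext i; fin_cases i <;> rfl

theorem inner_join_join (v w : R2) (s r : ℝ) :
    inner ℝ (join v s) (join w r) = inner ℝ v w + s * r := by
  simp [PiLp.inner_apply, Fin.sum_univ_succ, join]
  ring

theorem measurePreserving_split :
    MeasurePreserving (fun p : R3 => (sp p, p 1)) volume (volume.prod volume) := by
  have h1 := EuclideanSpace.volume_preserving_symm_measurableEquiv_toLp (Fin 3)
  have h2 := volume_preserving_piFinSuccAbove (fun _ : Fin 3 => ℝ) 1
  have h3 : MeasurePreserving (Prod.swap : ℝ × (Fin 2 → ℝ) → (Fin 2 → ℝ) × ℝ)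
    (volume.prod volume) (volume.prod volume) := Measure.measurePreserving_swap
  have h4 := ((EuclideanSpace.volume_preserving_symm_measurableEquiv_toLp (Fin 2)).symm).prod
    (MeasurePreserving.id (volume : Measure ℝ))
  have h5 := h4.comp (h3.comp (h2.comp h1))
  have h6 : (fun p : R3 => (sp p, p 1)) = (Prod.map
      (⇑(MeasurableEquiv.toLp 2 (Fin 2 → ℝ)).symm.symm) id ∘ Prod.swap ∘
        ⇑(MeasurableEquiv.piFinSuccAbove (fun _ => ℝ) 1) ∘
        ⇑(MeasurableEquiv.toLp 2 (Fin 3 → ℝ)).symm) := by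
    funext p
    refine Prod.ext ?_ rfl
    ext i
    fin_cases i <;> rfl
  rw [h6]
  exact h5

/-- The splitting of `ℝ³` as a measurable equivalence. -/
def splitEquiv : R3 ≃ᵐ R2 × ℝ where
  toFun := fun p => (sp p, p 1)
  invFun := fun q => join q.1 q.2
  left_inv := join_sp
  right_inv := fun q => by simp
  measurable_toFun := measurePreserving_split.measurable
  measurable_invFun := by
    show Measurable fun q : R2 × ℝ => !₂[q.1 0, q.2, q.1 1]
    refine (PiLp.continuous_toLp 2 _).measurable.comp ?_
    refine measurable_pi_lambda _ fun i => ?_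
    fin_cases i <;> simp <;> fun_prop

theorem measurePreserving_join :
    MeasurePreserving (fun q : R2 × ℝ => join q.1 q.2) (volume.prod volume) volume :=
  MeasurePreserving.symm splitEquiv measurePreserving_split

theorem measurable_sp : Measurable sp := measurable_fst.comp measurePreserving_split.measurable

theorem measurableEmbedding_join : MeasurableEmbedding (fun q : R2 × ℝ => join q.1 q.2) :=
  splitEquiv.symm.measurableEmbedding

theorem measurable_join_left (s : ℝ) : Measurable fun v : R2 => join v s :=
  measurePreserving_join.measurable.comp (measurable_id.prodMk measurable_const)

theorem lintegral_split {F : R3 → ℝ≥0∞} (hF : AEMeasurable F volume) :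
    ∫⁻ p, F p = ∫⁻ v : R2, ∫⁻ s : ℝ, F (join v s) := by
  rw [← measurePreserving_join.lintegral_comp_emb measurableEmbedding_join]
  exact lintegral_prod _ (hF.comp_quasiMeasurePreserving measurePreserving_join.quasiMeasurePreserving)

theorem lintegral_split_swap {F : R3 → ℝ≥0∞} (hF : AEMeasurable F volume) :
    ∫⁻ p, F p = ∫⁻ s : ℝ, ∫⁻ v : R2, F (join v s) := by
  rw [← measurePreserving_join.lintegral_comp_emb measurableEmbedding_join]
  exact lintegral_prod_symm _
    (hF.comp_quasiMeasurePreserving measurePreserving_join.quasiMeasurePreserving)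

theorem integrable_split {F : R3 → ℂ} (hF : Integrable F volume) :
    Integrable (fun q : R2 × ℝ => F (join q.1 q.2)) (volume.prod volume) :=
  measurePreserving_join.integrable_comp_of_integrable hF

theorem integral_split {F : R3 → ℂ} (hF : Integrable F volume) :
    ∫ p, F p = ∫ v : R2, ∫ s : ℝ, F (join v s) := by
  rw [← measurePreserving_join.integral_comp measurableEmbedding_join]
  exact integral_prod _ (integrable_split hF)

/-! ### Half-space support -/

section FourierTwo

variable {E : Type*} [NormedAddCommGroup E] [InnerProductSpace ℝ E] [FiniteDimensional ℝ E]
  [MeasurableSpace E] [BorelSpace E]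

theorem ae_eq_zero_of_fourier_eq_zero {G : E → ℂ} (hG : Integrable G (volume : Measure E))
    (h : ∀ x, 𝓕 G x = 0) : G =ᵐ[volume] 0 := by
  refine ae_eq_of_integral_schwartz hG.locallyIntegrable locallyIntegrable_zero fun ψ => ?_
  have h1 := integral_fourier_mul hG (𝓕⁻ ψ : SchwartzMap E ℂ).integrable
  have h2 : 𝓕 (⇑(𝓕⁻ ψ : SchwartzMap E ℂ)) = ψ := by
    rw [← SchwartzMap.fourier_coe, FourierTransform.fourier_fourierInv_eq]
  rw [h2] at h1
  rw [← h1]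
  simp [h]

/-- Plancherel for `L¹ ∩ L²`. -/
theorem eLpNorm_fourier_two {f : E → ℂ} (hf : Integrable f (volume : Measure E))
    (hf2 : MemLp f 2 (volume : Measure E)) :
    eLpNorm (𝓕 f) 2 volume = eLpNorm f 2 (volume : Measure E) := by
  have hneg := Measure.measurePreserving_neg (volume : Measure E)
  have h1 : MemLp (fun x => f (-x)) 2 (volume : Measure E) := hf2.comp_measurePreserving hneg
  have h2 : Integrable (fun x => f (-x)) (volume : Measure E) := hf.comp_neg
  have h3 : 𝓕⁻ (fun x => f (-x)) = 𝓕 f := by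
    rw [Real.fourierInv_eq_fourier_comp_neg]; simp
  rw [← h3, ← eLpNorm_congr_ae (ift_of_integrable h1 h2), eLpNorm_ift h1]
  exact eLpNorm_comp_measurePreserving hf2.1 hneg

end FourierTwo

/-- Fubini: the three-dimensional transform restricted to a plane of constant `y` is the planar
transform of the partial transform in `μ`. -/
theorem fourier_join {Θ : R3 → ℂ} (hΘ : Integrable Θ volume) (v : R2) (y : ℝ) :
    𝓕 Θ (join v y) = 𝓕 (fun w : R2 => ∫ s : ℝ,
      ((Real.fourierChar (-(s * y)) : Circle) : ℂ) * Θ (join w s)) v := by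
  rw [Real.fourier_eq, Real.fourier_eq, integral_split ((Real.fourierIntegral_convergent_iff _).2 hΘ)]
  refine integral_congr_ae (Filter.Eventually.of_forall fun w => ?_)
  simp only [inner_join_join, neg_add, AddChar.map_add_eq_mul, Circle.smul_def, Circle.coe_mul,
    smul_eq_mul, mul_assoc]
  rw [integral_const_mul]

theorem integrable_fourierChar_slice {Θ : R3 → ℂ} (hΘ : Integrable Θ volume) (y : ℝ) :
    Integrable (fun q : R2 × ℝ => ((Real.fourierChar (-(q.2 * y)) : Circle) : ℂ) *
      Θ (join q.1 q.2)) (volume.prod volume) := by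
  have h := integrable_split hΘ
  refine h.norm.mono' (AEStronglyMeasurable.mul ?_ h.1)
    (Filter.Eventually.of_forall fun q => (norm_fourierChar_mul _ _).le)
  refine Continuous.aestronglyMeasurable ?_
  exact continuous_subtype_val.comp (Real.continuous_fourierChar.comp (by fun_prop))

/-- The partial inverse Fourier transform of a function vanishing on `{y = s}` vanishes. -/
theorem partial_inversion_eq_zero (ψ : SchwartzMap R3 ℂ) {y : ℝ} (hψ : ∀ v, ψ (join v y) = 0) :
    ∀ᵐ w : R2, ∫ s : ℝ, ((Real.fourierChar (-(s * y)) : Circle) : ℂ) * 𝓕⁻ (ψ : R3 → ℂ) (join w s)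
      = 0 := by
  have hint : Integrable (𝓕⁻ (ψ : R3 → ℂ)) volume := by
    rw [← SchwartzMap.fourierInv_coe]; exact (𝓕⁻ ψ : SchwartzMap R3 ℂ).integrable
  refine ae_eq_zero_of_fourier_eq_zero (integrable_fourierChar_slice hint y).integral_prod_left
    fun v => ?_
  rw [← fourier_join hint, ← SchwartzMap.fourierInv_coe, ← SchwartzMap.fourier_coe,
    FourierTransform.fourier_fourierInv_eq, hψ]

/-- The sign condition makes the exponential decay, and its primitive gives `z⁻¹`. This is the
source of one-sidedness: only `s > 0` enters. -/
theorem integral_exp_resolvent {σ : ℝ} (hσ : σ = 1 ∨ σ = -1) {z : ℂ} (hz : 0 < σ * z.im) :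
    z⁻¹ = -(2 * Real.pi * Complex.I * σ) *
      ∫ s in Set.Ioi (0 : ℝ), Complex.exp (2 * Real.pi * Complex.I * σ * z * s) := by
  have hre : (2 * Real.pi * Complex.I * σ * z).re < 0 := by
    have : (2 * Real.pi * Complex.I * σ * z).re = -(2 * Real.pi * (σ * z.im)) := by
      simp; ring
    rw [this]; have := Real.pi_pos; nlinarith [mul_pos this hz]
  rw [integral_exp_mul_complex_Ioi hre 0]
  have hz0 : z ≠ 0 := by rintro rfl; simp at hz
  have hσ0 : (σ : ℂ) ≠ 0 := by rcases hσ with rfl | rfl <;> simp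
  have hpi : (Real.pi : ℂ) ≠ 0 := by exact_mod_cast Real.pi_ne_zero
  simp only [Complex.ofReal_zero, mul_zero, Complex.exp_zero]
  field_simp

/-- Data of a resolvent symbol `b(ξ,τ) / (N(ξ,τ) - μ)` with `N` on one side of the real axis. -/
structure ResolventData (σ ε B : ℝ) (b N : R2 → ℂ) : Prop where
  sign : σ = 1 ∨ σ = -1
  eps_pos : 0 < ε
  measurable_b : Measurable b
  measurable_N : Measurable N
  bound : ∀ v, ‖b v‖ ≤ B
  le_im : ∀ v, ε ≤ σ * (N v).im

/-- The symbol `b(ξ,τ) / (N(ξ,τ) - μ)`. -/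
def resolvent (b N : R2 → ℂ) (p : R3) : ℂ := b (sp p) * (N (sp p) - p 1)⁻¹

theorem norm_exp_resolvent (σ μ s : ℝ) (z : ℂ) :
    ‖Complex.exp (2 * Real.pi * Complex.I * σ * (z - μ) * s)‖
      = Real.exp (-(2 * Real.pi * (σ * z.im) * s)) := by
  rw [Complex.norm_exp]
  congr 1
  have : (2 * Real.pi * Complex.I * σ * (z - μ) * s : ℂ)
      = ((2 * Real.pi * σ * s : ℝ) : ℂ) * (Complex.I * (z - μ)) := by push_cast; ring
  rw [this, Complex.re_ofReal_mul]
  simp; ring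

/-- Expanding the resolvent as an integral of exponentials over `s > 0` and exchanging integrals,
the `μ` integral for a given `s` is the partial transform at height `y = σ s` of `𝓕⁻ ψ`. By partial
Fourier inversion it only sees the values of `ψ` on that plane, where `ψ` vanishes. The lower bound
`ε` makes the exchange legitimate. -/
theorem integral_resolvent_mul_eq_zero {σ ε B : ℝ} {b N : R2 → ℂ} (D : ResolventData σ ε B b N)
    (ψ : SchwartzMap R3 ℂ) (hψ : ∀ s, 0 < s → ∀ v, ψ (join v (σ * s)) = 0) :
    ∫ p, resolvent b N p * 𝓕⁻ (ψ : R3 → ℂ) p = 0 := by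
  have hint : Integrable (𝓕⁻ (ψ : R3 → ℂ)) volume := by
    rw [← SchwartzMap.fourierInv_coe]; exact (𝓕⁻ ψ : SchwartzMap R3 ℂ).integrable
  have hε := D.eps_pos
  have hNm : Measurable fun p : R3 => N (sp p) := D.measurable_N.comp measurable_sp
  have hbm : Measurable fun p : R3 => b (sp p) := D.measurable_b.comp measurable_sp
  set F : R3 → ℝ → ℂ := fun p s => (b (sp p) *
    Complex.exp (2 * Real.pi * Complex.I * σ * (N (sp p) - p 1) * s)) * 𝓕⁻ (ψ : R3 → ℂ) p with hF
  have hexp : IntegrableOn (fun s : ℝ => Real.exp (-(2 * Real.pi * ε) * s)) (Set.Ioi 0) volume :=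
    integrableOn_exp_mul_Ioi (by have := Real.pi_pos; nlinarith [mul_pos this hε]) 0
  have hFm : AEStronglyMeasurable (Function.uncurry F)
      ((volume : Measure R3).prod (volume.restrict (Set.Ioi (0 : ℝ)))) := by
    refine AEStronglyMeasurable.mul (Measurable.aestronglyMeasurable ?_) hint.1.comp_fst
    refine (hbm.comp measurable_fst).mul (Complex.measurable_exp.comp ?_)
    refine Measurable.mul (Measurable.mul (by fun_prop) ?_) (by fun_prop)
    exact (hNm.comp measurable_fst).sub (by fun_prop)
  have hFint : Integrable (Function.uncurry F)
      ((volume : Measure R3).prod (volume.restrict (Set.Ioi (0 : ℝ)))) := by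
    have hI := (hint.norm.const_mul B).mul_prod hexp
    refine hI.mono' hFm ?_
    have hs : ∀ᵐ q : R3 × ℝ ∂((volume : Measure R3).prod (volume.restrict (Set.Ioi (0 : ℝ)))),
        q.2 ∈ Set.Ioi (0 : ℝ) :=
      Measure.quasiMeasurePreserving_snd.ae (ae_restrict_mem measurableSet_Ioi)
    filter_upwards [hs] with q hq
    simp only [Function.uncurry, hF, norm_mul, norm_exp_resolvent]
    have h1 := D.bound (sp q.1)
    have h2 : Real.exp (-(2 * Real.pi * (σ * (N (sp q.1)).im) * q.2))
        ≤ Real.exp (-(2 * Real.pi * ε) * q.2) := by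
      rw [Real.exp_le_exp]
      have h3 := D.le_im (sp q.1)
      have h4 : (0 : ℝ) < q.2 := hq
      have := Real.pi_pos
      have : 0 ≤ (σ * (N (sp q.1)).im - ε) * (2 * Real.pi * q.2) :=
        mul_nonneg (by linarith) (by positivity)
      nlinarith
    calc _ ≤ B * Real.exp (-(2 * Real.pi * ε) * q.2) * ‖𝓕⁻ (ψ : R3 → ℂ) q.1‖ := by
          have : 0 ≤ B := (norm_nonneg _).trans h1
          gcongr
      _ = _ := by ring
  have h1 : ∫ p, resolvent b N p * 𝓕⁻ (ψ : R3 → ℂ) p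
      = -(2 * Real.pi * Complex.I * σ) * ∫ p, ∫ s in Set.Ioi (0 : ℝ), F p s := by
    rw [← integral_const_mul]
    refine integral_congr_ae (Filter.Eventually.of_forall fun p => ?_)
    have him : 0 < σ * (N (sp p) - p 1).im := by
      simp only [Complex.sub_im, Complex.ofReal_im, sub_zero]
      exact hε.trans_le (D.le_im _)
    simp only [resolvent, hF]
    rw [integral_exp_resolvent D.sign him, integral_mul_const, integral_const_mul]
    ring
  rw [h1, integral_integral_swap hFint]
  have h2 : ∀ s ∈ Set.Ioi (0 : ℝ), ∫ p, F p s = 0 := by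
    intro s hs
    have hs0 : (0 : ℝ) < s := hs
    have hFs : Integrable (fun p => F p s) volume := by
      refine (hint.norm.const_mul B).mono' ?_ (Filter.Eventually.of_forall fun p => ?_)
      · refine AEStronglyMeasurable.mul (Measurable.aestronglyMeasurable ?_) hint.1
        refine hbm.mul (Complex.measurable_exp.comp ?_)
        refine Measurable.mul (Measurable.mul (by fun_prop) ?_) (by fun_prop)
        exact hNm.sub (by fun_prop)
      · simp only [hF, norm_mul, norm_exp_resolvent]
        have h3 : Real.exp (-(2 * Real.pi * (σ * (N (sp p)).im) * s)) ≤ 1 := by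
          rw [Real.exp_le_one_iff]
          have := hε.le.trans (D.le_im (sp p))
          have := Real.pi_pos
          have : 0 ≤ 2 * Real.pi * (σ * (N (sp p)).im) * s := by positivity
          linarith
        have h4 := D.bound (sp p)
        have h5 : 0 ≤ B := (norm_nonneg _).trans h4
        calc _ ≤ B * 1 * ‖𝓕⁻ (ψ : R3 → ℂ) p‖ := by gcongr
          _ = _ := by ring
    rw [integral_split hFs]
    refine integral_eq_zero_of_ae ?_
    filter_upwards [partial_inversion_eq_zero ψ (hψ s hs0)] with w hw
    have h3 : ∀ t : ℝ, F (join w t) s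
        = (b w * Complex.exp (2 * Real.pi * Complex.I * σ * N w * s)) *
          (((Real.fourierChar (-(t * (σ * s))) : Circle) : ℂ) * 𝓕⁻ (ψ : R3 → ℂ) (join w t)) := by
      intro t
      simp only [hF, sp_join, join_one]
      rw [Real.fourierChar_apply, show (2 * Real.pi * Complex.I * σ * (N w - t) * s : ℂ)
        = 2 * Real.pi * Complex.I * σ * N w * s + ((2 * Real.pi * -(t * (σ * s)) : ℝ) : ℂ) * Complex.I by
          push_cast; ring, Complex.exp_add]
      ring
    simp_rw [h3]
    rw [integral_const_mul, hw, mul_zero, Pi.zero_apply]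
  rw [setIntegral_congr_fun measurableSet_Ioi h2]
  simp

theorem isOpen_halfSpace (σ : ℝ) : IsOpen {p : R3 | σ * p 1 < 0} :=
  isOpen_lt (by fun_prop) continuous_const

/-- If `σ Im N > 0`, then `𝓕⁻ [b / (N - μ)]` vanishes on `{σ y < 0}`. -/
theorem ift_resolvent_eq_zero {σ ε B : ℝ} {b N : R2 → ℂ} (D : ResolventData σ ε B b N)
    (hU : MemLp (resolvent b N) 2 volume) :
    ∀ᵐ p : R3, σ * p 1 < 0 → ift (resolvent b N) p = 0 := by
  refine IsOpen.ae_eq_zero_of_integral_contDiff_smul_eq_zero (U := {p : R3 | σ * p 1 < 0})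
    (isOpen_halfSpace σ)
    ((locallyIntegrable_of_memLp_two (memLp_ift hU)).locallyIntegrableOn _) fun φ hφ hc hs => ?_
  · have h1 : HasCompactSupport (fun x => (φ x : ℂ)) :=
      hc.comp_left (g := fun r : ℝ => (r : ℂ)) (by simp)
    have h2 : ContDiff ℝ ∞ (fun x => (φ x : ℂ)) := Complex.ofRealCLM.contDiff.comp hφ
    have h3 := integral_ift_mul_schwartz hU (h1.toSchwartzMap h2)
    rw [SchwartzMap.fourierInv_coe, integral_resolvent_mul_eq_zero D] at h3
    · simpa [mul_comm] using h3
    · intro s hs0 v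
      have hnot : join v (σ * s) ∉ tsupport φ := by
        intro hm
        have := hs hm
        simp only [Set.mem_ofPred_eq, join_one] at this
        rcases D.sign with rfl | rfl <;> linarith
      simp [image_eq_zero_of_notMem_tsupport hnot]

theorem ae_ne_zero_coord_one : ∀ᵐ p : R3, p 1 ≠ 0 := by
  have h1 : ∀ᵐ q : R2 × ℝ ∂(volume.prod volume), q.2 ≠ 0 := by
    have : ∀ᵐ a : ℝ, a ≠ 0 := by simp [ae_iff]
    exact Measure.quasiMeasurePreserving_snd.ae this
  exact measurePreserving_split.quasiMeasurePreserving.ae h1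

/-- The resolvent symbol is dominated in `L⁴` by the corresponding Poisson kernel symbol. -/
theorem eLpNorm_ift_resolvent_le {σ ε B : ℝ} {b N : R2 → ℂ} (D : ResolventData σ ε B b N)
    (hU : MemLp (resolvent b N) 2 volume)
    (hU' : MemLp (resolvent b (fun v => (starRingEnd ℂ) (N v))) 2 volume) :
    eLpNorm (ift (resolvent b N)) 4 volume
      ≤ eLpNorm (ift (resolvent b N - resolvent b fun v => (starRingEnd ℂ) (N v))) 4 volume := by
  have D' : ResolventData (-σ) ε B b (fun v => (starRingEnd ℂ) (N v)) :=
    { sign := by rcases D.sign with h | h <;> simp [h]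
      eps_pos := D.eps_pos
      measurable_b := D.measurable_b
      measurable_N := Complex.continuous_conj.measurable.comp D.measurable_N
      bound := D.bound
      le_im := fun v => by simpa using D.le_im v }
  refine eLpNorm_mono_ae ?_
  filter_upwards [ift_resolvent_eq_zero D hU, ift_resolvent_eq_zero D' hU', ift_sub hU hU',
    ae_ne_zero_coord_one] with p h1 h2 h3 h4
  rw [h3, Pi.sub_apply]
  -- The two inverse transforms live in opposite half spaces, so almost everywhere at most one is
  -- nonzero. The difference therefore has at least the modulus of the first.
  have h5 : σ * p 1 ≠ 0 := mul_ne_zero (by rcases D.sign with h | h <;> simp [h]) h4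
  rcases lt_or_gt_of_ne h5 with h | h
  · rw [h1 h, norm_zero]; exact norm_nonneg _
  · rw [h2 (by linarith), sub_zero]

end KPI
end

noncomputable section

namespace KPI

open MeasureTheory

/-! ### The roots of the symbol in `μ` -/

/-- `ξ (τ - ξ³)`. -/
def rad (v : R2) : ℝ := v 0 * (v 1 - v 0 ^ 3)

/-- The real part of the square root of `ξ (τ - ξ³) + iξ`. -/
def rootRe (v : R2) : ℝ := √((√(rad v ^ 2 + v 0 ^ 2) + rad v) / 2)

/-- The square root of `ξ (τ - ξ³) + iξ` with positive real part. -/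
def root (v : R2) : ℂ := ⟨rootRe v, v 0 / (2 * rootRe v)⟩

/-- The frequencies `(ξ, τ)` over which the region `R_{KP-I} ∩ (I_k × ℝ × ℝ)` lies. -/
def base (k : ℤ) : Set R2 :=
  {v | v 0 ∈ I k ∧ v 0 ^ 4 / 2 ^ 41 ≤ rad v ∧ rad v ≤ 2 ^ 41 * v 0 ^ 4}

theorem measurable_rad : Measurable rad := by unfold rad; fun_prop

theorem measurable_rootRe : Measurable rootRe := by
  have := measurable_rad
  unfold rootRe; fun_prop

theorem root_eq (v : R2) : root v = rootRe v + (v 0 / (2 * rootRe v) : ℝ) * Complex.I := by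
  exact Complex.mk_eq_add_mul_I _ _

theorem measurable_root : Measurable root := by
  have := measurable_rootRe
  have h : root = fun v => (rootRe v : ℂ) + ((v 0 / (2 * rootRe v) : ℝ) : ℂ) * Complex.I :=
    funext root_eq
  rw [h]; fun_prop

theorem measurableSet_I (k : ℤ) : MeasurableSet (I k) := by
  unfold I
  exact measurable_norm (measurableSet_Icc)

theorem measurableSet_base (k : ℤ) : MeasurableSet (base k) := by
  have h1 : Measurable fun v : R2 => v 0 := by fun_prop
  have h2 := measurable_rad
  exact (h1 (measurableSet_I k)).inter
    ((measurableSet_le (by fun_prop) h2).inter (measurableSet_le h2 (by fun_prop)))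

theorem rootRe_pos {v : R2} (hv : v 0 ≠ 0) : 0 < rootRe v := by
  have h1 : |rad v| < √(rad v ^ 2 + v 0 ^ 2) := by
    rw [← Real.sqrt_sq_eq_abs]
    exact Real.sqrt_lt_sqrt (sq_nonneg _) (by have := pow_pos (abs_pos.2 hv) 2; rw [sq_abs] at this; linarith)
  have := (abs_lt.1 h1).1
  exact Real.sqrt_pos.2 (by linarith)

theorem rootRe_sq {v : R2} (hv : v 0 ≠ 0) :
    rootRe v ^ 2 = (√(rad v ^ 2 + v 0 ^ 2) + rad v) / 2 := by
  have h := rootRe_pos hv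
  exact Real.sq_sqrt (Real.sqrt_pos.1 h).le

theorem rootIm_sq {v : R2} (hv : v 0 ≠ 0) :
    (v 0 / (2 * rootRe v)) ^ 2 = (√(rad v ^ 2 + v 0 ^ 2) - rad v) / 2 := by
  have h := rootRe_pos hv
  have h2 := rootRe_sq hv
  have h3 : √(rad v ^ 2 + v 0 ^ 2) ^ 2 = rad v ^ 2 + v 0 ^ 2 := Real.sq_sqrt (by positivity)
  rw [div_pow, mul_pow, div_eq_iff (by positivity), h2]
  nlinarith

theorem root_sq {v : R2} (hv : v 0 ≠ 0) : root v ^ 2 = rad v + v 0 * Complex.I := by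
  have h := rootRe_pos hv
  have h1 := rootRe_sq hv
  have h2 := rootIm_sq hv
  rw [sq]
  apply Complex.ext
  · simp only [root, Complex.mul_re, Complex.add_re, Complex.ofReal_re,
      Complex.I_re, Complex.I_im, Complex.ofReal_im]
    nlinarith
  · simp only [root, Complex.add_im, Complex.ofReal_re, Complex.mul_im,
      Complex.I_re, Complex.I_im, Complex.ofReal_im]
    field_simp
    ring

theorem norm_root_sq {v : R2} (hv : v 0 ≠ 0) : ‖root v‖ ^ 2 = √(rad v ^ 2 + v 0 ^ 2) := by
  have h1 := rootRe_sq hv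
  have h2 := rootIm_sq hv
  rw [Complex.sq_norm, Complex.normSq_apply]
  simp only [root]
  nlinarith

/-- Multiplied by `ξ`, the symbol is `ξ(τ - ξ³) + iξ - μ²`, a quadratic polynomial in `μ` whose
roots are `±root`. -/
theorem symb_eq_root {p : R3} (hp : p 0 ≠ 0) :
    symb p = (root (sp p) - p 1) * (root (sp p) + p 1) / p 0 := by
  have h := root_sq (v := sp p) hp
  have hp' : (p 0 : ℂ) ≠ 0 := by exact_mod_cast hp
  rw [eq_div_iff hp', show (root (sp p) - p 1) * (root (sp p) + p 1) = root (sp p) ^ 2 - (p 1 : ℂ) ^ 2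
    by ring, h]
  simp only [symb, modulation, omega, rad, sp_zero, sp_one]
  push_cast
  field_simp
  ring

/-- Partial fractions in `μ`. The two terms have the same form, with the root replaced by its
negative. -/
theorem inv_symb_eq {p : R3} (hp : p 0 ≠ 0) :
    (symb p)⁻¹ = p 0 / (2 * root (sp p)) * (root (sp p) - p 1)⁻¹
      + p 0 / (2 * -root (sp p)) * (-root (sp p) - p 1)⁻¹ := by
  have hp' : (p 0 : ℂ) ≠ 0 := by exact_mod_cast hp
  have h0 := symb_eq_root hp
  have h1 := symb_ne_zero p
  rw [h0] at h1 ⊢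
  have h2 : root (sp p) - p 1 ≠ 0 := fun h => h1 (by rw [h]; simp)
  have h3 : root (sp p) + p 1 ≠ 0 := fun h => h1 (by rw [h]; simp)
  have h4 : root (sp p) ≠ 0 := by
    intro h
    have := rootRe_pos (v := sp p) hp
    have h5 := congrArg Complex.re h
    simp [root] at h5
    linarith
  have h6 : -root (sp p) - p 1 = -(root (sp p) + p 1) := by ring
  rw [h6]
  field_simp
  ring

theorem one_le_of_mem_base {k : ℤ} (hk : 100 ≤ k) {v : R2} (hv : v ∈ base k) : 1 ≤ |v 0| := by
  refine le_trans ?_ hv.1.1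
  exact one_le_zpow₀ (by norm_num) (by omega)

/-- On `base k` the real part of the square of the root is comparable to `ξ⁴` and dominates its
imaginary part `ξ`. Hence the root has size about `ξ²`. -/
theorem rootRe_le_of_mem_base {k : ℤ} (hk : 100 ≤ k) {v : R2} (hv : v ∈ base k) :
    v 0 ^ 2 / 2 ^ 21 ≤ rootRe v ∧ rootRe v ≤ 2 ^ 21 * v 0 ^ 2 ∧ ‖root v‖ ≤ 2 ^ 21 * v 0 ^ 2 := by
  have h1 := one_le_of_mem_base hk hv
  have hne : v 0 ≠ 0 := by intro h; rw [h] at h1; norm_num at h1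
  obtain ⟨-, h2, h3⟩ := hv
  have h0 : 0 ≤ rad v := le_trans (by positivity) h2
  have h4 : |v 0| ^ 4 = v 0 ^ 4 := by rw [← abs_pow, abs_of_nonneg (by positivity)]
  have h5 : |v 0| ≤ v 0 ^ 4 := by rw [← h4]; exact le_self_pow₀ h1 (by norm_num)
  have h6 : √(rad v ^ 2 + v 0 ^ 2) ≤ rad v + |v 0| := by
    refine Real.sqrt_le_iff.2 ⟨by positivity, ?_⟩
    nlinarith [sq_abs (v 0), mul_nonneg h0 (abs_nonneg (v 0))]
  have h7 : rad v ≤ √(rad v ^ 2 + v 0 ^ 2) := Real.le_sqrt_of_sq_le (by nlinarith [sq_nonneg (v 0)])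
  have h8 := rootRe_sq hne
  have h9 := norm_root_sq hne
  have h10 := (rootRe_pos hne).le
  refine ⟨?_, ?_, ?_⟩
  · refine abs_le_of_sq_le_sq' ?_ h10 |>.2
    rw [h8, div_pow]
    nlinarith
  · refine abs_le_of_sq_le_sq' ?_ (by positivity) |>.2
    rw [h8, mul_pow]
    nlinarith
  · refine abs_le_of_sq_le_sq' ?_ (by positivity) |>.2
    rw [h9, mul_pow]
    nlinarith

theorem isBounded_base (k : ℤ) : Bornology.IsBounded (base k) := by
  have h2 : (0 : ℝ) < 2 ^ (k + 1) := by positivity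
  set Q : ℝ := 2 ^ (k + 1)
  refine (Metric.isBounded_closedBall (x := (0 : R2)) (r := Q + (2 ^ 41 + 1) * Q ^ 3)).subset
    fun v hv => ?_
  obtain ⟨⟨h3, h4⟩, h5, h6⟩ := hv
  have hpos : 0 < |v 0| := lt_of_lt_of_le (by positivity) h3
  have h7 : |v 1 - v 0 ^ 3| ≤ 2 ^ 41 * |v 0| ^ 3 := by
    have h8 : |v 0| * |v 1 - v 0 ^ 3| = rad v := by
      rw [← abs_mul]; exact abs_of_nonneg (le_trans (by positivity) h5)
    have h9 : v 0 ^ 4 = |v 0| * |v 0| ^ 3 := by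
      rw [← pow_succ', ← abs_pow]; exact (abs_of_nonneg (by positivity)).symm
    rw [← h8, h9] at h6
    nlinarith
  have h8 : |v 0| ^ 3 ≤ Q ^ 3 := by gcongr
  have h9 : |v 1| ≤ (2 ^ 41 + 1) * Q ^ 3 := by
    have : |v 1| ≤ |v 1 - v 0 ^ 3| + |v 0 ^ 3| := by
      have := abs_add_le (v 1 - v 0 ^ 3) (v 0 ^ 3); simpa using this
    rw [abs_pow] at this
    nlinarith
  rw [Metric.mem_closedBall, dist_zero_right]
  refine abs_le_of_sq_le_sq' ?_ (by positivity) |>.2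
  rw [EuclideanSpace.norm_sq_eq, Fin.sum_univ_two, Real.norm_eq_abs, Real.norm_eq_abs]
  nlinarith [abs_nonneg (v 0), abs_nonneg (v 1), mul_nonneg h2.le (abs_nonneg (v 1)), sq_nonneg Q,
    mul_nonneg h2.le (by positivity : 0 ≤ Q ^ 3),
    pow_le_pow_left₀ (abs_nonneg _) h4 2, pow_le_pow_left₀ (abs_nonneg _) h9 2]

theorem volume_base_lt_top (k : ℤ) : volume (base k) < ⊤ := (isBounded_base k).measure_lt_top

/-- The support of elements of `Y_k` lies over `base k`. -/
theorem sp_mem_base {k : ℤ} (hk : 100 ≤ k) {p : R3} (hp : p ∈ RKPI ∩ slab k) : sp p ∈ base k := by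
  obtain ⟨⟨h1, ⟨h2, h3⟩, h4⟩, h5⟩ := hp
  have h6 : (2 : ℝ) ^ 99 ≤ |p 0| := by
    refine le_trans ?_ h5.1
    rw [← zpow_natCast]; exact zpow_le_zpow_right₀ (by norm_num) (by push_cast; omega)
  have hne : p 0 ≠ 0 := by intro h; rw [h] at h1; norm_num at h1
  have h7 : rad (sp p) = p 0 * modulation p + p 1 ^ 2 := by
    simp only [rad, modulation, omega, sp_zero, sp_one]
    field_simp
    ring
  have h8 : |p 0 * modulation p| ≤ |p 0| ^ 2 := by
    rw [abs_mul, sq]; gcongr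
  -- The modulation changes `rad` by at most `ξ²`, which is negligible against `ξ⁴` since `|ξ| ≥
  -- 2^99`. This is why doubling the constant `2^40` to `2^41` suffices.
  have h9 : |p 0| ^ 2 * 2 ^ 60 ≤ |p 0| ^ 4 := by
    have : (2 : ℝ) ^ 60 ≤ |p 0| ^ 2 :=
      le_trans (by norm_num) (pow_le_pow_left₀ (by positivity) h6 2)
    nlinarith [sq_nonneg |p 0|]
  have h10 : p 0 ^ 4 = |p 0| ^ 4 := by rw [← abs_pow]; exact (abs_of_nonneg (by positivity)).symm
  have h11 : p 1 ^ 2 ≤ 2 ^ 40 * |p 0| ^ 4 := by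
    rw [← sq_abs (p 1)]
    calc |p 1| ^ 2 ≤ (2 ^ 20 * |p 0| ^ 2) ^ 2 := by gcongr
      _ = _ := by ring
  have h12 : |p 0| ^ 4 / 2 ^ 40 ≤ p 1 ^ 2 := by
    rw [← sq_abs (p 1)]
    calc |p 0| ^ 4 / 2 ^ 40 = (|p 0| ^ 2 / 2 ^ 20) ^ 2 := by ring
      _ ≤ _ := by gcongr
  rw [abs_le] at h8
  refine ⟨h5, ?_, ?_⟩
  · rw [h7, sp_zero, h10]; linarith [h8.1]
  · rw [h7, sp_zero, h10]; linarith [h8.2]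

/-! ### Integrability over strips -/

theorem lintegral_inv_one_add_sq_lt_top : ∫⁻ s : ℝ, ENNReal.ofReal (1 + s ^ 2)⁻¹ < ⊤ :=
  (integrable_inv_one_add_sq).lintegral_lt_top

/-- The decay is integrable in `μ`, and the other two frequencies range over a set of finite
measure. -/
theorem lintegral_strip_lt_top {T : Set R2} (hT : MeasurableSet T) (hT' : volume T < ⊤) (D : ℝ≥0) :
    ∫⁻ p : R3, (sp ⁻¹' T).indicator (fun p => D * ENNReal.ofReal (1 + p 1 ^ 2)⁻¹) p < ⊤ := by
  have hm : Measurable fun p : R3 => (D : ℝ≥0∞) * ENNReal.ofReal (1 + p 1 ^ 2)⁻¹ := by fun_prop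
  rw [lintegral_split (hm.indicator (measurable_sp hT)).aemeasurable]
  have h1 : ∀ v : R2, ∫⁻ s : ℝ, (sp ⁻¹' T).indicator
      (fun p : R3 => (D : ℝ≥0∞) * ENNReal.ofReal (1 + p 1 ^ 2)⁻¹) (join v s)
      = T.indicator (fun _ => D * ∫⁻ s : ℝ, ENNReal.ofReal (1 + s ^ 2)⁻¹) v := by
    intro v
    by_cases hv : v ∈ T
    · rw [Set.indicator_of_mem hv, ← lintegral_const_mul' _ _ (by finiteness)]
      refine lintegral_congr fun s => ?_
      rw [Set.indicator_of_mem (by simpa using hv), join_one]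
    · rw [Set.indicator_of_notMem hv]
      have : ∀ s : ℝ, (sp ⁻¹' T).indicator
        (fun p : R3 => (D : ℝ≥0∞) * ENNReal.ofReal (1 + p 1 ^ 2)⁻¹) (join v s) = 0 :=
        fun s => Set.indicator_of_notMem (by simpa using hv) _
      simp [this]
  simp_rw [h1]
  rw [lintegral_indicator_const hT]
  have := lintegral_inv_one_add_sq_lt_top
  exact ENNReal.mul_lt_top (ENNReal.mul_lt_top (by finiteness) this) hT'

theorem integrable_of_strip {f : R3 → ℂ} (hf : AEStronglyMeasurable f volume) {T : Set R2}
    (hT : MeasurableSet T) (hT' : volume T < ⊤) {D : ℝ} (hD : 0 ≤ D)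
    (h0 : ∀ p, sp p ∉ T → f p = 0) (h1 : ∀ p, sp p ∈ T → ‖f p‖ ≤ D * (1 + p 1 ^ 2)⁻¹) :
    Integrable f volume := by
  refine ⟨hf, (lintegral_mono fun p => ?_).trans_lt (lintegral_strip_lt_top hT hT' D.toNNReal)⟩
  by_cases hp : sp p ∈ T
  · rw [Set.indicator_of_mem (by exact hp), ← ofReal_norm]
    refine (ENNReal.ofReal_le_ofReal (h1 p hp)).trans (le_of_eq ?_)
    rw [ENNReal.ofReal_mul hD]; rfl
  · rw [h0 p hp]; simp

theorem memLp_two_of_strip {f : R3 → ℂ} (hf : AEStronglyMeasurable f volume) {T : Set R2}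
    (hT : MeasurableSet T) (hT' : volume T < ⊤) {D : ℝ} (hD : 0 ≤ D)
    (h0 : ∀ p, sp p ∉ T → f p = 0) (h1 : ∀ p, sp p ∈ T → ‖f p‖ ^ 2 ≤ D * (1 + p 1 ^ 2)⁻¹) :
    MemLp f 2 volume := by
  rw [memLp_two_iff_integrable_sq_norm hf]
  have : Integrable (fun p => ((‖f p‖ ^ 2 : ℝ) : ℂ)) volume := by
    refine integrable_of_strip ?_ hT hT' hD ?_ ?_
    · exact Complex.continuous_ofReal.comp_aestronglyMeasurable (hf.norm.pow 2)
    · intro p hp; simp [h0 p hp]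
    · intro p hp
      rw [Complex.norm_real, Real.norm_of_nonneg (by positivity)]
      exact h1 p hp
  have h2 := this.re
  simp only [RCLike.re_to_complex, Complex.ofReal_re] at h2
  exact h2

end KPI
end

noncomputable section

namespace KPI

open MeasureTheory

/-! ### The two branches of the symbol -/

/-- The part of `base k` where `ξ` has the sign `σ`. -/
def baseHalf (k : ℤ) (σ : ℝ) : Set R2 := base k ∩ {v | 0 < σ * v 0}

theorem measurableSet_baseHalf (k : ℤ) (σ : ℝ) : MeasurableSet (baseHalf k σ) :=
  (measurableSet_base k).inter (measurableSet_lt measurable_const (by fun_prop))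

theorem volume_baseHalf_lt_top (k : ℤ) (σ : ℝ) : volume (baseHalf k σ) < ⊤ :=
  (measure_mono Set.inter_subset_left).trans_lt (volume_base_lt_top k)

open Classical in
/-- The root `ρ M(ξ, τ)` of the symbol on `baseHalf k σ`, and a constant elsewhere. -/
def branch (k : ℤ) (σ ρ : ℝ) (v : R2) : ℂ :=
  if v ∈ baseHalf k σ then ρ * root v else (σ * ρ : ℝ) * Complex.I

/-- The coefficient `F ξ / (2 ρ M)` on `baseHalf k σ`. -/
def branchCoeff (k : ℤ) (σ ρ : ℝ) (F : R2 → ℂ) : R2 → ℂ :=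
  (baseHalf k σ).indicator fun v => F v * (v 0 / (2 * (ρ * root v)))

theorem measurable_branch (k : ℤ) (σ ρ : ℝ) : Measurable (branch k σ ρ) :=
  Measurable.ite (measurableSet_baseHalf k σ) (measurable_root.const_mul _) measurable_const

theorem measurable_branchCoeff (k : ℤ) (σ ρ : ℝ) {F : R2 → ℂ} (hF : Measurable F) :
    Measurable (branchCoeff k σ ρ F) := by
  have := measurable_root
  exact Measurable.indicator (by fun_prop) (measurableSet_baseHalf k σ)

theorem rootRe_le_norm_root {v : R2} : rootRe v ≤ ‖root v‖ :=
  (le_abs_self _).trans (Complex.abs_re_le_norm (root v))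

theorem ne_zero_of_mem_baseHalf {k : ℤ} {σ : ℝ} {v : R2} (hv : v ∈ baseHalf k σ) : v 0 ≠ 0 := by
  intro h
  have := hv.2
  simp [h] at this

theorem norm_branchCoeff_le {k : ℤ} (hk : 100 ≤ k) {σ ρ : ℝ} (hρ : |ρ| = 1) (F : R2 → ℂ) {v : R2}
    (hv : v ∈ baseHalf k σ) : ‖branchCoeff k σ ρ F v‖ ≤ 2 ^ 20 * ‖F v‖ / |v 0| := by
  have h1 := one_le_of_mem_base hk hv.1
  have h2 := (rootRe_le_of_mem_base hk hv.1).1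
  have h3 := rootRe_le_norm_root (v := v)
  have h4 : 0 < |v 0| := by linarith
  rw [branchCoeff, Set.indicator_of_mem hv, norm_mul, norm_div, norm_mul, norm_mul, Complex.norm_real,
    Complex.norm_real, Real.norm_eq_abs, Real.norm_eq_abs, hρ, one_mul, Complex.norm_ofNat]
  rw [← sq_abs] at h2
  have h5 : |v 0| ^ 2 / 2 ^ 21 ≤ ‖root v‖ := h2.trans h3
  have h6 : 0 < ‖root v‖ := lt_of_lt_of_le (by positivity) h5
  rw [mul_comm (2 ^ 20), mul_div_assoc]
  gcongr ‖F v‖ * ?_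
  rw [div_le_div_iff₀ (by positivity) h4]
  nlinarith

/-- The imaginary part of the root is `ξ / (2 Re)`, with `Re` of size `ξ²`. It is thus of size
`1/|ξ|`, and its sign is that of `ξ` times the choice `ρ` of root. This fixed sign is why the base
is cut by the sign of `ξ`. -/
theorem branch_im_bounds {k : ℤ} (hk : 100 ≤ k) {σ ρ : ℝ} (hσ : σ = 1 ∨ σ = -1)
    (hρ : ρ = 1 ∨ ρ = -1) {v : R2} (hv : v ∈ baseHalf k σ) :
    1 / (2 ^ 22 * |v 0|) ≤ σ * ρ * (branch k σ ρ v).im ∧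
    σ * ρ * (branch k σ ρ v).im ≤ 2 ^ 20 / |v 0| := by
  have h1 := one_le_of_mem_base hk hv.1
  obtain ⟨h2, h3, -⟩ := rootRe_le_of_mem_base hk hv.1
  have hr := rootRe_pos (ne_zero_of_mem_baseHalf hv)
  have h4 : σ * ρ * (branch k σ ρ v).im = |v 0| / (2 * rootRe v) := by
    have h5 : σ * v 0 = |v 0| := by
      have h6 : 0 < σ * v 0 := hv.2
      rcases hσ with rfl | rfl
      · rw [one_mul] at *; exact (abs_of_pos h6).symm
      · rw [abs_of_neg (by linarith)]; ring
    have h7 : ρ * ρ = 1 := by rcases hρ with rfl | rfl <;> norm_num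
    have h8 : ((ρ : ℂ) * root v).im = ρ * (v 0 / (2 * rootRe v)) := by simp [root]
    rw [branch, if_pos hv, h8, ← h5]
    linear_combination (σ * (v 0 / (2 * rootRe v))) * h7
  rw [← sq_abs] at h2 h3
  have h0 : 0 < |v 0| := by linarith
  rw [h4]
  constructor
  · rw [div_le_div_iff₀ (by positivity) (by positivity)]
    nlinarith
  · rw [div_le_div_iff₀ (by positivity) (by positivity)]
    nlinarith

/-- On the half base `|ξ| ≤ 2^{k+1}`, which turns the pointwise lower bound for the imaginary part
into a uniform one. The constants depend on `k` but are used only qualitatively. -/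
theorem resolventData_branch {k : ℤ} (hk : 100 ≤ k) {σ ρ : ℝ} (hσ : σ = 1 ∨ σ = -1)
    (hρ : ρ = 1 ∨ ρ = -1) {F : R2 → ℂ} (hF : Measurable F) {B : ℝ} (hB : ∀ v, ‖F v‖ ≤ B) :
    ResolventData (σ * ρ) (1 / (2 ^ 22 * 2 ^ (k + 1))) (2 ^ 20 * B) (branchCoeff k σ ρ F)
      (branch k σ ρ) where
  sign := by rcases hσ with rfl | rfl <;> rcases hρ with rfl | rfl <;> norm_num
  eps_pos := by positivity
  measurable_b := measurable_branchCoeff k σ ρ hF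
  measurable_N := measurable_branch k σ ρ
  bound := fun v => by
    have hB0 : 0 ≤ B := (norm_nonneg _).trans (hB v)
    by_cases hv : v ∈ baseHalf k σ
    · refine (norm_branchCoeff_le hk (by rcases hρ with rfl | rfl <;> norm_num) F hv).trans ?_
      have h1 := one_le_of_mem_base hk hv.1
      refine (div_le_self (by positivity) h1).trans ?_
      gcongr
      exact hB v
    · rw [branchCoeff, Set.indicator_of_notMem hv, norm_zero]; positivity
  le_im := fun v => by
    by_cases hv : v ∈ baseHalf k σ
    · refine le_trans ?_ (branch_im_bounds hk hσ hρ hv).1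
      have h1 := one_le_of_mem_base hk hv.1
      have h2 := hv.1.1.2
      have h0 : 0 < |v 0| := by linarith
      gcongr
    -- Off the half base the value `iσρ` keeps the sign condition valid, since `(σρ)² = 1`; the
    -- coefficient vanishes there.
    · rw [branch, if_neg hv]
      have h3 : (((σ * ρ : ℝ) : ℂ) * Complex.I).im = σ * ρ := by simp
      rw [h3]
      have h4 : σ * ρ * (σ * ρ) = 1 := by
        rcases hσ with rfl | rfl <;> rcases hρ with rfl | rfl <;> norm_num
      rw [h4, div_le_one (by positivity)]
      have : (1 : ℝ) ≤ 2 ^ (k + 1) := one_le_zpow₀ (by norm_num) (by omega)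
      nlinarith

theorem norm_branch_le {k : ℤ} (hk : 100 ≤ k) {σ ρ : ℝ} (hρ : |ρ| = 1) {v : R2}
    (hv : v ∈ baseHalf k σ) : ‖branch k σ ρ v‖ ≤ 2 ^ 21 * v 0 ^ 2 := by
  rw [branch, if_pos hv, norm_mul, Complex.norm_real, Real.norm_eq_abs, hρ, one_mul]
  exact (rootRe_le_of_mem_base hk hv.1).2.2

theorem norm_sub_ofReal_sq (N : ℂ) (s : ℝ) : ‖N - s‖ ^ 2 = (N.re - s) ^ 2 + N.im ^ 2 := by
  rw [Complex.sq_norm, Complex.normSq_apply]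
  simp; ring

/-- Resolvents with `N` bounded and away from the real axis are square integrable over strips. -/
theorem memLp_resolvent {b N : R2 → ℂ} (hb : Measurable b) (hN : Measurable N) {T : Set R2}
    (hT : MeasurableSet T) (hT' : volume T < ⊤) {B ε D : ℝ} (hε : 0 < ε)
    (hB : ∀ v, ‖b v‖ ≤ B) (h0 : ∀ v, v ∉ T → b v = 0) (hεN : ∀ v ∈ T, ε ≤ |(N v).im|)
    (hD : ∀ v ∈ T, ‖N v‖ ≤ D) : MemLp (resolvent b N) 2 volume := by
  have hm : Measurable (resolvent b N) := by
    have h1 := hb.comp measurable_sp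
    have h2 := hN.comp measurable_sp
    exact h1.mul ((h2.sub (by fun_prop)).inv)
  have hK : 0 ≤ B ^ 2 * (2 + (1 + 2 * D ^ 2) / ε ^ 2) := by positivity
  refine memLp_two_of_strip hm.aestronglyMeasurable hT hT' hK ?_ ?_
  · intro p hp
    rw [resolvent, h0 _ hp, zero_mul]
  · intro p hp
    have h1 := hεN _ hp
    have h2 : |(N (sp p)).re| ≤ D := (Complex.abs_re_le_norm _).trans (hD _ hp)
    have h3 : ε ^ 2 ≤ (N (sp p)).im ^ 2 := by rw [← sq_abs (N (sp p)).im]; gcongr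
    have h4 : (N (sp p)).re ^ 2 ≤ D ^ 2 := by rw [← sq_abs (N (sp p)).re]; gcongr
    rw [resolvent, norm_mul, norm_inv, mul_pow, inv_pow, norm_sub_ofReal_sq, mul_assoc]
    set x := (N (sp p)).re
    set e := (N (sp p)).im
    set s := p 1
    have h5 : ‖b (sp p)‖ ^ 2 ≤ B ^ 2 := by gcongr; exact hB _
    have hpos : 0 < (x - s) ^ 2 + e ^ 2 := by nlinarith [sq_nonneg (x - s), pow_pos hε 2]
    gcongr
    rw [inv_le_iff_one_le_mul₀ hpos, mul_assoc, ← div_eq_inv_mul, ← mul_div_assoc,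
      le_div_iff₀ (by positivity), one_mul]
    have h6 : 1 + s ^ 2 ≤ 2 * (x - s) ^ 2 + (1 + 2 * D ^ 2) := by nlinarith [sq_nonneg (2 * x - s)]
    have h7 : 1 + 2 * D ^ 2 ≤ (1 + 2 * D ^ 2) / ε ^ 2 * ((x - s) ^ 2 + e ^ 2) := by
      rw [div_mul_eq_mul_div, le_div_iff₀ (by positivity)]
      gcongr
      nlinarith [sq_nonneg (x - s)]
    nlinarith [sq_nonneg e]

theorem memLp_resolvent_branch {k : ℤ} (hk : 100 ≤ k) {σ ρ : ℝ} (hσ : σ = 1 ∨ σ = -1)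
    (hρ : ρ = 1 ∨ ρ = -1) {F : R2 → ℂ} (hF : Measurable F) {B : ℝ} (hB : ∀ v, ‖F v‖ ≤ B) :
    MemLp (resolvent (branchCoeff k σ ρ F) (branch k σ ρ)) 2 volume ∧
    MemLp (resolvent (branchCoeff k σ ρ F) fun v => (starRingEnd ℂ) (branch k σ ρ v)) 2 volume := by
  have D := resolventData_branch hk hσ hρ hF hB
  have h0 : ∀ v, v ∉ baseHalf k σ → branchCoeff k σ ρ F v = 0 := fun v hv =>
    Set.indicator_of_notMem hv _
  have hσρ : |σ * ρ| = 1 := by rcases hσ with rfl | rfl <;> rcases hρ with rfl | rfl <;> norm_num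
  have him : ∀ v ∈ baseHalf k σ, 1 / (2 ^ 22 * 2 ^ (k + 1)) ≤ |(branch k σ ρ v).im| := by
    intro v _
    refine (D.le_im v).trans ((le_abs_self _).trans (le_of_eq ?_))
    rw [abs_mul, hσρ, one_mul]
  have hD : ∀ v ∈ baseHalf k σ, ‖branch k σ ρ v‖ ≤ 2 ^ 21 * ((2 : ℝ) ^ (k + 1)) ^ 2 := by
    intro v hv
    refine (norm_branch_le hk (by rcases hρ with rfl | rfl <;> norm_num) hv).trans ?_
    rw [← sq_abs]
    have := hv.1.1.2
    gcongr
  refine ⟨memLp_resolvent D.measurable_b D.measurable_N (measurableSet_baseHalf k σ)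
    (volume_baseHalf_lt_top k σ) D.eps_pos D.bound h0 him hD,
    memLp_resolvent D.measurable_b (Complex.continuous_conj.measurable.comp D.measurable_N)
    (measurableSet_baseHalf k σ) (volume_baseHalf_lt_top k σ) D.eps_pos D.bound h0
    (D := 2 ^ 21 * ((2 : ℝ) ^ (k + 1)) ^ 2) ?_ ?_⟩
  · intro v hv; simpa using him v hv
  · intro v hv; simpa using hD v hv

/-! ### The weighted estimate for the Poisson kernel symbol -/

/-- The profile `(1 + t²)^{-3/4}`. -/
def profile (t : ℝ) : ℝ := (1 + t ^ 2) ^ (-(3 / 4) : ℝ)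

theorem measurable_profile : Measurable profile := by
  unfold profile; fun_prop

theorem lintegral_profile_lt_top : ∫⁻ t : ℝ, ENNReal.ofReal (profile t) < ⊤ := by
  have h := integrable_rpow_neg_one_add_norm_sq (E := ℝ) (μ := volume) (r := 3 / 2)
    (by norm_num)
  have h2 : Integrable profile := by
    refine h.congr (Filter.Eventually.of_forall fun t => ?_)
    simp only [profile, Real.norm_eq_abs, sq_abs]
    norm_num
  exact h2.lintegral_lt_top

/-- With `R = (Aξ)²`, the squared weight is at most a multiple of `R^{5/4}` and the squared Poisson
symbol at most a multiple of `R^{-2}`. The product `R^{-3/4}` is controlled by the profile, whose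
decay `|t|^{-3/2}` is integrable. -/
theorem poisson_algebra {K c A e ξ x s Sy Bn F κ : ℝ} (hA : 0 < A) (hξ : 0 < ξ) (hK : 0 ≤ K) (hc : 0 < c)
    (hSy : 0 ≤ Sy) (hSy' : Sy ≤ K * (A * ξ) ^ 2) (he : |e| ≤ κ / ξ) (hBn : 0 ≤ Bn)
    (hBn' : Bn ≤ κ * F / ξ) (hlow : c * (1 + (ξ * (s - x)) ^ 2) ≤ (A * ξ) ^ 2) :
    (Sy ^ (5 / 8 : ℝ) * (Bn * (2 * |e| / A ^ 2))) ^ 2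
      ≤ 4 * K ^ (5 / 4 : ℝ) * κ ^ 4 * c ^ (-(3 / 4) : ℝ) * F ^ 2 * profile (ξ * (s - x)) := by
  set R := (A * ξ) ^ 2 with hR
  have hRpos : 0 < R := by positivity
  have h1 : (Sy ^ (5 / 8 : ℝ)) ^ 2 ≤ K ^ (5 / 4 : ℝ) * R ^ (5 / 4 : ℝ) := by
    rw [← Real.mul_rpow hK hRpos.le, ← Real.rpow_natCast, ← Real.rpow_mul hSy]
    norm_num
    gcongr
  have h2 : (Bn * (2 * |e| / A ^ 2)) ^ 2 ≤ 4 * κ ^ 4 * F ^ 2 / R ^ 2 := by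
    have h3 : Bn * (2 * |e| / A ^ 2) ≤ κ * F / ξ * (2 * (κ / ξ) / A ^ 2) := by
      have := hBn.trans hBn'
      gcongr
    calc _ ≤ (κ * F / ξ * (2 * (κ / ξ) / A ^ 2)) ^ 2 := by gcongr
      _ = _ := by rw [hR]; field_simp; norm_num
  have h4 : R ^ (5 / 4 : ℝ) / R ^ 2 ≤ c ^ (-(3 / 4) : ℝ) * profile (ξ * (s - x)) := by
    rw [profile, ← Real.mul_rpow hc.le (by positivity), ← Real.rpow_natCast R 2, ← Real.rpow_sub hRpos]
    norm_num
    exact Real.rpow_le_rpow_of_nonpos (by positivity) hlow (by norm_num)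
  rw [mul_pow]
  calc _ ≤ K ^ (5 / 4 : ℝ) * R ^ (5 / 4 : ℝ) * (4 * κ ^ 4 * F ^ 2 / R ^ 2) := by gcongr
    _ = 4 * K ^ (5 / 4 : ℝ) * κ ^ 4 * F ^ 2 * (R ^ (5 / 4 : ℝ) / R ^ 2) := by ring
    _ ≤ 4 * K ^ (5 / 4 : ℝ) * κ ^ 4 * F ^ 2 * (c ^ (-(3 / 4) : ℝ) * profile (ξ * (s - x))) := by
        gcongr
    _ = _ := by ring

/-- The Poisson kernel symbol of a branch. -/
def poissonSymb (k : ℤ) (σ ρ : ℝ) (F : R2 → ℂ) : R3 → ℂ :=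
  resolvent (branchCoeff k σ ρ F) (branch k σ ρ)
    - resolvent (branchCoeff k σ ρ F) fun v => (starRingEnd ℂ) (branch k σ ρ v)

/-- The difference of `(N - μ)⁻¹` and the same expression with the conjugate of `N` is, in modulus,
`2 |Im N| / |N - μ|²`. One power of decay in `μ` has been gained. -/
theorem norm_poissonSymb (k : ℤ) (σ ρ : ℝ) (F : R2 → ℂ) (p : R3)
    (hp : branch k σ ρ (sp p) - p 1 ≠ 0) :
    ‖poissonSymb k σ ρ F p‖ = ‖branchCoeff k σ ρ F (sp p)‖ *
      (2 * |(branch k σ ρ (sp p)).im| / ‖branch k σ ρ (sp p) - p 1‖ ^ 2) := by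
  set N := branch k σ ρ (sp p)
  have h2 : (starRingEnd ℂ) N - p 1 = (starRingEnd ℂ) (N - p 1) := by simp
  have h1 : (starRingEnd ℂ) (N - p 1) ≠ 0 := (map_ne_zero _).2 hp
  have h3 : (starRingEnd ℂ) (N - p 1) - (N - p 1) = ((-2 * N.im : ℝ) : ℂ) * Complex.I := by
    apply Complex.ext <;> simp; ring
  simp only [poissonSymb, Pi.sub_apply, resolvent]
  rw [← mul_sub, norm_mul, h2, inv_sub_inv hp h1, norm_div, norm_mul, RCLike.norm_conj, h3, norm_mul,
    Complex.norm_I, Complex.norm_real, Real.norm_eq_abs, abs_mul, ← sq]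
  norm_num

/-- With `A = |N - μ|`, factor the symbol and use `|N + μ| ≤ A + 2|N|`. The linear term is absorbed
because the imaginary part of `N` keeps `A|ξ|` bounded below. -/
theorem norm_symb_le_branch {k : ℤ} (hk : 100 ≤ k) {σ ρ : ℝ} (hσ : σ = 1 ∨ σ = -1)
    (hρ : ρ = 1 ∨ ρ = -1) {p : R3} (hp : sp p ∈ baseHalf k σ) :
    ‖symb p‖ ≤ 2 ^ 46 * (‖branch k σ ρ (sp p) - p 1‖ * |p 0|) ^ 2 := by
  have h1 : 1 ≤ |p 0| := one_le_of_mem_base hk hp.1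
  have hne : p 0 ≠ 0 := ne_zero_of_mem_baseHalf hp
  have h2 := (rootRe_le_of_mem_base hk hp.1).2.2
  have him := (branch_im_bounds hk hσ hρ hp).1
  set N := branch k σ ρ (sp p) with hN
  set A := ‖N - p 1‖
  have hσρ : |σ * ρ| = 1 := by rcases hσ with rfl | rfl <;> rcases hρ with rfl | rfl <;> norm_num
  have h3 : 1 / (2 ^ 22 * |p 0|) ≤ A := by
    refine him.trans ((le_abs_self _).trans ?_)
    rw [abs_mul, hσρ, one_mul]
    refine le_trans (le_of_eq ?_) (Complex.abs_im_le_norm _)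
    simp
  have h0 : 0 < |p 0| := by linarith
  have h4 : 1 ≤ 2 ^ 22 * (A * |p 0|) := by
    rw [div_le_iff₀ (by positivity)] at h3; linarith
  have hsq : symb p = (N - p 1) * (N + p 1) / p 0 := by
    have h5 : N = ρ * root (sp p) := by rw [hN, branch, if_pos hp]
    have h6 : (ρ : ℂ) ^ 2 = 1 := by rcases hρ with rfl | rfl <;> norm_num
    rw [symb_eq_root hne, h5]
    congr 1
    linear_combination (-root (sp p) ^ 2) * h6
  have h7 : ‖N + p 1‖ ≤ A + 2 * (2 ^ 21 * |p 0| ^ 2) := by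
    have h8 : ‖N‖ ≤ 2 ^ 21 * |p 0| ^ 2 := by
      have := norm_branch_le hk (by rcases hρ with rfl | rfl <;> norm_num) hp (ρ := ρ)
      rwa [← sq_abs] at this
    have h9 : N + p 1 = -(N - p 1) + 2 * N := by ring
    calc ‖N + p 1‖ = ‖-(N - p 1) + 2 * N‖ := by rw [← h9]
      _ ≤ ‖-(N - p 1)‖ + ‖2 * N‖ := norm_add_le _ _
      _ ≤ _ := by
        rw [norm_neg, norm_mul, Complex.norm_ofNat]
        gcongr
  have hA : 0 ≤ A := norm_nonneg _
  rw [hsq, norm_div, norm_mul, Complex.norm_real, Real.norm_eq_abs, div_le_iff₀ h0]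
  calc A * ‖N + p 1‖ ≤ A * (A + 2 * (2 ^ 21 * |p 0| ^ 2)) := by gcongr
    _ = A ^ 2 * 1 + 2 ^ 22 * (A * |p 0|) * |p 0| * 1 := by ring
    _ ≤ A ^ 2 * |p 0| ^ 3 + 2 ^ 22 * (A * |p 0|) * |p 0| * (2 ^ 22 * (A * |p 0|)) := by
        gcongr
        exact one_le_pow₀ h1
    _ = (1 + 2 ^ 44) * (A ^ 2 * |p 0| ^ 3) := by ring
    _ ≤ 2 ^ 46 * (A ^ 2 * |p 0| ^ 3) := by gcongr; norm_num
    _ = _ := by ring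

/-- The last hypothesis of `poisson_algebra` holds because `|N - μ|² ξ²` is the sum of `(ξ(μ - Re
N))²` and `(ξ Im N)²`, and the latter is at least `2^{-44}`. -/
theorem weight_poissonSymb_sq_le {k : ℤ} (hk : 100 ≤ k) {σ ρ : ℝ} (hσ : σ = 1 ∨ σ = -1)
    (hρ : ρ = 1 ∨ ρ = -1) (F : R2 → ℂ) {p : R3} (hp : sp p ∈ baseHalf k σ) :
    (‖symb p‖ ^ (5 / 8 : ℝ) * ‖poissonSymb k σ ρ F p‖) ^ 2
      ≤ 4 * (2 ^ 46) ^ (5 / 4 : ℝ) * (2 ^ 20) ^ 4 * (1 / 2 ^ 44) ^ (-(3 / 4) : ℝ) * ‖F (sp p)‖ ^ 2 *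
        profile (|p 0| * (p 1 - (branch k σ ρ (sp p)).re)) := by
  have h1 : 1 ≤ |p 0| := one_le_of_mem_base hk hp.1
  have h0 : 0 < |p 0| := by linarith
  obtain ⟨him, him'⟩ := branch_im_bounds hk hσ hρ hp
  have hσρ : |σ * ρ| = 1 := by rcases hσ with rfl | rfl <;> rcases hρ with rfl | rfl <;> norm_num
  have h2 : σ * ρ * (branch k σ ρ (sp p)).im = |(branch k σ ρ (sp p)).im| := by
    rw [← abs_of_nonneg (a := σ * ρ * _) (le_trans (by positivity) him), abs_mul, hσρ, one_mul]
  rw [h2, sp_zero] at him him'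
  have hsq := norm_sub_ofReal_sq (branch k σ ρ (sp p)) (p 1)
  have himpos : 0 < |(branch k σ ρ (sp p)).im| := lt_of_lt_of_le (by positivity) him
  have hApos : 0 < ‖branch k σ ρ (sp p) - p 1‖ := by
    have : 0 < ‖branch k σ ρ (sp p) - p 1‖ ^ 2 := by
      rw [hsq, ← sq_abs (branch k σ ρ (sp p)).im]; positivity
    exact lt_of_le_of_ne (norm_nonneg _) fun h => by rw [← h] at this; norm_num at this
  rw [norm_poissonSymb _ _ _ _ _ (norm_pos_iff.1 hApos)]
  refine poisson_algebra hApos h0 (by positivity) (by positivity) (norm_nonneg _)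
    (norm_symb_le_branch hk hσ hρ hp) him' (norm_nonneg _)
    (norm_branchCoeff_le hk (by rcases hρ with rfl | rfl <;> norm_num) F hp) ?_
  rw [mul_pow ‖_‖, hsq, mul_pow, add_mul, mul_add, ← sq_abs (branch k σ ρ (sp p)).im]
  have h3 : 1 / 2 ^ 44 ≤ |(branch k σ ρ (sp p)).im| ^ 2 * |p 0| ^ 2 := by
    rw [← mul_pow]
    have : 1 / 2 ^ 22 ≤ |(branch k σ ρ (sp p)).im| * |p 0| := by
      rw [div_le_iff₀ (by positivity)] at him ⊢
      linarith
    calc (1 : ℝ) / 2 ^ 44 = (1 / 2 ^ 22) ^ 2 := by norm_num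
      _ ≤ _ := by gcongr
  nlinarith [mul_nonneg (sq_nonneg |p 0|) (sq_nonneg (p 1 - (branch k σ ρ (sp p)).re))]

end KPI
end

/-! ### The `L⁴` bound for symbols `F(ξ,τ)/(τ - ω + i)`. -/

noncomputable section

namespace KPI

open MeasureTheory

theorem enorm_rpow_two (z : ℂ) : ‖z‖ₑ ^ (2 : ℝ) = ENNReal.ofReal (‖z‖ ^ 2) := by
  rw [ENNReal.ofReal_pow (norm_nonneg _), ofReal_norm, ← ENNReal.rpow_natCast]; norm_num

theorem measurable_resolvent {b N : R2 → ℂ} (hb : Measurable b) (hN : Measurable N) :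
    Measurable (resolvent b N) :=
  (hb.comp measurable_sp).mul (((hN.comp measurable_sp).sub (by fun_prop)).inv)

theorem measurable_poissonSymb (k : ℤ) (σ ρ : ℝ) {F : R2 → ℂ} (hF : Measurable F) :
    Measurable (poissonSymb k σ ρ F) :=
  (measurable_resolvent (measurable_branchCoeff k σ ρ hF) (measurable_branch k σ ρ)).sub
    (measurable_resolvent (measurable_branchCoeff k σ ρ hF)
      (Complex.continuous_conj.measurable.comp (measurable_branch k σ ρ)))

theorem poissonSymb_eq_zero {k : ℤ} {σ ρ : ℝ} {F : R2 → ℂ} {p : R3} (hp : sp p ∉ baseHalf k σ) :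
    poissonSymb k σ ρ F p = 0 := by
  simp [poissonSymb, resolvent, branchCoeff, Set.indicator_of_notMem hp]

theorem ofReal_zpow_two (k : ℤ) : ENNReal.ofReal ((2 : ℝ) ^ k) = (2 : ℝ≥0∞) ^ (k : ℝ) := by
  rw [← Real.rpow_intCast, ← ENNReal.ofReal_rpow_of_pos (by norm_num)]; norm_num

theorem le_of_rpow_two_le {a b c : ℝ≥0∞} {r : ℝ} (h : a ^ (2 : ℝ) ≤ c * 2 ^ r * b ^ (2 : ℝ)) :
    a ≤ c ^ (1 / 2 : ℝ) * 2 ^ (r / 2) * b := by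
  have := ENNReal.rpow_le_rpow h (show (0 : ℝ) ≤ 1 / 2 by norm_num)
  rw [ENNReal.mul_rpow_of_nonneg _ _ (by norm_num), ENNReal.mul_rpow_of_nonneg _ _ (by norm_num),
    ← ENNReal.rpow_mul, ← ENNReal.rpow_mul, ← ENNReal.rpow_mul] at this
  norm_num at this
  rwa [div_eq_mul_one_div r]

/-- For fixed `(ξ, τ)` the square is `|F|²` times a profile of width `1/|ξ|` in `μ`. Integrating in
`μ` produces `2^{-k}`, whose square root is the smoothing gain. -/
theorem exists_eLpNorm_weight_poissonSymb_le : ∃ C : ℝ≥0, ∀ (k : ℤ) (σ ρ : ℝ) (F : R2 → ℂ),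
    100 ≤ k → (σ = 1 ∨ σ = -1) → (ρ = 1 ∨ ρ = -1) → Measurable F →
    eLpNorm (fun p => ((‖symb p‖ ^ (5 / 8 : ℝ) : ℝ) : ℂ) * poissonSymb k σ ρ F p) 2 volume
      ≤ C * 2 ^ (-(k : ℝ) / 2) * eLpNorm F 2 volume := by
  set K : ℝ := 4 * (2 ^ 46) ^ (5 / 4 : ℝ) * (2 ^ 20) ^ 4 * (1 / 2 ^ 44) ^ (-(3 / 4) : ℝ) with hK
  have hK0 : 0 ≤ K := by positivity
  set P := ∫⁻ t : ℝ, ENNReal.ofReal (profile t) with hP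
  have hfin : ENNReal.ofReal K * P * 2 ≠ ⊤ :=
    ENNReal.mul_ne_top (ENNReal.mul_ne_top ENNReal.ofReal_ne_top lintegral_profile_lt_top.ne)
      (by norm_num)
  refine ⟨((ENNReal.ofReal K * P * 2) ^ (1 / 2 : ℝ)).toNNReal, fun k σ ρ F hk hσ hρ hF => ?_⟩
  rw [ENNReal.coe_toNNReal (ENNReal.rpow_ne_top_of_nonneg (by norm_num) hfin)]
  apply le_of_rpow_two_le
  have hm : Measurable fun p : R3 => ((‖symb p‖ ^ (5 / 8 : ℝ) : ℝ) : ℂ) * poissonSymb k σ ρ F p := by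
    have h1 := measurable_symb
    have h2 := measurable_poissonSymb k σ ρ hF
    fun_prop
  rw [← eLpNorm_two_rpow, ← eLpNorm_two_rpow, lintegral_split (hm.enorm.pow_const _).aemeasurable,
    ← lintegral_const_mul _ (by fun_prop)]
  refine lintegral_mono fun v => ?_
  by_cases hv : v ∈ baseHalf k σ
  · have hv0 : 0 < |v 0| := by have := one_le_of_mem_base hk hv.1; linarith
    have h1 : ∀ s : ℝ, ‖((‖symb (join v s)‖ ^ (5 / 8 : ℝ) : ℝ) : ℂ) * poissonSymb k σ ρ F (join v s)‖ₑ
        ^ (2 : ℝ) ≤ (ENNReal.ofReal K * ‖F v‖ₑ ^ (2 : ℝ)) *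
          ENNReal.ofReal (profile (|v 0| * (s - (branch k σ ρ v).re))) := by
      intro s
      have h2 := weight_poissonSymb_sq_le hk hσ hρ F (p := join v s) (by simpa using hv)
      rw [← hK] at h2
      simp only [sp_join, join_zero, join_one] at h2
      rw [enorm_rpow_two, enorm_rpow_two, ← ENNReal.ofReal_mul hK0, ← ENNReal.ofReal_mul (by positivity)]
      refine ENNReal.ofReal_le_ofReal ?_
      rwa [norm_mul, Complex.norm_real, Real.norm_of_nonneg (by positivity)]
    refine (lintegral_mono h1).trans ?_
    have hpm := measurable_profile
    rw [lintegral_const_mul _ (by fun_prop), lintegral_comp_affine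
      (fun t => ENNReal.ofReal (profile t)) (by fun_prop) hv0]
    have h3 : ENNReal.ofReal |v 0|⁻¹ ≤ 2 * 2 ^ (-(k : ℝ)) := by
      have h4 : |v 0|⁻¹ ≤ 2 ^ (1 - k) := by
        rw [show (1 - k) = -(k - 1) by ring, zpow_neg]
        have h5 : (2 : ℝ) ^ (k - 1) ≤ |v 0| := hv.1.1.1
        gcongr
      refine (ENNReal.ofReal_le_ofReal h4).trans (le_of_eq ?_)
      rw [ofReal_zpow_two]
      push_cast
      rw [sub_eq_add_neg, ENNReal.rpow_add _ _ (by norm_num) (by norm_num), ENNReal.rpow_one]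
    calc _ = ENNReal.ofReal K * P * ‖F v‖ₑ ^ (2 : ℝ) * ENNReal.ofReal |v 0|⁻¹ := by rw [hP]; ring
      _ ≤ ENNReal.ofReal K * P * ‖F v‖ₑ ^ (2 : ℝ) * (2 * 2 ^ (-(k : ℝ))) := by gcongr
      _ = _ := by ring
  · have h1 : ∀ s : ℝ, ‖((‖symb (join v s)‖ ^ (5 / 8 : ℝ) : ℝ) : ℂ) * poissonSymb k σ ρ F (join v s)‖ₑ
        ^ (2 : ℝ) = 0 := by
      intro s
      rw [poissonSymb_eq_zero (by simpa using hv)]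
      simp
    simp only [h1, lintegral_zero, zero_le]

variable {μ₀ : ℝ → ℝ}

/-- The resolvent itself decays too slowly in `μ` for the weighted estimate at exponent `5/8`.
Half-space domination replaces it by the Poisson symbol, to which that estimate applies. -/
theorem exists_eLpNorm_ift_branch_le (h : IsBasicCutoff μ₀) : ∃ C : ℝ≥0, ∀ (k : ℤ) (σ ρ : ℝ) (F : R2 → ℂ)
    (B : ℝ), 100 ≤ k → (σ = 1 ∨ σ = -1) → (ρ = 1 ∨ ρ = -1) → Measurable F → (∀ v, ‖F v‖ ≤ B) →
    eLpNorm (ift (resolvent (branchCoeff k σ ρ F) (branch k σ ρ))) 4 volume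
      ≤ C * 2 ^ (-(k : ℝ) / 2) * eLpNorm F 2 volume := by
  obtain ⟨C₁, h1⟩ := exists_eLpNorm_ift_four_le_weight h
  obtain ⟨C₂, h2⟩ := exists_eLpNorm_weight_poissonSymb_le
  refine ⟨C₁ * C₂, fun k σ ρ F B hk hσ hρ hF hB => ?_⟩
  obtain ⟨h3, h4⟩ := memLp_resolvent_branch hk hσ hρ hF hB
  refine (eLpNorm_ift_resolvent_le (resolventData_branch hk hσ hρ hF hB) h3 h4).trans ?_
  refine (h1 _ (h3.sub h4)).trans ?_
  push_cast
  rw [mul_assoc (C₁ : ℝ≥0∞), mul_assoc (C₁ : ℝ≥0∞)]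
  gcongr
  exact h2 k σ ρ F hk hσ hρ hF

/-- The symbol `F(ξ,τ) / (τ - ω + i)` restricted to `base k`. -/
def atom (k : ℤ) (F : R2 → ℂ) (p : R3) : ℂ :=
  (sp ⁻¹' base k).indicator (fun p => F (sp p) * (symb p)⁻¹) p

theorem resolvent_branch_of_mem {k : ℤ} {σ ρ : ℝ} {F : R2 → ℂ} {p : R3} (hp : sp p ∈ baseHalf k σ) :
    resolvent (branchCoeff k σ ρ F) (branch k σ ρ) p
      = F (sp p) * (p 0 / (2 * (ρ * root (sp p)))) * (ρ * root (sp p) - p 1)⁻¹ := by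
  rw [resolvent, branchCoeff, Set.indicator_of_mem hp, branch, if_pos hp]; rfl

theorem resolvent_branch_of_notMem {k : ℤ} {σ ρ : ℝ} {F : R2 → ℂ} {p : R3}
    (hp : sp p ∉ baseHalf k σ) : resolvent (branchCoeff k σ ρ F) (branch k σ ρ) p = 0 := by
  rw [resolvent, branchCoeff, Set.indicator_of_notMem hp, zero_mul]

/-- At each point of the base only the two terms matching the sign of `ξ` survive, and these are the
partial fractions. -/
theorem atom_eq {k : ℤ} (hk : 100 ≤ k) (F : R2 → ℂ) : atom k F =
    (resolvent (branchCoeff k 1 1 F) (branch k 1 1) + resolvent (branchCoeff k 1 (-1) F) (branch k 1 (-1)))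
    + (resolvent (branchCoeff k (-1) 1 F) (branch k (-1) 1)
      + resolvent (branchCoeff k (-1) (-1) F) (branch k (-1) (-1))) := by
  funext p
  simp only [Pi.add_apply, atom]
  by_cases hp : sp p ∈ base k
  · have h0 : p 0 ≠ 0 := by
      have h1 : 1 ≤ |p 0| := one_le_of_mem_base hk hp
      intro h; rw [h] at h1; norm_num at h1
    rw [Set.indicator_of_mem (by exact hp), inv_symb_eq h0]
    rcases lt_or_gt_of_ne h0 with hneg | hpos
    · have h1 : sp p ∉ baseHalf k 1 := fun hh => by
        have : 0 < 1 * p 0 := hh.2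
        linarith
      have h2 : sp p ∈ baseHalf k (-1) := ⟨hp, show 0 < -1 * p 0 by linarith⟩
      rw [resolvent_branch_of_notMem h1, resolvent_branch_of_notMem h1, resolvent_branch_of_mem h2,
        resolvent_branch_of_mem h2]
      push_cast; ring
    · have h1 : sp p ∉ baseHalf k (-1) := fun hh => by
        have : 0 < -1 * p 0 := hh.2
        linarith
      have h2 : sp p ∈ baseHalf k 1 := ⟨hp, show 0 < 1 * p 0 by linarith⟩
      rw [resolvent_branch_of_notMem h1, resolvent_branch_of_notMem h1, resolvent_branch_of_mem h2,
        resolvent_branch_of_mem h2]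
      push_cast; ring
  · rw [Set.indicator_of_notMem (by exact hp)]
    have h1 : ∀ σ : ℝ, sp p ∉ baseHalf k σ := fun σ hh => hp hh.1
    simp [resolvent_branch_of_notMem (h1 _)]

theorem memLp_atom {k : ℤ} (hk : 100 ≤ k) {F : R2 → ℂ} (hF : Measurable F) {B : ℝ}
    (hB : ∀ v, ‖F v‖ ≤ B) : MemLp (atom k F) 2 volume := by
  rw [atom_eq hk]
  have h := fun (σ ρ : ℝ) hσ hρ => (memLp_resolvent_branch (σ := σ) (ρ := ρ) hk hσ hρ hF hB).1
  exact ((h 1 1 (.inl rfl) (.inl rfl)).add (h 1 (-1) (.inl rfl) (.inr rfl))).add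
    ((h (-1) 1 (.inr rfl) (.inl rfl)).add (h (-1) (-1) (.inr rfl) (.inr rfl)))

theorem exists_eLpNorm_ift_atom_le (h : IsBasicCutoff μ₀) : ∃ C : ℝ≥0, ∀ (k : ℤ) (F : R2 → ℂ)
    (B : ℝ), 100 ≤ k → Measurable F → (∀ v, ‖F v‖ ≤ B) →
    eLpNorm (ift (atom k F)) 4 volume ≤ C * 2 ^ (-(k : ℝ) / 2) * eLpNorm F 2 volume := by
  obtain ⟨C, hC⟩ := exists_eLpNorm_ift_branch_le h
  refine ⟨4 * C, fun k F B hk hF hB => ?_⟩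
  have h1 := fun (σ ρ : ℝ) hσ hρ => (memLp_resolvent_branch (σ := σ) (ρ := ρ) hk hσ hρ hF hB).1
  have h2 := fun (σ ρ : ℝ) hσ hρ => hC k σ ρ F B hk hσ hρ hF hB
  have a1 := h1 1 1 (.inl rfl) (.inl rfl)
  have a2 := h1 1 (-1) (.inl rfl) (.inr rfl)
  have a3 := h1 (-1) 1 (.inr rfl) (.inl rfl)
  have a4 := h1 (-1) (-1) (.inr rfl) (.inr rfl)
  rw [atom_eq hk]
  refine (eLpNorm_ift_four_add_le (a1.add a2) (a3.add a4)).trans ?_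
  refine (add_le_add (eLpNorm_ift_four_add_le a1 a2) (eLpNorm_ift_four_add_le a3 a4)).trans ?_
  refine (add_le_add (add_le_add (h2 1 1 (.inl rfl) (.inl rfl)) (h2 1 (-1) (.inl rfl) (.inr rfl)))
    (add_le_add (h2 (-1) 1 (.inr rfl) (.inl rfl)) (h2 (-1) (-1) (.inr rfl) (.inr rfl)))).trans
    (le_of_eq ?_)
  push_cast
  ring

end KPI
end

noncomputable section

namespace KPI

open MeasureTheory

/-! ### The mixed norm -/

theorem lintegral_R2 {F : R2 → ℝ≥0∞} (hF : Measurable F) :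
    ∫⁻ v, F v = ∫⁻ a : ℝ, ∫⁻ c : ℝ, F !₂[a, c] := by
  have h1 := EuclideanSpace.volume_preserving_symm_measurableEquiv_toLp (Fin 2)
  have h2 := volume_preserving_finTwoArrow ℝ
  have h3 := (h2.comp h1).symm ((MeasurableEquiv.toLp 2 (Fin 2 → ℝ)).symm.trans
    MeasurableEquiv.finTwoArrow)
  rw [← h3.lintegral_comp hF, Measure.volume_eq_prod]
  exact lintegral_prod _ (hF.comp h3.measurable).aemeasurable

/-- The norm of `L¹_y L²_{x,t}` with the two outer variables collected in a vector. -/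
def mixedNorm (u : R3 → ℂ) : ℝ≥0∞ :=
  ∫⁻ y : ℝ, (∫⁻ v : R2, ‖u (join v y)‖ₑ ^ (2 : ℝ)) ^ (1 / 2 : ℝ)

theorem measurable_ift {g : R3 → ℂ} (hg : MemLp g 2 volume) : Measurable (ift g) := by
  rw [ift_eq hg]; exact (Lp.stronglyMeasurable _).measurable

theorem measurable_join_lintegral {F : R3 → ℝ≥0∞} (hF : Measurable F) :
    Measurable fun y : ℝ => ∫⁻ v : R2, F (join v y) :=
  Measurable.lintegral_prod_left' (f := fun q : R2 × ℝ => F (join q.1 q.2))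
    (hF.comp measurePreserving_join.measurable)

theorem measurable_toLp_two : Measurable fun q : ℝ × ℝ => (!₂[q.1, q.2] : R2) := by
  refine (PiLp.continuous_toLp 2 _).measurable.comp (measurable_pi_lambda _ fun i => ?_)
  fin_cases i <;> simp <;> fun_prop

theorem lintegral_dilate {F : R2 → ℝ≥0∞} (hF : Measurable F) {c : ℝ} (hc : 0 < c) :
    ∫⁻ x : ℝ, ∫⁻ t : ℝ, F !₂[c * x, c * t] = ENNReal.ofReal c⁻¹ ^ 2 * ∫⁻ v, F v := by
  have hm : Measurable fun q : ℝ × ℝ => F !₂[q.1, q.2] := hF.comp measurable_toLp_two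
  have h1 : ∀ a : ℝ, ∫⁻ t : ℝ, F !₂[a, c * t] = ENNReal.ofReal c⁻¹ * ∫⁻ t : ℝ, F !₂[a, t] := by
    intro a
    have := lintegral_comp_affine (fun t => F !₂[a, t]) (hm.comp (measurable_const.prodMk measurable_id)) hc 0
    simpa using this
  have h2 : Measurable fun a : ℝ => ∫⁻ t : ℝ, F !₂[a, t] := hm.lintegral_prod_right'
  have h3 := lintegral_comp_affine (fun a => ∫⁻ t : ℝ, F !₂[a, t]) h2 hc 0
  simp only [sub_zero] at h3
  simp only [h1]
  have h4 : Measurable fun a : ℝ => ∫⁻ t : ℝ, F !₂[c * a, t] :=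
    h2.comp (measurable_const_mul c)
  rw [lintegral_const_mul _ h4, h3, lintegral_R2 hF, sq, mul_assoc]

/-- The normalization contributes `(2π)⁻³`. Dilating by `2π` contributes `2π` through the square
root of the `(x,t)` Jacobian and another `2π` from `y`, so one factor remains. -/
theorem mixedNorm_ift {g : R3 → ℂ} (hg : MemLp g 2 volume) :
    mixedNorm (ift g) = ENNReal.ofReal (2 * Real.pi) * L1yL2xt (invFourier g hg) := by
  set c : ℝ := (2 * Real.pi)⁻¹ with hc
  have hc0 : 0 < c := by have := Real.pi_pos; positivity
  have hci : c⁻¹ = 2 * Real.pi := inv_inv _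
  set A := ENNReal.ofReal c⁻¹ with hA
  have hA0 : A ≠ 0 := by rw [hA]; simpa using hc0
  have hAt : A ≠ ⊤ := ENNReal.ofReal_ne_top
  have hmu := measurable_ift hg
  set F : R3 → ℝ≥0∞ := fun p => ‖ift g p‖ₑ ^ (2 : ℝ) with hF
  have hFm : Measurable F := hmu.enorm.pow_const _
  have h1 : ∀ x y t : ℝ, ‖invFourier g hg !₂[x, y, t]‖ₑ ^ (2 : ℝ)
      = (A⁻¹ ^ 3) ^ (2 : ℝ) * F (join !₂[c * x, c * t] (c * y)) := by
    intro x y t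
    have h2 : (2 * Real.pi)⁻¹ • (!₂[x, y, t] : R3) = join !₂[c * x, c * t] (c * y) := by
      ext i; fin_cases i <;> simp [join, hc]
    have h3 : ‖(((2 * Real.pi) ^ 3)⁻¹ : ℝ)‖ₑ = A⁻¹ ^ 3 := by
      rw [Real.enorm_of_nonneg (by positivity), ← inv_pow, ← hc, ENNReal.ofReal_pow hc0.le, hA,
        ENNReal.ofReal_inv_of_pos hc0, inv_inv]
    rw [invFourier, ← ift_eq hg, h2, enorm_smul, ENNReal.mul_rpow_of_nonneg _ _ (by norm_num), h3]
  have h4 : ∀ y : ℝ, Measurable fun v : R2 => F (join v y) := fun y =>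
    hFm.comp (measurable_join_left y)
  have h5 : ∀ y : ℝ, (∫⁻ x : ℝ, ∫⁻ t : ℝ, ‖invFourier g hg !₂[x, y, t]‖ₑ ^ (2 : ℝ)) ^ (1 / 2 : ℝ)
      = A⁻¹ ^ 2 * (fun y => (∫⁻ v : R2, F (join v y)) ^ (1 / 2 : ℝ)) (c * (y - 0)) := by
    intro y
    simp only [h1]
    rw [lintegral_dilate (F := fun v => (A⁻¹ ^ 3) ^ (2 : ℝ) * F (join v (c * y)))
      ((h4 (c * y)).const_mul _) hc0, lintegral_const_mul _ (h4 (c * y)), ← hA, ← mul_assoc,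
      ENNReal.mul_rpow_of_nonneg _ _ (by norm_num), ENNReal.mul_rpow_of_nonneg _ _ (by norm_num),
      ← ENNReal.rpow_mul, ← ENNReal.rpow_natCast A, ← ENNReal.rpow_mul]
    norm_num
    congr 1
    rw [pow_succ' A⁻¹ 2, ← mul_assoc, ENNReal.mul_inv_cancel hA0 hAt, one_mul]
  have h7 := measurable_join_lintegral hFm
  have h8 : Measurable fun y : ℝ => (∫⁻ v : R2, F (join v y)) ^ (1 / 2 : ℝ) := h7.pow_const _
  have h9 : Measurable fun y : ℝ => (fun y => (∫⁻ v : R2, F (join v y)) ^ (1 / 2 : ℝ)) (c * (y - 0)) :=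
    h8.comp (by fun_prop : Measurable fun y : ℝ => c * (y - 0))
  rw [L1yL2xt, lintegral_congr h5, lintegral_const_mul _ h9, lintegral_comp_affine _ h8 hc0, ← hA,
    ← hci, ← hA, ← mul_assoc, ← mul_assoc, show A * A⁻¹ ^ 2 * A = (A * A⁻¹) * (A * A⁻¹) by ring,
    ENNReal.mul_inv_cancel hA0 hAt, mul_one, one_mul]
  rfl

end KPI
end

noncomputable section

namespace KPI

open MeasureTheory

/-! ### The local smoothing estimate -/

/-- From `μ² = rad - ξ(τ - ω)` with `rad` bounded on the base. Dividing by the symbol therefore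
gives integrable decay in `μ`; the constant may depend on `k` since it serves only for
integrability. -/
theorem one_add_sq_le_norm_symb {k : ℤ} (hk : 100 ≤ k) {p : R3} (hp : sp p ∈ base k) :
    1 + p 1 ^ 2 ≤ (1 + 2 ^ 41 * ((2 : ℝ) ^ (k + 1)) ^ 4 + 2 ^ (k + 1)) * ‖symb p‖ := by
  have h1 : 1 ≤ |p 0| := one_le_of_mem_base hk hp
  have hne : p 0 ≠ 0 := by intro h; rw [h] at h1; norm_num at h1
  have h2 : |p 0| ≤ 2 ^ (k + 1) := hp.1.2
  have h3 : rad (sp p) ≤ 2 ^ 41 * p 0 ^ 4 := hp.2.2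
  have h4 : rad (sp p) = p 0 * modulation p + p 1 ^ 2 := by
    simp only [rad, modulation, omega, sp_zero, sp_one]
    field_simp
    ring
  have h5 := one_le_norm_symb p
  have h6 := abs_modulation_le_norm_symb p
  have h7 : -(p 0 * modulation p) ≤ 2 ^ (k + 1) * ‖symb p‖ := by
    refine (neg_le_abs _).trans ?_
    rw [abs_mul]; gcongr
  have h8 : p 0 ^ 4 ≤ ((2 : ℝ) ^ (k + 1)) ^ 4 := by
    rw [← abs_of_nonneg (show 0 ≤ p 0 ^ 4 by positivity), abs_pow]; gcongr
  have h9 : 2 ^ 41 * p 0 ^ 4 ≤ 2 ^ 41 * ((2 : ℝ) ^ (k + 1)) ^ 4 * ‖symb p‖ := by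
    calc 2 ^ 41 * p 0 ^ 4 ≤ 2 ^ 41 * ((2 : ℝ) ^ (k + 1)) ^ 4 * 1 := by linarith
      _ ≤ _ := by gcongr
  nlinarith

/-- The symbol `w / (τ - ω + i)` restricted to `base k`. -/
def smoothed (k : ℤ) (w : R3 → ℂ) : R3 → ℂ :=
  (sp ⁻¹' base k).indicator fun p => (symb p)⁻¹ * w p

theorem measurable_smoothed (k : ℤ) {w : R3 → ℂ} (hw : Measurable w) : Measurable (smoothed k w) :=
  (measurable_symb.inv.mul hw).indicator (measurable_sp (measurableSet_base k))

theorem norm_smoothed_le {k : ℤ} (hk : 100 ≤ k) {w : R3 → ℂ} {M : ℝ} (hM : 0 ≤ M)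
    (hw : ∀ p, ‖w p‖ ≤ M) {p : R3} (hp : sp p ∈ base k) :
    ‖smoothed k w p‖
      ≤ M * (1 + 2 ^ 41 * ((2 : ℝ) ^ (k + 1)) ^ 4 + 2 ^ (k + 1)) * (1 + p 1 ^ 2)⁻¹ := by
  have h1 := one_add_sq_le_norm_symb hk hp
  have h2 := one_le_norm_symb p
  rw [smoothed, Set.indicator_of_mem (by exact hp), norm_mul, norm_inv, mul_comm, mul_assoc]
  gcongr
  · exact hw p
  · rw [← div_eq_mul_inv, inv_eq_one_div, div_le_div_iff₀ (by linarith) (by positivity), one_mul]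
    exact h1

theorem smoothed_eq_zero {k : ℤ} {w : R3 → ℂ} {p : R3} (hp : sp p ∉ base k) :
    smoothed k w p = 0 := Set.indicator_of_notMem (by exact hp) _

theorem integrable_smoothed {k : ℤ} (hk : 100 ≤ k) {w : R3 → ℂ} (hwm : Measurable w) {M : ℝ}
    (hM : 0 ≤ M) (hw : ∀ p, ‖w p‖ ≤ M) : Integrable (smoothed k w) volume :=
  integrable_of_strip (measurable_smoothed k hwm).aestronglyMeasurable (measurableSet_base k)
    (volume_base_lt_top k) (by positivity) (fun _ hp => smoothed_eq_zero hp)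
    fun _ hp => norm_smoothed_le hk hM hw hp

theorem memLp_smoothed {k : ℤ} (hk : 100 ≤ k) {w : R3 → ℂ} (hwm : Measurable w) {M : ℝ}
    (hM : 0 ≤ M) (hw : ∀ p, ‖w p‖ ≤ M) : MemLp (smoothed k w) 2 volume := by
  refine memLp_two_of_strip (measurable_smoothed k hwm).aestronglyMeasurable (measurableSet_base k)
    (volume_base_lt_top k)
    (D := (M * (1 + 2 ^ 41 * ((2 : ℝ) ^ (k + 1)) ^ 4 + 2 ^ (k + 1))) ^ 2) (by positivity)
    (fun _ hp => smoothed_eq_zero hp) fun p hp => ?_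
  have h1 := norm_smoothed_le hk hM hw hp
  have h2 : (1 + p 1 ^ 2)⁻¹ ≤ 1 := inv_le_one_of_one_le₀ (by nlinarith [sq_nonneg (p 1)])
  calc ‖smoothed k w p‖ ^ 2
      ≤ (M * (1 + 2 ^ 41 * ((2 : ℝ) ^ (k + 1)) ^ 4 + 2 ^ (k + 1)) * (1 + p 1 ^ 2)⁻¹) ^ 2 := by gcongr
    _ ≤ _ := by
      rw [mul_pow, sq (1 + p 1 ^ 2)⁻¹]
      gcongr
      exact mul_le_of_le_one_left (by positivity) h2

/-- The Fourier transform of `Θ` in the variable `μ`. -/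
def partialFourier (Θ : R3 → ℂ) (y : ℝ) (w : R2) : ℂ :=
  ∫ s : ℝ, ((Real.fourierChar (-(s * y)) : Circle) : ℂ) * Θ (join w s)

theorem measurable_partialFourier {Θ : R3 → ℂ} (hΘ : Measurable Θ) (y : ℝ) :
    Measurable (partialFourier Θ y) := by
  have h : Measurable fun q : R2 × ℝ => ((Real.fourierChar (-(q.2 * y)) : Circle) : ℂ) *
      Θ (join q.1 q.2) := by
    refine Measurable.mul (Continuous.measurable ?_) (hΘ.comp measurePreserving_join.measurable)
    exact continuous_subtype_val.comp (Real.continuous_fourierChar.comp (by fun_prop))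
  exact (h.stronglyMeasurable.integral_prod_right (ν := volume)).measurable

theorem norm_partialFourier_smoothed_le {k : ℤ} (hk : 100 ≤ k) {w : R3 → ℂ} {M : ℝ} (hM : 0 ≤ M)
    (hw : ∀ p, ‖w p‖ ≤ M) (y : ℝ) (v : R2) :
    ‖partialFourier (smoothed k w) y v‖
      ≤ M * (1 + 2 ^ 41 * ((2 : ℝ) ^ (k + 1)) ^ 4 + 2 ^ (k + 1)) * ∫ s : ℝ, (1 + s ^ 2)⁻¹ := by
  rw [← integral_const_mul]
  refine norm_integral_le_of_norm_le (integrable_inv_one_add_sq.const_mul _)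
    (Filter.Eventually.of_forall fun s => ?_)
  rw [norm_fourierChar_mul]
  by_cases hv : v ∈ base k
  · exact norm_smoothed_le hk hM hw (p := join v s) (by simpa using hv)
  · rw [smoothed_eq_zero (by simpa using hv), norm_zero]
    positivity

variable {μ₀ : ℝ → ℝ}

/-- This is the dual of the bound for atoms. Pairing the partial transform with its own conjugate
`F` is pairing an atom built from `F`, times a character in `μ`, with `𝓕⁻ φ`. The character is
invisible in `L⁴`, so the bound is uniform in `y`. -/
theorem exists_eLpNorm_partialFourier_le (h : IsBasicCutoff μ₀) : ∃ C : ℝ≥0, ∀ (k : ℤ) (φ : R3 → ℂ)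
    (y : ℝ), 100 ≤ k → Integrable φ volume → MemLp φ 2 volume →
    eLpNorm (𝓕 (partialFourier (smoothed k (𝓕⁻ φ)) y)) 2 volume
      ≤ C * 2 ^ (-(k : ℝ) / 2) * N43 volume φ := by
  obtain ⟨C, hC⟩ := exists_eLpNorm_ift_atom_le h
  refine ⟨C, fun k φ y hk hφ hφ2 => ?_⟩
  set M := ∫ p, ‖φ p‖
  have hM : 0 ≤ M := integral_nonneg fun _ => norm_nonneg _
  have hw : ∀ p, ‖𝓕⁻ φ p‖ ≤ M := fun p => by
    rw [Real.fourierInv_eq]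
    refine (norm_integral_le_integral_norm _).trans (le_of_eq ?_)
    simp
    rfl
  have hwm : Measurable (𝓕⁻ φ) := (continuous_fourierInv_of_integrable hφ).measurable
  set Θ := smoothed k (𝓕⁻ φ) with hΘ
  set Φ := partialFourier Θ y with hΦ
  have hΘi : Integrable Θ volume := integrable_smoothed hk hwm hM hw
  have hΦm : Measurable Φ := measurable_partialFourier (measurable_smoothed k hwm) y
  have hΦi : Integrable Φ volume := (integrable_fourierChar_slice hΘi y).integral_prod_left
  set B := M * (1 + 2 ^ 41 * ((2 : ℝ) ^ (k + 1)) ^ 4 + 2 ^ (k + 1)) * ∫ s : ℝ, (1 + s ^ 2)⁻¹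
  have hΦB : ∀ v, ‖Φ v‖ ≤ B := norm_partialFourier_smoothed_le hk hM hw y
  have hΦ2 : MemLp Φ 2 volume := by
    rw [memLp_two_iff_integrable_sq_norm hΦm.aestronglyMeasurable]
    refine (hΦi.norm.const_mul B).mono' (hΦm.norm.pow_const _).aestronglyMeasurable
      (Filter.Eventually.of_forall fun v => ?_)
    rw [Real.norm_of_nonneg (by positivity), sq]
    gcongr
    exact hΦB v
  rw [eLpNorm_fourier_two hΦi hΦ2]
  -- With this choice the pairing is `‖Φ‖₂²`, so one power of `‖Φ‖₂` can be cancelled at the end.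
  -- The preceding qualitative bounds make that norm finite.
  set F : R2 → ℂ := fun v => (starRingEnd ℂ) (Φ v) with hF
  have hFm : Measurable F := Complex.continuous_conj.measurable.comp hΦm
  have hFB : ∀ v, ‖F v‖ ≤ B := fun v => by simpa [hF] using hΦB v
  have hFn : eLpNorm F 2 volume = eLpNorm Φ 2 volume :=
    eLpNorm_congr_norm_ae (Filter.Eventually.of_forall fun v => by simp [hF])
  set e : R3 := join 0 y with he
  have hinner : ∀ q : R3, inner ℝ q e = q 1 * y := fun q => by
    conv_lhs => rw [← join_sp q]
    rw [he, inner_join_join]; simp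
  set a : R3 → ℂ := fun q => ((Real.fourierChar (-inner ℝ q e) : Circle) : ℂ) * atom k F q with ha
  have hatom := memLp_atom hk hFm hFB
  have hsq : ∫ v, Φ v * F v = ∫ p, a p * ift φ p := by
    have h1 : ∫ p, a p * ift φ p = ∫ p, a p * 𝓕⁻ φ p := integral_congr_ae (by
      filter_upwards [ift_of_integrable hφ2 hφ] with p hp
      rw [hp])
    have h2 : (fun p => a p * 𝓕⁻ φ p)
        = fun p => ((Real.fourierChar (-(p 1 * y)) : Circle) : ℂ) * Θ p * F (sp p) := by
      funext p
      simp only [ha, hinner, atom, hΘ, smoothed]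
      by_cases hp : p ∈ sp ⁻¹' base k
      · simp only [Set.indicator_of_mem hp]; ring
      · simp only [Set.indicator_of_notMem hp]; ring
    have h3 : Integrable (fun p => ((Real.fourierChar (-(p 1 * y)) : Circle) : ℂ) * Θ p * F (sp p))
        volume := by
      refine (hΘi.norm.mul_const B).mono' (Measurable.aestronglyMeasurable ?_)
        (Filter.Eventually.of_forall fun p => ?_)
      · refine Measurable.mul (Measurable.mul (Continuous.measurable ?_) (measurable_smoothed k hwm))
          (hFm.comp measurable_sp)
        exact continuous_subtype_val.comp (Real.continuous_fourierChar.comp (by fun_prop))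
      · rw [norm_mul, norm_fourierChar_mul]
        gcongr
        exact hFB _
    rw [h1, h2, integral_split h3]
    refine integral_congr_ae (Filter.Eventually.of_forall fun v => ?_)
    simp only [sp_join, join_one, integral_mul_const]
    rfl
  have hnorm : ‖∫ v, Φ v * F v‖ₑ = eLpNorm Φ 2 volume ^ (2 : ℝ) := by
    rw [← eLpNorm_two_rpow, ← ofReal_norm]
    have h1 : ∀ v, Φ v * F v = ((‖Φ v‖ ^ 2 : ℝ) : ℂ) := fun v => by
      simp only [hF]; rw [Complex.mul_conj']; push_cast; rfl
    simp only [h1, enorm_rpow_two]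
    rw [integral_complex_ofReal, Complex.norm_real, Real.norm_of_nonneg (by positivity),
      ofReal_integral_eq_lintegral_ofReal
        ((memLp_two_iff_integrable_sq_norm hΦm.aestronglyMeasurable).1 hΦ2)
        (Filter.Eventually.of_forall fun v => by positivity)]
  have hmain : eLpNorm Φ 2 volume ^ (2 : ℝ)
      ≤ (C * 2 ^ (-(k : ℝ) / 2) * N43 volume φ) * eLpNorm Φ 2 volume := by
    rw [← hnorm, hsq]
    refine (enorm_integral_mul_ift_le (memLp_fourierChar_mul hatom e) hφ2).trans ?_
    rw [eLpNorm_ift_fourierChar_mul hatom]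
    calc _ ≤ (C * 2 ^ (-(k : ℝ) / 2) * eLpNorm F 2 volume) * N43 volume φ := by
          gcongr; exact hC k F B hk hFm hFB
      _ = _ := by rw [hFn]; ring
  rcases eq_or_ne (eLpNorm Φ 2 volume) 0 with h0 | h0
  · rw [h0]; exact zero_le
  · rw [show (2 : ℝ) = 1 + 1 by norm_num, ENNReal.rpow_add_of_nonneg _ _ (by norm_num) (by norm_num),
      ENNReal.rpow_one, show (1 : ℝ) + 1 = 2 by norm_num] at hmain
    exact (ENNReal.mul_le_mul_iff_left h0 hΦ2.2.ne).1 hmain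

/-- Cauchy-Schwarz on each plane of constant `y`, followed by the supremum in `y` on the second
factor. -/
theorem enorm_integral_mul_le_mixedNorm {u Ψ : R3 → ℂ} (hu : Measurable u) (hΨ : Measurable Ψ)
    {B : ℝ≥0∞} (hB : ∀ y, eLpNorm (fun v : R2 => Ψ (join v y)) 2 volume ≤ B) :
    ‖∫ p, u p * Ψ p‖ₑ ≤ mixedNorm u * B := by
  refine (enorm_integral_le_lintegral_enorm _).trans ?_
  rw [lintegral_split_swap (F := fun p => ‖u p * Ψ p‖ₑ) (hu.mul hΨ).enorm.aemeasurable, mixedNorm,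
    ← lintegral_mul_const'']
  swap
  · exact ((measurable_join_lintegral (hu.enorm.pow_const _)).pow_const _).aemeasurable
  refine lintegral_mono fun y => ?_
  have h1 := ENNReal.lintegral_mul_le_Lp_mul_Lq (volume : Measure R2)
    (Real.HolderConjugate.two_two) (f := fun v => ‖u (join v y)‖ₑ) (g := fun v => ‖Ψ (join v y)‖ₑ)
    (hu.comp (measurable_join_left y)).enorm.aemeasurable
    (hΨ.comp (measurable_join_left y)).enorm.aemeasurable
  simp only [enorm_mul]
  refine h1.trans ?_
  gcongr
  refine le_trans (le_of_eq ?_) (hB y)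
  rw [eLpNorm_two_rpow (fun v : R2 => Ψ (join v y)), ← ENNReal.rpow_mul]
  norm_num

/-- Dualizing the `L⁴` norm moves the division by the symbol from `f` to the test function. It then
suffices to bound the result in `L²` on planes of constant `y`, uniformly in `y`. -/
theorem exists_eLpNorm_ift_four_le_mixedNorm (h : IsBasicCutoff μ₀) : ∃ C : ℝ≥0, ∀ (k : ℤ)
    (f : R3 → ℂ), 100 ≤ k → MemLp f 2 volume → SupportedIn f (RKPI ∩ slab k) →
    MemLp (fun p => symb p * f p) 2 volume →
    eLpNorm (ift f) 4 volume
      ≤ C * 2 ^ (-(k : ℝ) / 2) * mixedNorm (ift fun p => symb p * f p) := by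
  obtain ⟨C, hC⟩ := exists_eLpNorm_partialFourier_le h
  refine ⟨C, fun k f hk hf hs hg => eLpNorm_ift_four_le_of_dual hf fun φ hφ hφ2 => ?_⟩
  set M := ∫ p, ‖φ p‖
  have hM : 0 ≤ M := integral_nonneg fun _ => norm_nonneg _
  have hw : ∀ p, ‖𝓕⁻ φ p‖ ≤ M := fun p => by
    rw [Real.fourierInv_eq]
    refine (norm_integral_le_integral_norm _).trans (le_of_eq ?_)
    simp
    rfl
  have hwm : Measurable (𝓕⁻ φ) := (continuous_fourierInv_of_integrable hφ).measurable
  set Θ := smoothed k (𝓕⁻ φ) with hΘ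
  have hΘi : Integrable Θ volume := integrable_smoothed hk hwm hM hw
  have hΘ2 : MemLp Θ 2 volume := memLp_smoothed hk hwm hM hw
  have hneg := Measure.measurePreserving_neg (volume : Measure R3)
  set Θn : R3 → ℂ := fun p => Θ (-p) with hΘn
  have hΘn2 : MemLp Θn 2 volume := hΘ2.comp_measurePreserving hneg
  have hΘni : Integrable Θn volume := hΘi.comp_neg
  have hift : ift Θn =ᵐ[volume] 𝓕 Θ := by
    have h1 : 𝓕⁻ Θn = 𝓕 Θ := by
      rw [Real.fourierInv_eq_fourier_comp_neg]; simp [hΘn]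
    rw [← h1]; exact ift_of_integrable hΘn2 hΘni
  set g : R3 → ℂ := fun p => symb p * f p with hgdef
  -- The support of `f` lies over the base, so the cutoff in `Θ` costs nothing and the factor `symb`
  -- cancels. The reflection `Θn` turns the multiplication formula for inverse transforms into one
  -- with `𝓕 Θ`.
  have h1 : ∫ p, f p * ift φ p = ∫ p, ift g p * 𝓕 Θ p := by
    calc ∫ p, f p * ift φ p = ∫ p, g p * Θ p := by
          refine integral_congr_ae ?_
          filter_upwards [ift_of_integrable hφ2 hφ, hs] with p hp hsp
          rw [hp]
          by_cases hp2 : p ∈ RKPI ∩ slab k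
          · have h3 : p ∈ sp ⁻¹' base k := sp_mem_base hk hp2
            have h4 := symb_ne_zero p
            simp only [hgdef, hΘ, smoothed, Set.indicator_of_mem h3]
            field_simp
          · simp [hgdef, hsp hp2]
      _ = ∫ p, g p * ift (ift Θn) p := by
          refine integral_congr_ae ?_
          filter_upwards [ift_ift hΘn2] with p hp
          rw [hp]; simp [hΘn]
      _ = ∫ p, ift g p * ift Θn p := (integral_ift_mul hg (memLp_ift hΘn2)).symm
      _ = _ := by
          refine integral_congr_ae ?_
          filter_upwards [hift] with p hp
          rw [hp]
  have hcont : Continuous (𝓕 Θ) := by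
    have h1 : 𝓕⁻ Θn = 𝓕 Θ := by
      rw [Real.fourierInv_eq_fourier_comp_neg]; simp [hΘn]
    rw [← h1]; exact continuous_fourierInv_of_integrable hΘni
  rw [h1]
  refine (enorm_integral_mul_le_mixedNorm (measurable_ift hg) hcont.measurable fun y => ?_).trans
    (le_of_eq (?_ : _ * (C * 2 ^ (-(k : ℝ) / 2) * N43 volume φ) = _))
  · have h2 : (fun v : R2 => 𝓕 Θ (join v y)) = 𝓕 (partialFourier Θ y) := by
      funext v; exact fourier_join hΘi v y
    rw [h2]
    exact hC k φ y hk hφ hφ2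
  · ring

/-! ### The `L⁴` bound in `X_k + Y_k` -/

theorem exists_eLpNorm_ift_four_le_Ynorm (h : IsBasicCutoff μ₀) : ∃ C : ℝ≥0, ∀ (k : ℤ) (f : R3 → ℂ),
    eLpNorm (ift f) 4 volume ≤ C * Ynorm k f := by
  obtain ⟨C, hC⟩ := exists_eLpNorm_ift_four_le_mixedNorm h
  -- The summand `1` keeps the constant positive, so that the bound is trivial when the norm is
  -- infinite.
  refine ⟨C * (2 * Real.pi).toNNReal + 1, fun k f => ?_⟩
  have htop : ((C * (2 * Real.pi).toNNReal + 1 : ℝ≥0) : ℝ≥0∞) * ⊤ = ⊤ :=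
    ENNReal.mul_top (by positivity)
  unfold Ynorm
  split_ifs with h1 h2 h3
  · refine (hC k f h1 h2.1 h2.2.1 h2.2.2).trans ?_
    rw [mixedNorm_ift h2.2.2, show ENNReal.ofReal (2 * Real.pi)
      = ((2 * Real.pi).toNNReal : ℝ≥0∞) from rfl]
    push_cast
    rw [add_mul]
    refine le_trans (le_of_eq ?_) le_self_add
    ring
  · rw [htop]; exact le_top
  · have h4 : f =ᵐ[volume] 0 := by
      filter_upwards [h3] with p hp
      exact hp (Set.notMem_empty p)
    have h5 : ift (0 : R3 → ℂ) =ᵐ[volume] 0 := ift_zero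
    rw [ift_congr h4, eLpNorm_congr_ae h5]
    simp
  · rw [htop]; exact le_top

theorem memLp_of_Ynorm_lt_top {k : ℤ} {f : R3 → ℂ} (h : Ynorm k f < ⊤) : MemLp f 2 volume := by
  unfold Ynorm at h
  split_ifs at h with h1 h2 h3
  · exact h2.1
  · exact absurd h (lt_irrefl _)
  · have h4 : f =ᵐ[volume] 0 := by
      filter_upwards [h3] with p hp
      exact hp (Set.notMem_empty p)
    exact (memLp_congr_ae h4).2 MemLp.zero
  · exact absurd h (lt_irrefl _)

/-- The `L⁴` norm is controlled by the norm of `X_k + Y_k`. -/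
theorem exists_eLpNorm_ift_four_le_XYnorm (h : IsBasicCutoff μ₀) : ∃ C : ℝ≥0, ∀ (k : ℤ) (f : R3 → ℂ),
    eLpNorm (ift f) 4 volume ≤ C * XYnorm μ₀ k f := by
  obtain ⟨C₁, h1⟩ := exists_eLpNorm_ift_four_le_Xnorm h
  obtain ⟨C₂, h2⟩ := exists_eLpNorm_ift_four_le_Ynorm h
  refine ⟨C₁ + C₂ + 1, fun k f => ?_⟩
  have hC0 : ((C₁ + C₂ + 1 : ℝ≥0) : ℝ≥0∞) ≠ 0 := by positivity
  rw [← ENNReal.div_le_iff' hC0 ENNReal.coe_ne_top]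
  refine le_iInf fun f₁ => le_iInf fun f₂ => le_iInf fun hf => ?_
  rw [ENNReal.div_le_iff' hC0 ENNReal.coe_ne_top]
  rcases eq_or_ne (Xnorm μ₀ k f₁ + Ynorm k f₂) ⊤ with htop | htop
  · rw [htop, ENNReal.mul_top hC0]; exact le_top
  obtain ⟨hX, hY⟩ := ENNReal.add_lt_top.1 (lt_top_iff_ne_top.2 htop)
  have m1 := (isL2Slab_of_Xnorm_lt_top hX).1
  have m2 := memLp_of_Ynorm_lt_top hY
  rw [ift_congr hf]
  refine (eLpNorm_ift_four_add_le m1 m2).trans ((add_le_add (h1 k f₁ m1) (h2 k f₂)).trans ?_)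
  rw [mul_add]
  gcongr
  · exact_mod_cast le_add_right le_self_add
  · exact_mod_cast le_add_right le_add_self

theorem memLp_of_XYnorm_lt_top {k : ℤ} {f : R3 → ℂ} (h : XYnorm μ₀ k f < ⊤) :
    MemLp f 2 volume := by
  simp only [XYnorm, iInf_lt_iff] at h
  obtain ⟨f₁, f₂, hf, hlt⟩ := h
  obtain ⟨hX, hY⟩ := ENNReal.add_lt_top.1 hlt
  exact (memLp_congr_ae hf).2 ((isL2Slab_of_Xnorm_lt_top hX).1.add (memLp_of_Ynorm_lt_top hY))

end KPI
end

noncomputable section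

namespace KPI

open MeasureTheory

variable {μ₀ : ℝ → ℝ}

/-! ### Elementary properties of the norms -/

theorem XYnorm_congr {k : ℤ} {f g : R3 → ℂ} (h : f =ᵐ[volume] g) :
    XYnorm μ₀ k f = XYnorm μ₀ k g := by
  have h1 : ∀ f₁ f₂ : R3 → ℂ, (f =ᵐ[volume] f₁ + f₂) = (g =ᵐ[volume] f₁ + f₂) := fun f₁ f₂ =>
    propext ⟨fun h2 => h.symm.trans h2, fun h2 => h.trans h2⟩
  simp only [XYnorm, h1]

theorem supportedIn_of_Ynorm_lt_top {k : ℤ} {f : R3 → ℂ} (h : Ynorm k f < ⊤) :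
    SupportedIn f (slab k) := by
  unfold Ynorm at h
  split_ifs at h with h1 h2 h3
  · filter_upwards [h2.2.1] with p hp hps
    exact hp fun hh => hps hh.2
  · exact absurd h (lt_irrefl _)
  · filter_upwards [h3] with p hp _
    exact hp (Set.notMem_empty p)
  · exact absurd h (lt_irrefl _)

theorem supportedIn_of_XYnorm_lt_top {k : ℤ} {f : R3 → ℂ} (h : XYnorm μ₀ k f < ⊤) :
    SupportedIn f (slab k) := by
  simp only [XYnorm, iInf_lt_iff] at h
  obtain ⟨f₁, f₂, hf, hlt⟩ := h
  obtain ⟨hX, hY⟩ := ENNReal.add_lt_top.1 hlt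
  filter_upwards [hf, (isL2Slab_of_Xnorm_lt_top hX).2, supportedIn_of_Ynorm_lt_top hY] with p h1 h2 h3 hp
  rw [h1, Pi.add_apply, h2 hp, h3 hp, add_zero]

/-- The inverse transform is one representative of its class, so even for the zero function the
iterated integrals require Tonelli. -/
theorem mixedNorm_eq_zero {u : R3 → ℂ} (hu : Measurable u) (h : u =ᵐ[volume] 0) :
    mixedNorm u = 0 := by
  have h1 : ∫⁻ p, ‖u p‖ₑ ^ (2 : ℝ) = 0 := by
    rw [lintegral_eq_zero_iff (hu.enorm.pow_const _)]
    filter_upwards [h] with p hp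
    simp [hp]
  rw [lintegral_split_swap (hu.enorm.pow_const _).aemeasurable,
    lintegral_eq_zero_iff (measurable_join_lintegral (hu.enorm.pow_const _))] at h1
  rw [mixedNorm, lintegral_eq_zero_iff
    ((measurable_join_lintegral (hu.enorm.pow_const _)).pow_const _)]
  filter_upwards [h1] with y hy
  rw [hy]; simp

theorem Ynorm_zero (k : ℤ) : Ynorm k 0 = 0 := by
  unfold Ynorm
  have h0 : (fun p => symb p * (0 : R3 → ℂ) p) = 0 := by funext p; simp
  split_ifs with h1 h2 h3
  · have h3 := mixedNorm_ift h2.2.2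
    have h4 : ift (fun p => symb p * (0 : R3 → ℂ) p) =ᵐ[volume] 0 := by
      rw [h0]; exact ift_zero
    rw [mixedNorm_eq_zero (measurable_ift h2.2.2) h4, eq_comm, mul_eq_zero] at h3
    rcases h3 with h3 | h3
    · rw [ENNReal.ofReal_eq_zero] at h3
      have := Real.pi_pos
      linarith
    · rw [h3, mul_zero]
  · exact absurd ⟨MemLp.zero, Filter.Eventually.of_forall fun _ _ => rfl, by rw [h0]; exact MemLp.zero⟩ h2
  · rfl
  · exact absurd (Filter.Eventually.of_forall fun _ _ => rfl) h3

/-- The outputs are estimated through this trivial decomposition. -/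
theorem XYnorm_le_Xnorm (k : ℤ) (f : R3 → ℂ) : XYnorm μ₀ k f ≤ Xnorm μ₀ k f := by
  refine (iInf₂_le f (0 : R3 → ℂ)).trans ((iInf_le _ (by rw [add_zero])).trans ?_)
  rw [Ynorm_zero, add_zero]

/-! ### Finite overlap -/

/-- If `2^n ≤ |s| < 2^{n+1}`, then `s ∈ I k` forces `n - 1 ≤ k ≤ n + 1`. -/
theorem tsum_indicator_I_le (s : ℝ) : ∑' k : ℤ, (I k).indicator (fun _ => (1 : ℝ≥0∞)) s ≤ 3 := by
  rcases eq_or_ne s 0 with rfl | hs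
  · have h : ∀ k : ℤ, (I k).indicator (fun _ => (1 : ℝ≥0∞)) (0 : ℝ) = 0 := fun k =>
      Set.indicator_of_notMem (fun hh => by
        have h1 : (2 : ℝ) ^ (k - 1) ≤ |0| := hh.1
        have h2 : (0 : ℝ) < 2 ^ (k - 1) := by positivity
        rw [abs_zero] at h1
        linarith) _
    simp [h]
  · set n := Int.log 2 |s| with hn
    have hpos : 0 < |s| := abs_pos.2 hs
    have h1 : (2 : ℝ) ^ n ≤ |s| := by exact_mod_cast Int.zpow_log_le_self (b := 2) (by norm_num) hpos
    have h2 : |s| < (2 : ℝ) ^ (n + 1) := by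
      exact_mod_cast Int.lt_zpow_succ_log_self (b := 2) (by norm_num) |s|
    have h3 : ∀ k ∉ Finset.Icc (n - 1) (n + 1), (I k).indicator (fun _ => (1 : ℝ≥0∞)) s = 0 := by
      intro k hk
      refine Set.indicator_of_notMem (fun hh => hk ?_) _
      have h4 := (zpow_lt_zpow_iff_right₀ (by norm_num : (1 : ℝ) < 2)).1 (hh.1.trans_lt h2)
      have h5 := (zpow_le_zpow_iff_right₀ (by norm_num : (1 : ℝ) < 2)).1 (h1.trans hh.2)
      rw [Finset.mem_Icc]
      omega
    rw [tsum_eq_sum h3]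
    refine (Finset.sum_le_card_nsmul _ _ 1 fun k _ => Set.indicator_le_self' (by simp) s).trans ?_
    rw [Int.card_Icc, show n + 1 + 1 - (n - 1) = 3 by ring]
    norm_num

theorem tsum_lintegral_indicator_le {ι : Type*} [Countable ι] {S : ι → Set R3}
    (hS : ∀ i, MeasurableSet (S i)) {H : R3 → ℝ≥0∞} (hH : AEMeasurable H volume) {c : ℝ≥0∞}
    (hc : ∀ p, ∑' i, (S i).indicator (fun _ => (1 : ℝ≥0∞)) p ≤ c) :
    ∑' i, ∫⁻ p, (S i).indicator H p ≤ c * ∫⁻ p, H p := by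
  rw [← lintegral_tsum fun i => hH.indicator (hS i), ← lintegral_const_mul'' _ hH]
  refine lintegral_mono fun p => ?_
  have h1 : ∀ i, (S i).indicator H p = (S i).indicator (fun _ => (1 : ℝ≥0∞)) p * H p := fun i => by
    by_cases hp : p ∈ S i <;> simp [hp]
  simp only [h1]
  rw [ENNReal.tsum_mul_right]
  gcongr
  exact hc p

theorem tsum_indicator_muCut_le (h : IsBasicCutoff μ₀) (p : R3) :
    ∑' j : ℕ, {p : R3 | muCut μ₀ j (modulation p) ≠ 0}.indicator (fun _ => (1 : ℝ≥0∞)) p ≤ 4 := by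
  set s := modulation p
  have h1 : ∀ j : ℕ, {p : R3 | muCut μ₀ j (modulation p) ≠ 0}.indicator (fun _ => (1 : ℝ≥0∞)) p
      ≤ (if j = 0 then 1 else 0) + (I (j : ℤ)).indicator (fun _ => (1 : ℝ≥0∞)) s := by
    intro j
    by_cases hp : muCut μ₀ j s ≠ 0
    · rw [Set.indicator_of_mem (by exact hp)]
      by_cases hj : j = 0
      · rw [if_pos hj]; exact le_self_add
      · have h2 : s ∈ I (j : ℤ) := by
          unfold muCut at hp
          rw [if_neg hj] at hp
          exact abs_le_of_chi_ne_zero h hp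
        rw [Set.indicator_of_mem h2]; exact le_add_self
    · rw [Set.indicator_of_notMem (by exact hp)]; exact zero_le
  refine (ENNReal.tsum_le_tsum h1).trans ?_
  rw [ENNReal.tsum_add, tsum_ite_eq, show (4 : ℝ≥0∞) = 1 + 3 by norm_num]
  gcongr
  exact (ENNReal.tsum_comp_le_tsum_of_injective Nat.cast_injective
    (fun k : ℤ => (I k).indicator (fun _ => (1 : ℝ≥0∞)) s)).trans (tsum_indicator_I_le s)

/-! ### The norm of `X_k` of functions dominated by `|τ - ω + i|⁻¹` -/

theorem eLpNorm_muPiece_sq_le (h : IsBasicCutoff μ₀) {G : R3 → ℂ} {H : R3 → ℝ}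
    (hGH : ∀ᵐ p, ‖G p‖ ≤ ‖symb p‖⁻¹ * H p) (j : ℕ) :
    eLpNorm (muPiece μ₀ j G) 2 volume ^ (2 : ℝ) ≤ 4 * 2 ^ (-(2 * j) : ℝ) *
      ∫⁻ p, {p : R3 | muCut μ₀ j (modulation p) ≠ 0}.indicator (fun p => ‖H p‖ₑ ^ (2 : ℝ)) p := by
  rw [← eLpNorm_two_rpow, ← lintegral_const_mul']
  swap
  · exact ENNReal.mul_ne_top (by norm_num) (ENNReal.rpow_ne_top_of_ne_zero (by norm_num) (by norm_num))
  refine lintegral_mono_ae ?_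
  filter_upwards [hGH] with p hp
  by_cases hj : muCut μ₀ j (modulation p) ≠ 0
  · rw [Set.indicator_of_mem (by exact hj)]
    have h1 := two_pow_le_norm_symb h hj
    have h2 : 0 < ‖symb p‖ := norm_pos_iff.2 (symb_ne_zero p)
    have h3 : ‖muPiece μ₀ j G p‖ ≤ 2 * (2 ^ j)⁻¹ * ‖H p‖ := by
      refine (norm_muPiece_le h j G p).trans (hp.trans ?_)
      have h4 : ‖symb p‖⁻¹ ≤ 2 * (2 ^ j)⁻¹ := by
        rw [inv_eq_one_div, ← div_eq_mul_inv, div_le_div_iff₀ h2 (by positivity)]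
        linarith
      calc ‖symb p‖⁻¹ * H p ≤ ‖symb p‖⁻¹ * ‖H p‖ := by gcongr; exact Real.le_norm_self _
        _ ≤ _ := by gcongr
    have h5 : ‖muPiece μ₀ j G p‖ₑ ≤ 2 * 2 ^ (-(j : ℝ)) * ‖H p‖ₑ := by
      rw [← ofReal_norm, ← ofReal_norm]
      refine (ENNReal.ofReal_le_ofReal h3).trans (le_of_eq ?_)
      rw [ENNReal.ofReal_mul (by positivity), ENNReal.ofReal_mul (by norm_num),
        ENNReal.ofReal_inv_of_pos (by positivity), ENNReal.rpow_neg, ENNReal.rpow_natCast,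
        ENNReal.ofReal_pow (by norm_num)]
      norm_num
    calc ‖muPiece μ₀ j G p‖ₑ ^ (2 : ℝ) ≤ (2 * 2 ^ (-(j : ℝ)) * ‖H p‖ₑ) ^ (2 : ℝ) := by gcongr
      _ = _ := by
        rw [ENNReal.mul_rpow_of_nonneg _ _ (by norm_num), ENNReal.mul_rpow_of_nonneg _ _ (by norm_num),
          ← ENNReal.rpow_mul]
        norm_num
        ring_nf
  · have h1 : muPiece μ₀ j G p = 0 := by
      rw [not_not] at hj
      simp [muPiece, hj]
    rw [h1]; simp

/-- On the `j`-th modulation piece the symbol gains `2^{-j}`. For small `j` the terms `2^{j/2}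
2^{-j}` form a geometric series. For large `j` the factor `2^{2j - 2k₊} 2^{-2j}` is at most `1`, and
the squares add up by finite overlap of the cutoffs. -/
theorem exists_Xnorm_le (h : IsBasicCutoff μ₀) : ∃ C : ℝ≥0, ∀ (k : ℤ) (G : R3 → ℂ) (H : R3 → ℝ),
    IsL2Slab k G → AEMeasurable H volume → (∀ᵐ p, ‖G p‖ ≤ ‖symb p‖⁻¹ * H p) →
    Xnorm μ₀ k G ≤ C * eLpNorm H 2 volume := by
  have hg := geomSum_lt_top (c := 1 / 2) (by norm_num)
  refine ⟨(2 * geomSum (1 / 2) + 4).toNNReal, fun k G H hG hH hGH => ?_⟩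
  rw [ENNReal.coe_toNNReal (by finiteness)]
  have hpiece := eLpNorm_muPiece_sq_le h hGH
  have hE : eLpNorm H 2 volume ^ (2 : ℝ) = ∫⁻ p, ‖H p‖ₑ ^ (2 : ℝ) := by
    rw [eLpNorm_eq_lintegral_rpow_enorm_toReal (by norm_num) (by norm_num), ← ENNReal.rpow_mul]
    norm_num
  have hS : ∀ j : ℕ, MeasurableSet {p : R3 | muCut μ₀ j (modulation p) ≠ 0} := fun j =>
    ((measurable_muCut h j).comp measurable_modulation) (measurableSet_singleton 0).compl
  have hH2 : AEMeasurable (fun p => ‖H p‖ₑ ^ (2 : ℝ)) volume := hH.enorm.pow_const _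
  rw [Xnorm, if_pos hG, add_mul]
  gcongr
  · have h1 : ∀ j : ℕ, L2norm (fun p => (muCut μ₀ j (modulation p) : ℂ) * G p)
        ≤ 2 * 2 ^ (-(j : ℝ)) * eLpNorm H 2 volume := by
      intro j
      have h2 : eLpNorm (muPiece μ₀ j G) 2 volume ^ (2 : ℝ)
          ≤ 4 * 2 ^ (-(2 * j) : ℝ) * eLpNorm H 2 volume ^ (2 : ℝ) := by
        refine (hpiece j).trans ?_
        rw [hE]
        gcongr with p
        exact Set.indicator_le_self' (fun _ _ => zero_le) p
      have h3 := le_of_rpow_two_le h2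
      have h4 : (4 : ℝ≥0∞) ^ (1 / 2 : ℝ) = 2 := by
        rw [show (4 : ℝ≥0∞) = 2 ^ (2 : ℝ) by norm_num, ← ENNReal.rpow_mul]; norm_num
      rw [h4, show (-(2 * j) / 2 : ℝ) = -j by ring] at h3
      exact h3
    calc _ ≤ ∑ j ∈ Finset.range (2 * k.toNat), 2 * eLpNorm H 2 volume * 2 ^ (-(1 / 2 * (j : ℝ))) := by
          refine Finset.sum_le_sum fun j _ => ?_
          calc _ ≤ (2 : ℝ≥0∞) ^ ((j : ℝ) / 2) * (2 * 2 ^ (-(j : ℝ)) * eLpNorm H 2 volume) := by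
                gcongr; exact h1 j
            _ = 2 * eLpNorm H 2 volume * (2 ^ ((j : ℝ) / 2) * 2 ^ (-(j : ℝ))) := by ring
            _ = _ := by rw [← two_rpow_add]; ring_nf
      _ ≤ 2 * eLpNorm H 2 volume * geomSum (1 / 2) := by
          rw [← Finset.mul_sum]
          gcongr
          exact ENNReal.sum_le_tsum _
      _ = _ := by ring
  · have h1 : (∑' j : Set.Ici (2 * k.toNat), (2 : ℝ≥0∞) ^ (2 * (j : ℝ) - 2 * (k.toNat : ℝ)) *
        L2norm (fun p => (muCut μ₀ j (modulation p) : ℂ) * G p) ^ (2 : ℝ))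
        ≤ 16 * eLpNorm H 2 volume ^ (2 : ℝ) := by
      calc _ ≤ ∑' j : Set.Ici (2 * k.toNat), 4 * ∫⁻ p,
            {p : R3 | muCut μ₀ j (modulation p) ≠ 0}.indicator (fun p => ‖H p‖ₑ ^ (2 : ℝ)) p := by
            refine ENNReal.tsum_le_tsum fun j => ?_
            refine (mul_le_mul_right (hpiece j) _).trans ?_
            rw [← mul_assoc, show (2 : ℝ≥0∞) ^ (2 * (j : ℝ) - 2 * (k.toNat : ℝ))
              * (4 * 2 ^ (-(2 * (j : ℕ)) : ℝ)) = 4 * (2 ^ (2 * (j : ℝ) - 2 * (k.toNat : ℝ))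
              * 2 ^ (-(2 * (j : ℕ)) : ℝ)) by ring, ← two_rpow_add]
            gcongr
            refine mul_le_of_le_one_right zero_le ?_
            refine (ENNReal.rpow_le_rpow_of_exponent_le (by norm_num) (?_ : _ ≤ (0 : ℝ))).trans
              (by simp)
            have : (0 : ℝ) ≤ k.toNat := Nat.cast_nonneg _
            linarith
        _ ≤ ∑' j : ℕ, 4 * ∫⁻ p,
            {p : R3 | muCut μ₀ j (modulation p) ≠ 0}.indicator (fun p => ‖H p‖ₑ ^ (2 : ℝ)) p :=
            ENNReal.tsum_comp_le_tsum_of_injective Subtype.val_injective (fun j : ℕ => 4 * ∫⁻ p,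
              {p : R3 | muCut μ₀ j (modulation p) ≠ 0}.indicator (fun p => ‖H p‖ₑ ^ (2 : ℝ)) p)
        _ ≤ _ := by
            rw [ENNReal.tsum_mul_left, hE, show (16 : ℝ≥0∞) = 4 * 4 by norm_num, mul_assoc]
            gcongr
            exact tsum_lintegral_indicator_le hS hH2 (tsum_indicator_muCut_le h)
    refine (ENNReal.rpow_le_rpow h1 (by norm_num)).trans (le_of_eq ?_)
    rw [ENNReal.mul_rpow_of_nonneg _ _ (by norm_num), ← ENNReal.rpow_mul,
      show (16 : ℝ≥0∞) = 4 ^ (2 : ℝ) by norm_num, ← ENNReal.rpow_mul]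
    norm_num

theorem tsum_eLpNorm_slab_le {H : R3 → ℝ} (hH : AEMeasurable H volume) :
    ∑' k : ℤ, eLpNorm ((slab k).indicator H) 2 volume ^ (2 : ℝ)
      ≤ 3 * eLpNorm H 2 volume ^ (2 : ℝ) := by
  have hE : ∀ F : R3 → ℝ, eLpNorm F 2 volume ^ (2 : ℝ) = ∫⁻ p, ‖F p‖ₑ ^ (2 : ℝ) := fun F => by
    rw [eLpNorm_eq_lintegral_rpow_enorm_toReal (by norm_num) (by norm_num), ← ENNReal.rpow_mul]
    norm_num
  have hS : ∀ k : ℤ, MeasurableSet (slab k) := fun k =>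
    (by fun_prop : Measurable fun p : R3 => p 0) (measurableSet_I k)
  have h1 : ∀ (k : ℤ) (p : R3), ‖(slab k).indicator H p‖ₑ ^ (2 : ℝ)
      = (slab k).indicator (fun p => ‖H p‖ₑ ^ (2 : ℝ)) p := fun k p => by
    by_cases hp : p ∈ slab k <;> simp [hp]
  simp only [hE, h1]
  refine tsum_lintegral_indicator_le hS (hH.enorm.pow_const _) fun p => ?_
  exact tsum_indicator_I_le (p 0)

end KPI
end

noncomputable section

namespace KPI

open MeasureTheory

variable {μ₀ : ℝ → ℝ}

/-! ### Weak derivatives -/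

theorem IsWeakDerivMu.ae_eq {f g g' : R3 → ℂ} (h : IsWeakDerivMu f g) (h' : IsWeakDerivMu f g') :
    g =ᵐ[volume] g' := by
  refine ae_eq_of_integral_contDiff_smul_eq h.2.1 h'.2.1 fun φ hφ hc => ?_
  have h1 : HasCompactSupport (fun x => (φ x : ℂ)) :=
    hc.comp_left (g := fun r : ℝ => (r : ℂ)) (by simp)
  have h2 : ContDiff ℝ ∞ (fun x => (φ x : ℂ)) := Complex.ofRealCLM.contDiff.comp hφ
  have h3 := (h.2.2 _ h2 h1).symm.trans (h'.2.2 _ h2 h1)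
  simp only [Complex.real_smul, mul_comm (φ _ : ℂ)]
  exact neg_injective h3

theorem XYnorm_add_le_Wnorm {k : ℤ} {f g : R3 → ℂ} (h : IsWeakDerivMu f g) :
    XYnorm μ₀ k (g + f) ≤ Wnorm μ₀ k f := by
  unfold Wnorm
  split_ifs
  · refine le_iInf₂ fun g' hg' => le_of_eq (XYnorm_congr ?_)
    filter_upwards [h.ae_eq hg'] with p hp
    simp [hp]
  · exact le_top

theorem conv_apply (f g : R3 → ℂ) (p : R3) : conv f g p = ∫ q, f q * g (p - q) := rfl

theorem memLp_sub_left {g : R3 → ℂ} (hg : MemLp g 2 volume) (p : R3) :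
    MemLp (fun q => g (p - q)) 2 volume :=
  hg.comp_measurePreserving (Measure.measurePreserving_sub_left volume p)

theorem lintegral_enorm_mul_le {f g : R3 → ℂ} (hf : MemLp f 2 volume) (hg : MemLp g 2 volume) :
    ∫⁻ q, ‖f q * g q‖ₑ ≤ eLpNorm f 2 volume * eLpNorm g 2 volume := by
  have h1 := ENNReal.lintegral_mul_le_Lp_mul_Lq volume Real.HolderConjugate.two_two
    hf.1.enorm hg.1.enorm
  simp only [enorm_mul]
  refine h1.trans (le_of_eq ?_)
  rw [eLpNorm_two_rpow, eLpNorm_two_rpow, ← ENNReal.rpow_mul, ← ENNReal.rpow_mul]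
  norm_num

/-- The convolution, paired with a test function. -/
theorem integral_conv_mul {f g ψ : R3 → ℂ} (hf : MemLp f 2 volume) (hg : MemLp g 2 volume)
    (hψ : Integrable ψ volume) :
    ∫ p, conv f g p * ψ p = ∫ z, g z * ∫ p, f p * ψ (p + z) := by
  have hm : AEStronglyMeasurable (fun z : R3 × R3 => g z.2 * f (z.1 - z.2) * ψ z.1)
      (volume.prod volume) :=
    (aestronglyMeasurable_conv_integrand hg.1 hf.1).mul hψ.1.comp_fst
  have hint : Integrable (fun z : R3 × R3 => g z.2 * f (z.1 - z.2) * ψ z.1) (volume.prod volume) := by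
    refine ⟨hm, ?_⟩
    rw [hasFiniteIntegral_iff_enorm, lintegral_prod _ hm.enorm]
    have h1 : ∀ p : R3, ∫⁻ z, ‖g z * f (p - z) * ψ p‖ₑ
        ≤ eLpNorm g 2 volume * eLpNorm f 2 volume * ‖ψ p‖ₑ := by
      intro p
      simp only [enorm_mul (_ * _)]
      have h2 : eLpNorm (fun z => f (p - z)) 2 volume = eLpNorm f 2 volume :=
        eLpNorm_comp_measurePreserving hf.1 (Measure.measurePreserving_sub_left volume p)
      rw [lintegral_mul_const' _ _ enorm_ne_top, ← h2]
      gcongr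
      exact lintegral_enorm_mul_le hg (memLp_sub_left hf p)
    refine (lintegral_mono h1).trans_lt ?_
    rw [lintegral_const_mul' _ _ (ENNReal.mul_ne_top hg.2.ne hf.2.ne)]
    exact ENNReal.mul_lt_top (ENNReal.mul_lt_top hg.2 hf.2) hψ.2
  have h1 : ∀ p, conv f g p * ψ p = ∫ z, g z * f (p - z) * ψ p := by
    intro p
    rw [integral_mul_const, conv_apply, ← integral_sub_left_eq_self _ volume p]
    simp only [sub_sub_cancel, mul_comm]
  simp only [h1]
  rw [integral_integral_swap hint]
  refine integral_congr_ae (Filter.Eventually.of_forall fun z => ?_)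
  simp only [mul_assoc]
  rw [integral_const_mul, ← integral_add_right_eq_self _ z]
  simp

theorem integrable_of_test {ψ : R3 → ℂ} (hψ : Continuous ψ) (hc : HasCompactSupport ψ) :
    Integrable ψ volume := hψ.integrable_of_hasCompactSupport hc

theorem continuous_fderiv_eMu {φ : R3 → ℂ} (hφ : ContDiff ℝ ∞ φ) :
    Continuous fun p => fderiv ℝ φ p eMu :=
  (hφ.continuous_fderiv (by simp)).clm_apply continuous_const

theorem hasCompactSupport_fderiv_eMu {φ : R3 → ℂ} (hc : HasCompactSupport φ) :
    HasCompactSupport fun p => fderiv ℝ φ p eMu := by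
  have := hc.fderiv_apply ℝ eMu
  exact this

/-- By Fubini, testing the convolution is testing the first factor against translates of the test
function, and each translate is again admissible. -/
theorem IsWeakDerivMu.conv {f f' g : R3 → ℂ} (h : IsWeakDerivMu f f') (hf : MemLp f 2 volume)
    (hf' : MemLp f' 2 volume) (hg : MemLp g 2 volume) (h1 : MemLp (KPI.conv f g) 2 volume)
    (h2 : MemLp (KPI.conv f' g) 2 volume) : IsWeakDerivMu (KPI.conv f g) (KPI.conv f' g) := by
  refine ⟨locallyIntegrable_of_memLp_two h1, locallyIntegrable_of_memLp_two h2, fun φ hφ hc => ?_⟩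
  rw [integral_conv_mul hf hg (integrable_of_test (continuous_fderiv_eMu hφ)
    (hasCompactSupport_fderiv_eMu hc)), integral_conv_mul hf' hg (integrable_of_test hφ.continuous hc),
    ← integral_neg]
  refine integral_congr_ae (Filter.Eventually.of_forall fun z => ?_)
  have h3 : ContDiff ℝ ∞ fun p : R3 => φ (p + z) := hφ.comp (contDiff_id.add contDiff_const)
  have h4 : HasCompactSupport fun p : R3 => φ (p + z) := hc.comp_homeomorph (Homeomorph.addRight z)
  have h5 := h.2.2 _ h3 h4
  simp only [fderiv_comp_add_right] at h5
  simp only [h5, mul_neg]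

theorem IsWeakDerivMu.mul {f g Θ : R3 → ℂ} (h : IsWeakDerivMu f g) (hΘ : ContDiff ℝ ∞ Θ)
    (h1 : LocallyIntegrable (fun p => Θ p * f p) volume)
    (h2 : LocallyIntegrable (fun p => fderiv ℝ Θ p eMu * f p + Θ p * g p) volume) :
    IsWeakDerivMu (fun p => Θ p * f p) (fun p => fderiv ℝ Θ p eMu * f p + Θ p * g p) := by
  refine ⟨h1, h2, fun φ hφ hc => ?_⟩
  have h3 := h.2.2 (fun p => Θ p * φ p) (hΘ.mul hφ) hc.mul_left
  have h4 : ∀ p, fderiv ℝ (fun p => Θ p * φ p) p eMu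
      = Θ p * fderiv ℝ φ p eMu + fderiv ℝ Θ p eMu * φ p := by
    intro p
    rw [fderiv_fun_mul (hΘ.differentiable (by simp) p) (hφ.differentiable (by simp) p)]
    simp [mul_comm]
  simp only [h4, mul_add] at h3
  have i1 : Integrable (fun p => f p * (Θ p * fderiv ℝ φ p eMu)) volume :=
    h.1.integrable_smul_right_of_hasCompactSupport (hΘ.continuous.mul (continuous_fderiv_eMu hφ))
      (hasCompactSupport_fderiv_eMu hc).mul_left
  have i2 : Integrable (fun p => f p * (fderiv ℝ Θ p eMu * φ p)) volume :=
    h.1.integrable_smul_right_of_hasCompactSupport ((continuous_fderiv_eMu hΘ).mul hφ.continuous)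
      hc.mul_left
  have i3 : Integrable (fun p => g p * (Θ p * φ p)) volume :=
    h.2.1.integrable_smul_right_of_hasCompactSupport (hΘ.continuous.mul hφ.continuous) hc.mul_left
  rw [integral_add i1 i2] at h3
  have e1 : ∫ p, Θ p * f p * fderiv ℝ φ p eMu = ∫ p, f p * (Θ p * fderiv ℝ φ p eMu) :=
    integral_congr_ae (Filter.Eventually.of_forall fun p => by simp only; ring)
  have e2 : ∫ p, (fderiv ℝ Θ p eMu * f p + Θ p * g p) * φ p
      = (∫ p, f p * (fderiv ℝ Θ p eMu * φ p)) + ∫ p, g p * (Θ p * φ p) := by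
    rw [← integral_add i2 i3]
    exact integral_congr_ae (Filter.Eventually.of_forall fun p => by simp only; ring)
  rw [e1, e2]
  linear_combination h3

/-! ### Convolutions -/

/-- The first coordinates of the two factors add up to that of `p`. -/
theorem conv_eq_zero {f g : R3 → ℂ} {k₁ k₂ : ℤ} (hf : SupportedIn f (slab k₁))
    (hg : SupportedIn g (slab k₂)) {p : R3} (hp : (2 : ℝ) ^ (k₁ + 1) + 2 ^ (k₂ + 1) < |p 0|) :
    conv f g p = 0 := by
  rw [conv_apply]
  refine integral_eq_zero_of_ae ?_
  have hg' : ∀ᵐ q : R3, p - q ∉ slab k₂ → g (p - q) = 0 :=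
    (Measure.measurePreserving_sub_left volume p).quasiMeasurePreserving.ae hg
  filter_upwards [hf, hg'] with q h1 h2
  by_cases hq : q ∈ slab k₁
  · have h3 : p - q ∉ slab k₂ := fun hh => by
      have h4 : |q 0| ≤ 2 ^ (k₁ + 1) := hq.2
      have h5 : |p 0 - q 0| ≤ 2 ^ (k₂ + 1) := hh.2
      have h6 := abs_add_le (p 0 - q 0) (q 0)
      rw [sub_add_cancel] at h6
      linarith
    simp [h2 h3]
  · simp [h1 hq]

/-- Write `μ` as the sum of the `μ` coordinates of `q` and `p - q`. -/
theorem coord_mul_conv {f g : R3 → ℂ} (hf : MemLp f 2 volume) (hg : MemLp g 2 volume)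
    (hf' : MemLp (fun p : R3 => (p 1 : ℂ) * f p) 2 volume)
    (hg' : MemLp (fun p : R3 => (p 1 : ℂ) * g p) 2 volume) (p : R3) :
    (p 1 : ℂ) * conv f g p
      = conv (fun p => (p 1 : ℂ) * f p) g p + conv f (fun p => (p 1 : ℂ) * g p) p := by
  simp only [conv_apply]
  rw [← integral_const_mul, ← integral_add (integrable_mul_L2 hf' (memLp_sub_left hg p))
    (integrable_mul_L2 hf (memLp_sub_left hg' p))]
  refine integral_congr_ae (Filter.Eventually.of_forall fun q => ?_)
  simp only [PiLp.sub_apply]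
  push_cast
  ring

/-! ### The multiplier -/

/-- The multiplier `2^k χ_k(ξ) (τ - ω + i)⁻¹`. -/
def multiplier (μ₀ : ℝ → ℝ) (k : ℤ) (p : R3) : ℂ :=
  (2 : ℂ) ^ k * (chi μ₀ k (p 0) : ℂ) * (symb p)⁻¹

theorem contDiff_chi (h : IsBasicCutoff μ₀) (k : ℤ) : ContDiff ℝ ∞ (chi μ₀ k) :=
  (h.smooth.comp (contDiff_id.div_const _)).sub (h.smooth.comp (contDiff_id.div_const _))

theorem contDiff_coord (i : Fin 3) : ContDiff ℝ ∞ fun p : R3 => p i :=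
  contDiff_piLp_apply 2

theorem contDiffAt_symb {p : R3} (hp : p 0 ≠ 0) : ContDiffAt ℝ ∞ symb p := by
  have h0 := (contDiff_coord 0).contDiffAt (x := p)
  have h1 := (contDiff_coord 1).contDiffAt (x := p)
  have h2 := (contDiff_coord 2).contDiffAt (x := p)
  have h3 : ContDiffAt ℝ ∞ modulation p := h2.sub ((h0.pow 3).add ((h1.pow 2).div h0 hp))
  exact (Complex.ofRealCLM.contDiff.contDiffAt.comp p h3).add contDiffAt_const

/-- The dispersion is singular only at `ξ = 0`, and `χ_k` vanishes near it. Smoothness is what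
allows the product rule for weak derivatives. -/
theorem contDiff_multiplier (h : IsBasicCutoff μ₀) (k : ℤ) : ContDiff ℝ ∞ (multiplier μ₀ k) := by
  rw [contDiff_iff_contDiffAt]
  intro p
  by_cases hp : p 0 = 0
  · have h1 : multiplier μ₀ k =ᶠ[nhds p] fun _ => 0 := by
      have h2 : ∀ᶠ q : R3 in nhds p, |q 0| < 2 ^ (k - 1) := by
        have hc : Continuous fun q : R3 => |q 0| := by fun_prop
        refine hc.continuousAt.eventually_lt continuousAt_const ?_
        rw [hp, abs_zero]; positivity
      filter_upwards [h2] with q hq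
      have h3 : chi μ₀ k (q 0) = 0 := by
        by_contra hne
        exact absurd (abs_le_of_chi_ne_zero h hne).1 (not_le.2 hq)
      simp [multiplier, h3]
    exact contDiffAt_const.congr_of_eventuallyEq h1
  · have h1 : ContDiffAt ℝ ∞ (fun q : R3 => ((chi μ₀ k (q 0) : ℝ) : ℂ)) p :=
      (Complex.ofRealCLM.contDiff.comp ((contDiff_chi h k).comp (contDiff_coord 0))).contDiffAt
    exact (contDiffAt_const.mul h1).mul ((contDiffAt_symb hp).inv (symb_ne_zero p))

theorem fderiv_multiplier (h : IsBasicCutoff μ₀) (k : ℤ) (p : R3) :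
    fderiv ℝ (multiplier μ₀ k) p eMu
      = multiplier μ₀ k p * (2 * (p 1 / p 0 : ℝ)) * (symb p)⁻¹ := by
  rw [← ((contDiff_multiplier h k).differentiable (by simp) p).lineDeriv_eq_fderiv]
  have h0 : ∀ t : ℝ, (p + t • eMu) 0 = p 0 := fun t => by simp [eMu]
  have h1 : ∀ t : ℝ, (p + t • eMu) 1 = p 1 + t := fun t => by simp [eMu]
  have h2 : ∀ t : ℝ, (p + t • eMu) 2 = p 2 := fun t => by simp [eMu]
  have h3 : HasDerivAt (fun t : ℝ => modulation (p + t • eMu)) (-(2 * (p 1 / p 0))) 0 := by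
    simp only [modulation, omega, h0, h1, h2]
    have h4 : HasDerivAt (fun t : ℝ => p 1 + t) 1 0 := (hasDerivAt_id (0 : ℝ)).const_add (p 1)
    refine ((((h4.pow 2).div_const (p 0)).const_add (p 0 ^ 3)).const_sub (p 2)).congr_deriv ?_
    push_cast
    ring
  have h5 : HasDerivAt (fun t : ℝ => symb (p + t • eMu)) ((-(2 * (p 1 / p 0)) : ℝ) : ℂ) 0 :=
    h3.ofReal_comp.add_const Complex.I
  have h6 := (h5.inv (symb_ne_zero _)).const_mul ((2 : ℂ) ^ k * (chi μ₀ k (p 0) : ℂ))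
  have h7 : (fun t : ℝ => multiplier μ₀ k (p + t • eMu))
      = fun t : ℝ => (2 : ℂ) ^ k * (chi μ₀ k (p 0) : ℂ) * (symb (p + t • eMu))⁻¹ := by
    funext t; rw [multiplier, h0]
  rw [lineDeriv, h7]
  refine h6.deriv.trans ?_
  rw [zero_smul, add_zero, multiplier]
  push_cast
  field_simp

end KPI
end

noncomputable section

namespace KPI

open MeasureTheory

variable {μ₀ : ℝ → ℝ}

/-! ### Elements of `V_k ∩ W_k` -/

/-- The information on `f ∈ V_k ∩ W_k` with weak derivative `g` used in the bilinear estimate. -/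
structure InputBounds (M : ℝ≥0∞) (k : ℤ) (f g : R3 → ℂ) : Prop where
  memLp : MemLp f 2 volume
  supported : SupportedIn f (slab k)
  memLp_coord : MemLp (fun p : R3 => (p 1 : ℂ) * f p) 2 volume
  weakDeriv : IsWeakDerivMu f g
  memLp_deriv : MemLp g 2 volume
  supported_deriv : SupportedIn g (slab k)
  four : eLpNorm (ift f) 4 volume ≤ ENNReal.ofReal (1 + 2 ^ k)⁻¹ * M
  four_coord : eLpNorm (ift fun p : R3 => (p 1 : ℂ) * f p) 4 volume ≤ ENNReal.ofReal (2 * 2 ^ k) * M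
  four_deriv : eLpNorm (ift g) 4 volume ≤ ENNReal.ofReal 2 * M

theorem isL2Slab_of_Vnorm_lt_top {k : ℤ} {f : R3 → ℂ} (h : Vnorm μ₀ k f < ⊤) : IsL2Slab k f := by
  unfold Vnorm at h
  split_ifs at h with h1
  · exact h1
  · exact absurd h (lt_irrefl _)

theorem exists_weakDeriv_of_Wnorm_lt_top {k : ℤ} {f : R3 → ℂ} (h : Wnorm μ₀ k f < ⊤) :
    ∃ g, IsWeakDerivMu f g := by
  unfold Wnorm at h
  split_ifs at h with h1
  · simp only [iInf_lt_iff] at h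
    obtain ⟨g, hg, -⟩ := h
    exact ⟨g, hg⟩
  · exact absurd h (lt_irrefl _)

theorem inner_eMu (p : R3) : inner ℝ p eMu = p 1 := by
  simp [eMu, EuclideanSpace.inner_single_right]

/-- This brings the weight to the form of `eLpNorm_ift_div_le` with `A = 1 + 2^k`, so its inverse
acts on `L⁴` with norm at most `(1 + 2^k)⁻¹`. -/
theorem vWeight_eq (k : ℤ) (p : R3) :
    (1 + (2 : ℂ) ^ k + Complex.I * (p 1 : ℂ) / (2 : ℂ) ^ k)
      = ((1 + 2 ^ k : ℝ) : ℂ) + 2 * Real.pi *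
        (inner ℝ p ((2 * Real.pi * 2 ^ k)⁻¹ • eMu) : ℝ) * Complex.I := by
  rw [real_inner_smul_right, inner_eMu]
  have h1 : (Real.pi : ℂ) ≠ 0 := by exact_mod_cast Real.pi_ne_zero
  push_cast
  field_simp

theorem vWeight_ne_zero (k : ℤ) (p : R3) :
    (1 + (2 : ℂ) ^ k + Complex.I * (p 1 : ℂ) / (2 : ℂ) ^ k) ≠ 0 := by
  rw [vWeight_eq]
  intro h
  have h1 := congrArg Complex.re h
  have h2 : (0 : ℝ) < 2 ^ k := by positivity
  have h3 : (2 * (Real.pi : ℂ) * ((inner ℝ p ((2 * Real.pi * 2 ^ k)⁻¹ • eMu) : ℝ) : ℂ) * Complex.I).re = 0 := by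
    rw [show (2 * (Real.pi : ℂ) * ((inner ℝ p ((2 * Real.pi * 2 ^ k)⁻¹ • eMu) : ℝ) : ℂ))
      = ((2 * Real.pi * inner ℝ p ((2 * Real.pi * 2 ^ k)⁻¹ • eMu) : ℝ) : ℂ) by push_cast; ring,
      Complex.re_ofReal_mul]
    simp
  rw [Complex.add_re, h3, Complex.ofReal_re, Complex.zero_re] at h1
  linarith

theorem exists_inputBounds (h : IsBasicCutoff μ₀) : ∃ C : ℝ≥0, ∀ (k : ℤ) (f : R3 → ℂ),
    f ∈ V μ₀ k ∩ W μ₀ k → ∃ g, InputBounds (C * VWnorm μ₀ k f) k f g := by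
  obtain ⟨C, hC⟩ := exists_eLpNorm_ift_four_le_XYnorm h
  refine ⟨C, fun k f hf => ?_⟩
  have hV : Vnorm μ₀ k f < ⊤ := hf.1
  have hW : Wnorm μ₀ k f < ⊤ := hf.2
  obtain ⟨hf2, hfs⟩ := isL2Slab_of_Vnorm_lt_top hV
  obtain ⟨g, hg⟩ := exists_weakDeriv_of_Wnorm_lt_top hW
  set M := C * VWnorm μ₀ k f with hM
  set w : R3 → ℂ := fun p => 1 + (2 : ℂ) ^ k + Complex.I * (p 1 : ℂ) / (2 : ℂ) ^ k with hw
  set F : R3 → ℂ := fun p => f p * w p with hF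
  have hVF : XYnorm μ₀ k F ≤ VWnorm μ₀ k f := by
    refine le_trans (le_of_eq ?_) (le_max_left _ _)
    rw [Vnorm, if_pos ⟨hf2, hfs⟩]
  have hF2 : MemLp F 2 volume :=
    memLp_of_XYnorm_lt_top (hVF.trans_lt (max_lt hV hW))
  have hF4 : eLpNorm (ift F) 4 volume ≤ M := (hC k F).trans (by rw [hM]; gcongr)
  have hA : (0 : ℝ) < 1 + 2 ^ k := by positivity
  have hff : (fun q => (((1 + 2 ^ k : ℝ) : ℂ) + 2 * Real.pi *
      (inner ℝ q ((2 * Real.pi * 2 ^ k)⁻¹ • eMu) : ℝ) * Complex.I)⁻¹ * F q) = f := by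
    funext q
    rw [← vWeight_eq]
    show (w q)⁻¹ * (f q * w q) = f q
    rw [mul_comm (f q), inv_mul_cancel_left₀ (vWeight_ne_zero k q)]
  have hf4 : eLpNorm (ift f) 4 volume ≤ ENNReal.ofReal (1 + 2 ^ k)⁻¹ * M := by
    have h1 := (eLpNorm_ift_div_le hA ((2 * Real.pi * 2 ^ k)⁻¹ • eMu) hF2).2
    rw [hff] at h1
    exact h1.trans (by gcongr)
  set c : ℂ := -Complex.I * 2 ^ k with hc
  have hcn : ‖c‖ₑ = ENNReal.ofReal (2 ^ k) := by
    rw [← ofReal_norm, hc]; simp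
  -- Solving the definition of the weighted function `F` for `μ f` avoids a second multiplier
  -- argument: `μ f = c (F - (1 + 2^k) f)` with `c = -i 2^k`.
  have hcoord : (fun p : R3 => (p 1 : ℂ) * f p) = c • F + (-c * ((1 + 2 ^ k : ℝ) : ℂ)) • f := by
    funext p
    simp only [Pi.add_apply, Pi.smul_apply, smul_eq_mul, hF, hw, hc]
    push_cast
    have h2 : (2 : ℂ) ^ k ≠ 0 := zpow_ne_zero _ two_ne_zero
    field_simp
    linear_combination (f p * p 1) * Complex.I_sq
  have hcoord2 : MemLp (fun p : R3 => (p 1 : ℂ) * f p) 2 volume := by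
    rw [hcoord]; exact (hF2.const_smul _).add (hf2.const_smul _)
  have hcoord4 : eLpNorm (ift fun p : R3 => (p 1 : ℂ) * f p) 4 volume
      ≤ ENNReal.ofReal (2 * 2 ^ k) * M := by
    rw [hcoord]
    refine (eLpNorm_ift_four_add_le (hF2.const_smul _) (hf2.const_smul _)).trans ?_
    rw [eLpNorm_ift_four_smul _ hF2, eLpNorm_ift_four_smul _ hf2, enorm_mul (-c), enorm_neg, hcn]
    have h1 : ‖((1 + 2 ^ k : ℝ) : ℂ)‖ₑ = ENNReal.ofReal (1 + 2 ^ k) := by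
      rw [← ofReal_norm, Complex.norm_real, Real.norm_of_nonneg hA.le]
    have h2 : ENNReal.ofReal (1 + 2 ^ k) * ENNReal.ofReal (1 + 2 ^ k)⁻¹ = 1 := by
      rw [← ENNReal.ofReal_mul hA.le, mul_inv_cancel₀ hA.ne', ENNReal.ofReal_one]
    rw [h1]
    calc _ ≤ ENNReal.ofReal (2 ^ k) * M + ENNReal.ofReal (2 ^ k) * ENNReal.ofReal (1 + 2 ^ k) *
          (ENNReal.ofReal (1 + 2 ^ k)⁻¹ * M) := by gcongr
      _ = ENNReal.ofReal (2 ^ k) * M + ENNReal.ofReal (2 ^ k) *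
          (ENNReal.ofReal (1 + 2 ^ k) * ENNReal.ofReal (1 + 2 ^ k)⁻¹) * M := by ring
      _ = _ := by
        rw [h2, ENNReal.ofReal_mul (by norm_num)]
        norm_num
        ring
  have hWF : XYnorm μ₀ k (g + f) ≤ VWnorm μ₀ k f := (XYnorm_add_le_Wnorm hg).trans (le_max_right _ _)
  have hlt : XYnorm μ₀ k (g + f) < ⊤ := hWF.trans_lt (max_lt hV hW)
  have hgf2 := memLp_of_XYnorm_lt_top hlt
  -- The `W_k` norm controls only `g + f`; the remaining `f` is controlled through `V_k`.
  have hgf : g = (g + f) + (-1 : ℂ) • f := by funext p; simp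
  have hg2 : MemLp g 2 volume := by rw [hgf]; exact hgf2.add (hf2.const_smul _)
  have hgs : SupportedIn g (slab k) := by
    filter_upwards [hfs, supportedIn_of_XYnorm_lt_top hlt] with p h1 h2 hp
    have h3 := h2 hp
    rwa [Pi.add_apply, h1 hp, add_zero] at h3
  refine ⟨g, hf2, hfs, hcoord2, hg, hg2, hgs, hf4, hcoord4, ?_⟩
  rw [hgf]
  refine (eLpNorm_ift_four_add_le hgf2 (hf2.const_smul _)).trans ?_
  rw [eLpNorm_ift_four_smul _ hf2]
  have h1 : eLpNorm (ift (g + f)) 4 volume ≤ M := (hC k _).trans (by rw [hM]; gcongr)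
  have h2 : eLpNorm (ift f) 4 volume ≤ M := by
    refine hf4.trans (mul_le_of_le_one_left zero_le ?_)
    rw [ENNReal.ofReal_le_one]
    exact inv_le_one_of_one_le₀ (by linarith [show (0 : ℝ) < 2 ^ k by positivity])
  calc _ ≤ M + ‖(-1 : ℂ)‖ₑ * M := by gcongr
    _ = _ := by rw [enorm_neg, enorm_one]; norm_num; ring

/-! ### Bounds for the convolution -/

theorem memLp_conv_of_le {f g : R3 → ℂ} (hf : MemLp f 2 volume) (hg : MemLp g 2 volume) {a b : ℝ}
    (ha : 0 ≤ a) {M₁ M₂ : ℝ≥0∞} (hM₁ : M₁ < ⊤) (hM₂ : M₂ < ⊤)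
    (hf4 : eLpNorm (ift f) 4 volume ≤ ENNReal.ofReal a * M₁)
    (hg4 : eLpNorm (ift g) 4 volume ≤ ENNReal.ofReal b * M₂) :
    MemLp (conv f g) 2 volume ∧ eLpNorm (conv f g) 2 volume ≤ ENNReal.ofReal (a * b) * (M₁ * M₂) := by
  obtain ⟨h1, h2⟩ := memLp_conv_of_ift_four hf hg
    (hf4.trans_lt (ENNReal.mul_lt_top ENNReal.ofReal_lt_top hM₁))
    (hg4.trans_lt (ENNReal.mul_lt_top ENNReal.ofReal_lt_top hM₂))
  refine ⟨h1, h2.trans ((mul_le_mul' hf4 hg4).trans (le_of_eq ?_))⟩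
  rw [ENNReal.ofReal_mul ha]
  ring

theorem two_zpow_le_of_abs_sub_le {k₁ k₂ : ℤ} (h : |k₁ - k₂| ≤ 100) :
    (2 : ℝ) ^ k₁ ≤ 2 ^ 100 * 2 ^ k₂ := by
  rw [← zpow_natCast, ← zpow_add₀ (by norm_num)]
  refine zpow_le_zpow_right₀ (by norm_num) ?_
  have := (abs_le.1 h).2
  push_cast
  omega

/-- The majorant of the outputs. -/
def majorant (k₁ : ℤ) (H₀ H₁ H₂ : R3 → ℂ) (p : R3) : ℝ :=
  (2 ^ 103) ^ 2 * (2 ^ k₁ * (1 + 2 ^ k₁)) * ‖H₀ p‖ + 4 * ‖H₁ p‖ + 2 ^ 103 * 2 ^ k₁ * ‖H₂ p‖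

theorem memLp_majorant (k₁ : ℤ) {H₀ H₁ H₂ : R3 → ℂ} (h0 : MemLp H₀ 2 volume)
    (h1 : MemLp H₁ 2 volume) (h2 : MemLp H₂ 2 volume) : MemLp (majorant k₁ H₀ H₁ H₂) 2 volume :=
  ((h0.norm.const_mul _).add (h1.norm.const_mul _)).add (h2.norm.const_mul _)

theorem eLpNorm_const_mul_norm {a : ℝ} (ha : 0 ≤ a) (H : R3 → ℂ) :
    eLpNorm (fun p => a * ‖H p‖) 2 volume = ENNReal.ofReal a * eLpNorm H 2 volume := by
  have h1 := eLpNorm_const_smul a (fun p => ‖H p‖) 2 volume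
  rw [eLpNorm_norm, Real.enorm_of_nonneg ha] at h1
  exact h1

theorem eLpNorm_majorant_le (k₁ : ℤ) {H₀ H₁ H₂ : R3 → ℂ} (h0 : MemLp H₀ 2 volume)
    (h1 : MemLp H₁ 2 volume) (h2 : MemLp H₂ 2 volume) :
    eLpNorm (majorant k₁ H₀ H₁ H₂) 2 volume
      ≤ ENNReal.ofReal ((2 ^ 103) ^ 2 * (2 ^ k₁ * (1 + 2 ^ k₁))) * eLpNorm H₀ 2 volume
        + ENNReal.ofReal 4 * eLpNorm H₁ 2 volume
        + ENNReal.ofReal (2 ^ 103 * 2 ^ k₁) * eLpNorm H₂ 2 volume := by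
  rw [← eLpNorm_const_mul_norm (by positivity), ← eLpNorm_const_mul_norm (by positivity),
    ← eLpNorm_const_mul_norm (by positivity)]
  have m0 := h0.norm.const_mul ((2 ^ 103) ^ 2 * ((2 : ℝ) ^ k₁ * (1 + 2 ^ k₁)))
  have m1 := h1.norm.const_mul (4 : ℝ)
  have m2 := h2.norm.const_mul ((2 : ℝ) ^ 103 * 2 ^ k₁)
  refine (eLpNorm_add_le (m0.add m1).1 m2.1 (by norm_num)).trans ?_
  gcongr
  exact eLpNorm_add_le m0.1 m1.1 (by norm_num)

theorem ofReal_mul_add_three {a b c x y z : ℝ} (ha : 0 ≤ a) (hb : 0 ≤ b) (hc : 0 ≤ c) (hx : 0 ≤ x)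
    (hy : 0 ≤ y) (hz : 0 ≤ z) (M : ℝ≥0∞) :
    ENNReal.ofReal a * (ENNReal.ofReal x * M) + ENNReal.ofReal b * (ENNReal.ofReal y * M)
        + ENNReal.ofReal c * (ENNReal.ofReal z * M)
      = ENNReal.ofReal (a * x + b * y + c * z) * M := by
  rw [ENNReal.ofReal_add (by positivity) (by positivity),
    ENNReal.ofReal_add (by positivity) (by positivity), ENNReal.ofReal_mul ha, ENNReal.ofReal_mul hb,
    ENNReal.ofReal_mul hc]
  ring

/-- The weights in the majorant match the `L⁴` bounds of the factors: every product of powers of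
`2^{k₁}` and `2^{k₂}` reduces to `2^{k₁}/(1 + 2^{k₂})` or its mirror image, both at most `2^100`.
The weak derivative is placed on the first factor only. -/
theorem convolution_bounds {k₁ k₂ : ℤ} (hk : |k₁ - k₂| ≤ 100) {M₁ M₂ : ℝ≥0∞} (hM₁ : M₁ < ⊤)
    (hM₂ : M₂ < ⊤) {f₁ g₁ f₂ g₂ : R3 → ℂ} (b₁ : InputBounds M₁ k₁ f₁ g₁)
    (b₂ : InputBounds M₂ k₂ f₂ g₂) :
    MemLp (conv f₁ f₂) 2 volume ∧ MemLp (fun p : R3 => (p 1 : ℂ) * conv f₁ f₂ p) 2 volume ∧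
    MemLp (conv g₁ f₂) 2 volume ∧
    eLpNorm (majorant k₁ (conv f₁ f₂) (fun p : R3 => (p 1 : ℂ) * conv f₁ f₂ p) (conv g₁ f₂)) 2 volume
      ≤ ENNReal.ofReal ((2 ^ 103) ^ 2 * 2 ^ 101) * (M₁ * M₂) := by
  set κ₁ : ℝ := 2 ^ k₁ with hκ₁
  set κ₂ : ℝ := 2 ^ k₂ with hκ₂
  have p1 : 0 < κ₁ := by positivity
  have p2 : 0 < κ₂ := by positivity
  have hle : κ₁ ≤ 2 ^ 100 * κ₂ := two_zpow_le_of_abs_sub_le hk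
  have hle' : κ₂ ≤ 2 ^ 100 * κ₁ := two_zpow_le_of_abs_sub_le (by rwa [abs_sub_comm])
  obtain ⟨m0, n0⟩ := memLp_conv_of_le b₁.memLp b₂.memLp (by positivity) hM₁ hM₂ b₁.four b₂.four
  obtain ⟨m1, n1⟩ := memLp_conv_of_le b₁.memLp_coord b₂.memLp (by positivity) hM₁ hM₂ b₁.four_coord
    b₂.four
  obtain ⟨m1', n1'⟩ := memLp_conv_of_le b₁.memLp b₂.memLp_coord (by positivity) hM₁ hM₂ b₁.four
    b₂.four_coord
  obtain ⟨m2, n2⟩ := memLp_conv_of_le b₁.memLp_deriv b₂.memLp (by norm_num) hM₁ hM₂ b₁.four_deriv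
    b₂.four
  rw [← hκ₁, ← hκ₂] at n0 n1 n1'
  rw [← hκ₂] at n2
  have hc : (fun p : R3 => (p 1 : ℂ) * conv f₁ f₂ p) = conv (fun p => (p 1 : ℂ) * f₁ p) f₂
      + conv f₁ (fun p => (p 1 : ℂ) * f₂ p) :=
    funext fun p => coord_mul_conv b₁.memLp b₂.memLp b₁.memLp_coord b₂.memLp_coord p
  have m3 : MemLp (fun p : R3 => (p 1 : ℂ) * conv f₁ f₂ p) 2 volume := by
    rw [hc]; exact m1.add m1'
  refine ⟨m0, m3, m2, (eLpNorm_majorant_le k₁ m0 m3 m2).trans ?_⟩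
  have n3 : eLpNorm (fun p : R3 => (p 1 : ℂ) * conv f₁ f₂ p) 2 volume
      ≤ ENNReal.ofReal (2 * κ₁ * (1 + κ₂)⁻¹ + (1 + κ₁)⁻¹ * (2 * κ₂)) * (M₁ * M₂) := by
    rw [hc, ENNReal.ofReal_add (by positivity) (by positivity), add_mul]
    exact (eLpNorm_add_le m1.1 m1'.1 (by norm_num)).trans (add_le_add n1 n1')
  rw [← hκ₁]
  calc _ ≤ ENNReal.ofReal ((2 ^ 103) ^ 2 * (κ₁ * (1 + κ₁))) *
          (ENNReal.ofReal ((1 + κ₁)⁻¹ * (1 + κ₂)⁻¹) * (M₁ * M₂))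
        + ENNReal.ofReal 4 *
          (ENNReal.ofReal (2 * κ₁ * (1 + κ₂)⁻¹ + (1 + κ₁)⁻¹ * (2 * κ₂)) * (M₁ * M₂))
        + ENNReal.ofReal (2 ^ 103 * κ₁) * (ENNReal.ofReal (2 * (1 + κ₂)⁻¹) * (M₁ * M₂)) := by
        gcongr
    _ = ENNReal.ofReal ((2 ^ 103) ^ 2 * (κ₁ * (1 + κ₁)) * ((1 + κ₁)⁻¹ * (1 + κ₂)⁻¹)
        + 4 * (2 * κ₁ * (1 + κ₂)⁻¹ + (1 + κ₁)⁻¹ * (2 * κ₂))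
        + 2 ^ 103 * κ₁ * (2 * (1 + κ₂)⁻¹)) * (M₁ * M₂) := by
        exact ofReal_mul_add_three (by positivity) (by positivity) (by positivity) (by positivity)
          (by positivity) (by positivity) _
    _ ≤ _ := by
        gcongr
        have q1 : κ₁ * (1 + κ₂)⁻¹ ≤ 2 ^ 100 := by
          rw [← div_eq_mul_inv, div_le_iff₀ (by positivity)]; linarith
        have q2 : (1 + κ₁)⁻¹ * κ₂ ≤ 2 ^ 100 := by
          rw [mul_comm, ← div_eq_mul_inv, div_le_iff₀ (by positivity)]; linarith
        have q3 : (1 + κ₁) * (1 + κ₁)⁻¹ = 1 := mul_inv_cancel₀ (by positivity)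
        calc _ = (2 ^ 103) ^ 2 * ((1 + κ₁) * (1 + κ₁)⁻¹) * (κ₁ * (1 + κ₂)⁻¹)
              + 8 * (κ₁ * (1 + κ₂)⁻¹) + 8 * ((1 + κ₁)⁻¹ * κ₂)
              + 2 * 2 ^ 103 * (κ₁ * (1 + κ₂)⁻¹) := by ring
          _ ≤ (2 ^ 103) ^ 2 * 1 * 2 ^ 100 + 8 * 2 ^ 100 + 8 * 2 ^ 100 + 2 * 2 ^ 103 * 2 ^ 100 := by
              rw [q3]; gcongr
          _ ≤ _ := by norm_num

/-! ### The output -/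

theorem isL2Slab_of_le {k : ℤ} {G : R3 → ℂ} {H : R3 → ℝ} (hG : AEStronglyMeasurable G volume)
    (hH : MemLp H 2 volume) (h : ∀ p, ‖G p‖ ≤ ‖symb p‖⁻¹ * (slab k).indicator H p) :
    IsL2Slab k G := by
  refine ⟨hH.mono hG (Filter.Eventually.of_forall fun p => (h p).trans ?_),
    Filter.Eventually.of_forall fun p hp => ?_⟩
  · have h1 : ‖symb p‖⁻¹ ≤ 1 := inv_le_one_of_one_le₀ (one_le_norm_symb p)
    have h2 : (slab k).indicator H p ≤ ‖H p‖ := by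
      by_cases hp : p ∈ slab k
      · rw [Set.indicator_of_mem hp]; exact Real.le_norm_self _
      · rw [Set.indicator_of_notMem hp]; exact norm_nonneg _
    calc _ ≤ ‖symb p‖⁻¹ * ‖H p‖ := by gcongr
      _ ≤ _ := mul_le_of_le_one_left (norm_nonneg _) h1
  · have h1 := h p
    rw [Set.indicator_of_notMem hp, mul_zero] at h1
    exact norm_le_zero_iff.1 h1

theorem multiplier_eq_zero (h : IsBasicCutoff μ₀) {k : ℤ} {p : R3} (hp : p ∉ slab k) :
    multiplier μ₀ k p = 0 := by
  have h1 : chi μ₀ k (p 0) = 0 := by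
    by_contra hne
    exact hp (abs_le_of_chi_ne_zero h hne)
  simp [multiplier, h1]

theorem norm_multiplier_le (h : IsBasicCutoff μ₀) (k : ℤ) (p : R3) :
    ‖multiplier μ₀ k p‖ ≤ 2 ^ k * ‖symb p‖⁻¹ := by
  rw [multiplier, norm_mul, norm_mul, norm_inv, norm_zpow, Complex.norm_ofNat, Complex.norm_real]
  have := abs_chi_le_one h k (p 0)
  gcongr
  exact mul_le_of_le_one_right (by positivity) this

/-- On the slab `2^k ≤ 2|ξ|`, and `|ξ| ≤ 2 (2^{k₁} + 2^{k₂})`. Thus `4 (1 + 2^100) ≤ 2^103` is the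
constant. -/
theorem two_zpow_le_of_conv_ne_zero {k k₁ k₂ : ℤ} (hk : |k₁ - k₂| ≤ 100) {f g : R3 → ℂ}
    (hf : SupportedIn f (slab k₁)) (hg : SupportedIn g (slab k₂)) {p : R3} (hp : p ∈ slab k)
    (hne : conv f g p ≠ 0) : (2 : ℝ) ^ k ≤ 2 ^ 103 * 2 ^ k₁ := by
  have h1 : |p 0| ≤ 2 ^ (k₁ + 1) + 2 ^ (k₂ + 1) := by
    by_contra! hlt
    exact hne (conv_eq_zero hf hg hlt)
  have h2 : (2 : ℝ) ^ (k - 1) ≤ |p 0| := hp.1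
  have h3 := two_zpow_le_of_abs_sub_le (k₁ := k₂) (k₂ := k₁) (by rwa [abs_sub_comm])
  rw [zpow_add_one₀ (by norm_num), zpow_add_one₀ (by norm_num)] at h1
  rw [zpow_sub_one₀ (by norm_num)] at h2
  have h4 : (0 : ℝ) < 2 ^ k₁ := by positivity
  linarith

section Output

variable {k k₁ k₂ : ℤ} {f₁ f₂ g₁ : R3 → ℂ}

theorem norm_multiplier_mul_conv_le (h : IsBasicCutoff μ₀) (hk : |k₁ - k₂| ≤ 100)
    (hf : SupportedIn f₁ (slab k₁)) (hg : SupportedIn f₂ (slab k₂)) (p : R3) :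
    ‖multiplier μ₀ k p * conv f₁ f₂ p‖ ≤ ‖symb p‖⁻¹ * (2 ^ 103 * 2 ^ k₁ * ‖conv f₁ f₂ p‖) := by
  by_cases hp : p ∈ slab k
  · rcases eq_or_ne (conv f₁ f₂ p) 0 with h0 | h0
    · simp [h0]
    · have h1 := two_zpow_le_of_conv_ne_zero hk hf hg hp h0
      rw [norm_mul]
      calc _ ≤ 2 ^ k * ‖symb p‖⁻¹ * ‖conv f₁ f₂ p‖ := by gcongr; exact norm_multiplier_le h k p
        _ = ‖symb p‖⁻¹ * (2 ^ k * ‖conv f₁ f₂ p‖) := by ring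
        _ ≤ _ := by gcongr
  · rw [multiplier_eq_zero h hp, zero_mul, norm_zero]; positivity

/-- The part `1 + 2^k` of the weight is compared with `1 + 2^{k₁}`. In the part `iμ/2^k` the
denominator cancels the factor `2^k` of the multiplier, leaving exactly `μ (f₁ * f₂)`. -/
theorem norm_outputPiece_mul_vWeight_le (h : IsBasicCutoff μ₀) (hk : |k₁ - k₂| ≤ 100)
    (hf : SupportedIn f₁ (slab k₁)) (hg : SupportedIn f₂ (slab k₂)) (H₂ : R3 → ℂ) (p : R3) :
    ‖multiplier μ₀ k p * conv f₁ f₂ p *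
      (1 + (2 : ℂ) ^ k + Complex.I * (p 1 : ℂ) / (2 : ℂ) ^ k)‖
      ≤ ‖symb p‖⁻¹ * (slab k).indicator
        (majorant k₁ (conv f₁ f₂) (fun p : R3 => (p 1 : ℂ) * conv f₁ f₂ p) H₂) p := by
  by_cases hp : p ∈ slab k
  · rw [Set.indicator_of_mem hp]
    set H₀ := conv f₁ f₂ p with hH
    have e1 : multiplier μ₀ k p * H₀ * (1 + (2 : ℂ) ^ k + Complex.I * (p 1 : ℂ) / (2 : ℂ) ^ k)
        = multiplier μ₀ k p * H₀ * (1 + (2 : ℂ) ^ k)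
          + multiplier μ₀ k p / (2 : ℂ) ^ k * (Complex.I * ((p 1 : ℂ) * H₀)) := by ring
    have e2 : ‖multiplier μ₀ k p / (2 : ℂ) ^ k * (Complex.I * ((p 1 : ℂ) * H₀))‖
        ≤ ‖symb p‖⁻¹ * ‖(p 1 : ℂ) * H₀‖ := by
      rw [norm_mul, norm_mul Complex.I, Complex.norm_I, one_mul, norm_div, norm_zpow,
        Complex.norm_ofNat]
      gcongr
      rw [div_le_iff₀ (by positivity), mul_comm]
      exact norm_multiplier_le h k p
    have e3 : ‖multiplier μ₀ k p * H₀ * (1 + (2 : ℂ) ^ k)‖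
        ≤ ‖symb p‖⁻¹ * ((2 ^ 103) ^ 2 * (2 ^ k₁ * (1 + 2 ^ k₁)) * ‖H₀‖) := by
      rcases eq_or_ne H₀ 0 with h0 | h0
      · simp [h0]
      · have h1 := two_zpow_le_of_conv_ne_zero hk hf hg hp h0
        have h2 : ‖1 + (2 : ℂ) ^ k‖ ≤ 2 ^ 103 * (1 + 2 ^ k₁) := by
          refine (norm_add_le _ _).trans ?_
          rw [norm_one, norm_zpow, Complex.norm_ofNat]
          linarith
        rw [norm_mul]
        calc _ ≤ ‖symb p‖⁻¹ * (2 ^ 103 * 2 ^ k₁ * ‖H₀‖) * (2 ^ 103 * (1 + 2 ^ k₁)) := by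
              gcongr; exact norm_multiplier_mul_conv_le h hk hf hg p
          _ = _ := by ring
    rw [e1]
    refine (norm_add_le _ _).trans ((add_le_add e3 e2).trans ?_)
    rw [← mul_add, majorant]
    refine mul_le_mul_of_nonneg_left ?_ (by positivity)
    have h5 : 0 ≤ ‖(p 1 : ℂ) * H₀‖ := norm_nonneg _
    have h6 : 0 ≤ 2 ^ 103 * 2 ^ k₁ * ‖H₂ p‖ := by positivity
    simp only [← hH]
    linarith
  · rw [multiplier_eq_zero h hp, zero_mul, zero_mul, norm_zero, Set.indicator_of_notMem hp, mul_zero]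

/-- The derivative brings down `2μ/ξ` and a second inverse symbol. On the slab `2^k/|ξ| ≤ 2`, and
the extra inverse symbol is bounded by `1`. -/
theorem norm_fderiv_multiplier_mul_le (h : IsBasicCutoff μ₀) (z : ℂ) {p : R3} (hp : p ∈ slab k) :
    ‖fderiv ℝ (multiplier μ₀ k) p eMu * z‖ ≤ ‖symb p‖⁻¹ * (4 * ‖(p 1 : ℂ) * z‖) := by
  have h1 : (2 : ℝ) ^ (k - 1) ≤ |p 0| := hp.1
  rw [zpow_sub_one₀ (by norm_num)] at h1
  have h0 : 0 < |p 0| := lt_of_lt_of_le (by positivity) h1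
  have h2 : ‖symb p‖⁻¹ ≤ 1 := inv_le_one_of_one_le₀ (one_le_norm_symb p)
  have h3 : (2 : ℝ) ^ k / |p 0| ≤ 2 := by
    rw [div_le_iff₀ h0]; linarith
  rw [fderiv_multiplier h, norm_mul, norm_mul, norm_mul, norm_mul, norm_inv, Complex.norm_ofNat,
    Complex.norm_real, norm_div, norm_mul, Complex.norm_real]
  simp only [Real.norm_eq_abs]
  calc _ ≤ 2 ^ k * ‖symb p‖⁻¹ * (2 * (|p 1| / |p 0|)) * 1 * ‖z‖ := by
        gcongr; exact norm_multiplier_le h k p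
    _ = ‖symb p‖⁻¹ * (2 * (2 ^ k / |p 0|) * (|p 1| * ‖z‖)) := by ring
    _ ≤ ‖symb p‖⁻¹ * (2 * 2 * (|p 1| * ‖z‖)) := by gcongr
    _ = _ := by ring

/-- Bounding the sum of the two norms serves the output, its derivative and the sum of both at once.
-/
theorem norm_outputDeriv_add_le (h : IsBasicCutoff μ₀) (hk : |k₁ - k₂| ≤ 100)
    (hf : SupportedIn f₁ (slab k₁)) (hg : SupportedIn f₂ (slab k₂))
    (hf' : SupportedIn g₁ (slab k₁)) (p : R3) :
    ‖fderiv ℝ (multiplier μ₀ k) p eMu * conv f₁ f₂ p + multiplier μ₀ k p * conv g₁ f₂ p‖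
        + ‖multiplier μ₀ k p * conv f₁ f₂ p‖
      ≤ ‖symb p‖⁻¹ * (slab k).indicator
        (majorant k₁ (conv f₁ f₂) (fun p : R3 => (p 1 : ℂ) * conv f₁ f₂ p) (conv g₁ f₂)) p := by
  by_cases hp : p ∈ slab k
  · rw [Set.indicator_of_mem hp]
    have e1 := norm_fderiv_multiplier_mul_le (k := k) h (conv f₁ f₂ p) hp
    have e2 := norm_multiplier_mul_conv_le (k := k) h hk hf hg p
    have e3 := norm_multiplier_mul_conv_le (k := k) h hk hf' hg p
    have e4 : 2 ^ 103 * 2 ^ k₁ * ‖conv f₁ f₂ p‖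
        ≤ (2 ^ 103) ^ 2 * (2 ^ k₁ * (1 + 2 ^ k₁)) * ‖conv f₁ f₂ p‖ := by
      have h1 : (0 : ℝ) < 2 ^ k₁ := by positivity
      gcongr ?_ * _
      nlinarith
    calc _ ≤ ‖fderiv ℝ (multiplier μ₀ k) p eMu * conv f₁ f₂ p‖
          + ‖multiplier μ₀ k p * conv g₁ f₂ p‖ + ‖multiplier μ₀ k p * conv f₁ f₂ p‖ := by
          gcongr; exact norm_add_le _ _
      _ ≤ ‖symb p‖⁻¹ * (4 * ‖(p 1 : ℂ) * conv f₁ f₂ p‖)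
          + ‖symb p‖⁻¹ * (2 ^ 103 * 2 ^ k₁ * ‖conv g₁ f₂ p‖)
          + ‖symb p‖⁻¹ * (2 ^ 103 * 2 ^ k₁ * ‖conv f₁ f₂ p‖) := by gcongr
      _ = ‖symb p‖⁻¹ * (4 * ‖(p 1 : ℂ) * conv f₁ f₂ p‖ + 2 ^ 103 * 2 ^ k₁ * ‖conv g₁ f₂ p‖
          + 2 ^ 103 * 2 ^ k₁ * ‖conv f₁ f₂ p‖) := by ring
      _ ≤ _ := by
          rw [majorant]
          refine mul_le_mul_of_nonneg_left ?_ (by positivity)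
          linarith
  · have h1 : fderiv ℝ (multiplier μ₀ k) p eMu = 0 := by
      rw [fderiv_multiplier h, multiplier_eq_zero h hp]; simp
    rw [h1, multiplier_eq_zero h hp, Set.indicator_of_notMem hp]
    simp

/-- The norm of an output in `V_k ∩ W_k` is controlled by the `L²` norm of the majorant on
the slab. -/
theorem VWnorm_outputPiece_le (h : IsBasicCutoff μ₀) {C : ℝ≥0∞}
    (hC : ∀ (k : ℤ) (G : R3 → ℂ) (H : R3 → ℝ), IsL2Slab k G → AEMeasurable H volume →
      (∀ᵐ p, ‖G p‖ ≤ ‖symb p‖⁻¹ * H p) → Xnorm μ₀ k G ≤ C * eLpNorm H 2 volume)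
    (hk : |k₁ - k₂| ≤ 100) {M₁ M₂ : ℝ≥0∞} (hM₁ : M₁ < ⊤) (hM₂ : M₂ < ⊤) {g₂ : R3 → ℂ}
    (b₁ : InputBounds M₁ k₁ f₁ g₁) (b₂ : InputBounds M₂ k₂ f₂ g₂) :
    VWnorm μ₀ k (outputPiece μ₀ k (conv f₁ f₂)) ≤ C * eLpNorm ((slab k).indicator
      (majorant k₁ (conv f₁ f₂) (fun p : R3 => (p 1 : ℂ) * conv f₁ f₂ p) (conv g₁ f₂))) 2 volume := by
  obtain ⟨m0, m1, m2, -⟩ := convolution_bounds hk hM₁ hM₂ b₁ b₂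
  set H := majorant k₁ (conv f₁ f₂) (fun p : R3 => (p 1 : ℂ) * conv f₁ f₂ p) (conv g₁ f₂) with hH
  have hH2 : MemLp H 2 volume := memLp_majorant k₁ m0 m1 m2
  have hS : MeasurableSet (slab k) :=
    (by fun_prop : Measurable fun p : R3 => p 0) (measurableSet_I k)
  have hHm : AEMeasurable ((slab k).indicator H) volume := hH2.1.aemeasurable.indicator hS
  set F : R3 → ℂ := fun p => multiplier μ₀ k p * conv f₁ f₂ p with hF
  set G : R3 → ℂ := fun p =>
    fderiv ℝ (multiplier μ₀ k) p eMu * conv f₁ f₂ p + multiplier μ₀ k p * conv g₁ f₂ p with hG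
  have hΘ := contDiff_multiplier h k
  have hFm : AEStronglyMeasurable F volume := hΘ.continuous.aestronglyMeasurable.mul m0.1
  have hGm : AEStronglyMeasurable G volume :=
    ((continuous_fderiv_eMu hΘ).aestronglyMeasurable.mul m0.1).add
      (hΘ.continuous.aestronglyMeasurable.mul m2.1)
  have hFG := norm_outputDeriv_add_le (k := k) h hk b₁.supported b₂.supported b₁.supported_deriv
  have hFs : IsL2Slab k F := isL2Slab_of_le hFm hH2 fun p =>
    (le_add_of_nonneg_left (norm_nonneg _)).trans (hFG p)
  have hGs : IsL2Slab k G := isL2Slab_of_le hGm hH2 fun p =>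
    (le_add_of_nonneg_right (norm_nonneg _)).trans (hFG p)
  have hGFle : ∀ p, ‖(G + F) p‖ ≤ ‖symb p‖⁻¹ * (slab k).indicator H p := fun p =>
    (norm_add_le _ _).trans (hFG p)
  have hGF : IsL2Slab k (G + F) := isL2Slab_of_le (hGm.add hFm) hH2 hGFle
  have hw : IsWeakDerivMu F G :=
    (b₁.weakDeriv.conv b₁.memLp b₁.memLp_deriv b₂.memLp m0 m2).mul hΘ
      (locallyIntegrable_of_memLp_two hFs.1) (locallyIntegrable_of_memLp_two hGs.1)
  have hFw := norm_outputPiece_mul_vWeight_le (k := k) h hk b₁.supported b₂.supported (conv g₁ f₂)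
  have hFwm : AEStronglyMeasurable (fun p : R3 => F p *
      (1 + (2 : ℂ) ^ k + Complex.I * (p 1 : ℂ) / (2 : ℂ) ^ k)) volume :=
    hFm.mul (Measurable.aestronglyMeasurable (by fun_prop))
  have hout : outputPiece μ₀ k (conv f₁ f₂) = F := rfl
  rw [hout]
  refine max_le ?_ ?_
  · rw [Vnorm, if_pos hFs]
    exact (XYnorm_le_Xnorm _ _).trans (hC k _ _ (isL2Slab_of_le hFwm hH2 hFw) hHm
      (Filter.Eventually.of_forall hFw))
  · rw [Wnorm, if_pos hFs]
    exact (iInf₂_le G hw).trans ((XYnorm_le_Xnorm _ _).trans (hC k _ _ hGF hHm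
      (Filter.Eventually.of_forall hGFle)))

end Output

theorem sum_VWnorm_outputPiece_le (h : IsBasicCutoff μ₀) : ∃ C : ℝ≥0, ∀ (k₁ k₂ : ℤ) (f₁ f₂ : R3 → ℂ),
    |k₁ - k₂| ≤ 100 → f₁ ∈ V μ₀ k₁ ∩ W μ₀ k₁ → f₂ ∈ V μ₀ k₂ ∩ W μ₀ k₂ →
    (∀ k : ℤ, outputPiece μ₀ k (conv f₁ f₂) ∈ V μ₀ k ∩ W μ₀ k) ∧
    (∑' k : ℤ, VWnorm μ₀ k (outputPiece μ₀ k (conv f₁ f₂)) ^ (2 : ℝ)) ^ (1 / 2 : ℝ)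
      ≤ C * VWnorm μ₀ k₁ f₁ * VWnorm μ₀ k₂ f₂ := by
  obtain ⟨A, hA⟩ := exists_inputBounds h
  obtain ⟨B, hB⟩ := exists_Xnorm_le h
  refine ⟨B * 2 * ((2 ^ 103) ^ 2 * 2 ^ 101 : ℝ).toNNReal * A * A, fun k₁ k₂ f₁ f₂ hk hf₁ hf₂ => ?_⟩
  obtain ⟨g₁, b₁⟩ := hA k₁ f₁ hf₁
  obtain ⟨g₂, b₂⟩ := hA k₂ f₂ hf₂
  have hM₁ : A * VWnorm μ₀ k₁ f₁ < ⊤ := ENNReal.mul_lt_top ENNReal.coe_lt_top (max_lt hf₁.1 hf₁.2)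
  have hM₂ : A * VWnorm μ₀ k₂ f₂ < ⊤ := ENNReal.mul_lt_top ENNReal.coe_lt_top (max_lt hf₂.1 hf₂.2)
  obtain ⟨m0, m1, m2, hle⟩ := convolution_bounds hk hM₁ hM₂ b₁ b₂
  have hk' := fun k : ℤ => VWnorm_outputPiece_le (k := k) h hB hk hM₁ hM₂ b₁ b₂
  set H := majorant k₁ (conv f₁ f₂) (fun p : R3 => (p 1 : ℂ) * conv f₁ f₂ p) (conv g₁ f₂)
  have hH2 : MemLp H 2 volume := memLp_majorant k₁ m0 m1 m2
  constructor
  · intro k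
    have hS : MeasurableSet (slab k) :=
      (by fun_prop : Measurable fun p : R3 => p 0) (measurableSet_I k)
    have h1 := (hk' k).trans_lt (ENNReal.mul_lt_top ENNReal.coe_lt_top (hH2.indicator hS).2)
    exact ⟨(le_max_left _ _).trans_lt h1, (le_max_right _ _).trans_lt h1⟩
  · have h1 : ∑' k : ℤ, VWnorm μ₀ k (outputPiece μ₀ k (conv f₁ f₂)) ^ (2 : ℝ)
        ≤ (B * 2 * eLpNorm H 2 volume) ^ (2 : ℝ) := by
      calc _ ≤ ∑' k : ℤ, (B : ℝ≥0∞) ^ (2 : ℝ) * eLpNorm ((slab k).indicator H) 2 volume ^ (2 : ℝ) := by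
            refine ENNReal.tsum_le_tsum fun k => ?_
            rw [← ENNReal.mul_rpow_of_nonneg _ _ (by norm_num)]
            exact ENNReal.rpow_le_rpow (hk' k) (by norm_num)
        _ ≤ (B : ℝ≥0∞) ^ (2 : ℝ) * (3 * eLpNorm H 2 volume ^ (2 : ℝ)) := by
            rw [ENNReal.tsum_mul_left]
            gcongr
            exact tsum_eLpNorm_slab_le hH2.1.aemeasurable
        -- The overlap constant `3` is rounded up to a perfect square.
        _ ≤ (B : ℝ≥0∞) ^ (2 : ℝ) * (2 ^ (2 : ℝ) * eLpNorm H 2 volume ^ (2 : ℝ)) := by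
            gcongr; norm_num
        _ = _ := by
            rw [ENNReal.mul_rpow_of_nonneg _ _ (by norm_num),
              ENNReal.mul_rpow_of_nonneg _ _ (by norm_num), mul_assoc]
    calc _ ≤ ((B * 2 * eLpNorm H 2 volume) ^ (2 : ℝ)) ^ (1 / 2 : ℝ) := ENNReal.rpow_le_rpow h1 (by norm_num)
      _ = B * 2 * eLpNorm H 2 volume := by rw [← ENNReal.rpow_mul]; norm_num
      _ ≤ B * 2 * (ENNReal.ofReal ((2 ^ 103) ^ 2 * 2 ^ 101) * (A * VWnorm μ₀ k₁ f₁ * (A * VWnorm μ₀ k₂ f₂))) := by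
          gcongr
      _ = _ := by
          simp only [ENNReal.coe_mul, ENNReal.coe_ofNat, ENNReal.ofNNReal_toNNReal]
          ring

end KPI
end

theorem proposition10p1 (μ₀ : ℝ → ℝ) (hμ₀ : KPI.IsBasicCutoff μ₀) :
    ∃ C : ℝ≥0, ∀ (k₁ k₂ : ℤ) (f₁ f₂ : KPI.R3 → ℂ), |k₁ - k₂| ≤ 100 →
      f₁ ∈ KPI.V μ₀ k₁ ∩ KPI.W μ₀ k₁ → f₂ ∈ KPI.V μ₀ k₂ ∩ KPI.W μ₀ k₂ →
      (∀ k : ℤ, KPI.outputPiece μ₀ k (KPI.conv f₁ f₂) ∈ KPI.V μ₀ k ∩ KPI.W μ₀ k) ∧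
      (∑' k : ℤ, KPI.VWnorm μ₀ k (KPI.outputPiece μ₀ k (KPI.conv f₁ f₂)) ^ (2 : ℝ)) ^ (1 / 2 : ℝ)
        ≤ (C : ℝ≥0∞) * KPI.VWnorm μ₀ k₁ f₁ * KPI.VWnorm μ₀ k₂ f₂ :=
  KPI.sum_VWnorm_outputPiece_le hμ₀
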